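/- Let $d\ge 1$, let $A=d\cdot\Delta_2\cap\mathbb Z^2=\{(i,j)\in\mathbb Z^2 : i,j\ge 0,\ i+j\le d\}$ and $A^\diamond=\{(i,j)\in\mathbb Z^2 : |i|+|j|\le d\}$. A *sign distribution* is a function $\sigma:A\to\mathbb F_2$; it is extended to $A^\diamond$ by $\sigma(i,-j)=\sigma(i,j)+j$, $\sigma(-i,j)=\sigma(i,j)+i$, $\sigma(-i,-j)=\sigma(i,j)+i+j$ for $(i,j)\in A$. A *unimodular triangulation* $\mathcal T$ of $A$ is a (not necessarily regular) triangulation of $d\cdot\Delta_2=\operatorname{conv}\{(0,0),(d,0),(0,d)\}$ with vertices in $A$ all of whose triangles have area $\tfrac12$. Reflecting $\mathcal T$ at the coordinate axes gives a triangulation $\mathcal T^\diamond$ of the diamond $|x|+|y|\le d$, and identifying antipodal points of the boundary of the diamond gives a cell decomposition of $\mathbb{RP}^2$ with vertex set $A^\diamond/{\equiv}$. The *patchworked curve* $\mathcal C(\mathcal T,\sigma)\subset\mathbb{RP}^2$ is the union, over all triangles of $\mathcal T^\diamond$ and all edges of that triangle whose endpoints have distinct signs, of the segment from the barycenter of the triangle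 to the midpoint of the edge. The *regions* of $(\mathcal T,\sigma)$ are the connected components of the graph on $A^\diamond/{\equiv}$ that is obtained from the $1$-skeleton of the cell decomposition by deleting the edges whose endpoints have distinct signs (signs being read off in $A^\diamond$). An *oval* is a connected component of the curve whose complement in $\mathbb{RP}^2$ is disconnected, and thus consists of an open disk, the *inside* of the oval, and an open Möbius strip. The *root region* is the region that lies in the inside of no oval. Two patchworked curves $\mathcal C(\mathcal T,\sigma)$ and $\mathcal C(\mathcal T',\sigma')$ are *root isotopic* if they are ambient isotopic in $\mathbb{RP}^2$ and some vertex in $A^\diamond/{\equiv}$ lies in the root region of both. **Theorem.** Let $\sigma:A\to\mathbb F_2$ be a sign distribution such that for any two unimodular triangulations $\mathcal T,\mathcal T'$ of $A$ the patchworked curves $\mathcal C(\mathcal T,\sigma)$ and $\mathcal C(\mathcal T',\sigma)$ are root isotopic. Then $\sigma$ is equivalent to the Harnack sign distribution $\eta(i,j)=(i+1)(j+1) \bmod 2$; that is, there are $\epsilon\in\mathbb F_2$ and a map $g(x,y)=(\pm x,\pm y)$ in the Klein four-group generated by the reflections at the coordinate axes such that $\eta(u)=\epsilon+\sigma(g(u))$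 for all $u\in A$. -/

import Mathlib

namespace TCurve

noncomputable section

/-! ### Lattice points, sign distributions -/

/-- The lattice points `A = d·Δ₂ ∩ ℤ²` of the dilated standard triangle. -/
def latticeTriangle (d : ℕ) : Set (ℤ × ℤ) :=
  {p | 0 ≤ p.1 ∧ 0 ≤ p.2 ∧ p.1 + p.2 ≤ d}

/-- The lattice points `A^⋄` of the diamond `|x| + |y| ≤ d`. -/
def latticeDiamond (d : ℕ) : Set (ℤ × ℤ) :=
  {p | |p.1| + |p.2| ≤ d}

/-- A sign distribution of degree `d`: a function `A → 𝔽₂`. -/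
abbrev SignDistribution (d : ℕ) : Type := latticeTriangle d → ZMod 2

/-- Each lattice point of the diamond has a mirror image in the positive quadrant. -/
def foldPoint {d : ℕ} (u : latticeDiamond d) : latticeTriangle d :=
  ⟨(|u.1.1|, |u.1.2|), abs_nonneg _, abs_nonneg _, u.2⟩

/-- The extension of a sign distribution to the diamond:
`σ(i,-j) = σ(i,j) + j`, `σ(-i,j) = σ(i,j) + i`, `σ(-i,-j) = σ(i,j) + i + j` for `(i,j) ∈ A`. -/
def extendSign {d : ℕ} (σ : SignDistribution d) (u : latticeDiamond d) : ZMod 2 :=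
  σ (foldPoint u) + (if u.1.1 < 0 then (u.1.1 : ZMod 2) else 0)
    + (if u.1.2 < 0 then (u.1.2 : ZMod 2) else 0)

/-- The Klein four-group generated by the reflections at the two coordinate axes:
`g = (a, b)` with `a, b = ±1` is the linear map `(x, y) ↦ (a x, b y)`. -/
abbrev Klein : Type := ℤˣ × ℤˣ

/-- The copy in the diamond of a point of `A` under the reflection `g`. -/
def reflect {d : ℕ} (g : Klein) (p : latticeTriangle d) : latticeDiamond d :=
  ⟨((g.1 : ℤ) * p.1.1, (g.2 : ℤ) * p.1.2), by
    obtain ⟨⟨x, y⟩, hx, hy, hxy⟩ := p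
    have key : ∀ (e : ℤˣ) (z : ℤ), |(e : ℤ) * z| = |z| := by
      intro e z
      rcases Int.units_eq_one_or e with h | h <;> simp [h]
    simp only at hx hy hxy
    simp only [latticeDiamond, Set.mem_ofPred_eq, key, abs_of_nonneg hx, abs_of_nonneg hy]
    exact hxy⟩

/-- Two sign distributions are equivalent if `σ'(u) = ε + σ(g u)` on `A` for some `g` in the Klein
four-group of axis reflections and some `ε ∈ 𝔽₂`. -/
def SignEquivalent {d : ℕ} (σ σ' : SignDistribution d) : Prop :=
  ∃ (g : Klein) (ε : ZMod 2), ∀ u : latticeTriangle d, σ' u = ε + extendSign σ (reflect g u)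

/-- The Harnack sign distribution `η(i,j) = (i+1)(j+1)` modulo two. -/
def harnackSign (d : ℕ) : SignDistribution d :=
  fun u => ((u.1.1 + 1) * (u.1.2 + 1) : ℤ)

/-! ### Unimodular triangulations -/

/-- A lattice point as a point of the real plane. -/
def toPlane (p : ℤ × ℤ) : ℝ × ℝ := (p.1, p.2)

/-- Euclidean area of the triangle with vertices `p`, `q`, `r`. -/
def triangleArea (p q r : ℝ × ℝ) : ℝ :=
  |(q.1 - p.1) * (r.2 - p.2) - (r.1 - p.1) * (q.2 - p.2)| / 2

/-- `T` is a unimodular triangulation of `A = d·Δ₂ ∩ ℤ²`: a simplicial complex which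
triangulates `d·Δ₂`, whose vertices belong to `A`, and all of whose triangles have area `1/2`. It
need not be regular. -/
structure IsUnimodularTriangulation (d : ℕ) (T : Geometry.SimplicialComplex ℝ (ℝ × ℝ)) :
    Prop where
  space_eq : T.space = convexHull ℝ {((0 : ℝ), (0 : ℝ)), ((d : ℝ), (0 : ℝ)), ((0 : ℝ), (d : ℝ))}
  vertices_subset : T.vertices ⊆ toPlane '' latticeTriangle d
  area_eq : ∀ p q r : ℝ × ℝ, p ≠ q → p ≠ r → q ≠ r → {p, q, r} ∈ T.faces →
    triangleArea p q r = 1 / 2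

/-- `p` and `q` are the two ends of an edge of `T`. -/
def IsEdge {d : ℕ} (T : Geometry.SimplicialComplex ℝ (ℝ × ℝ)) (p q : latticeTriangle d) : Prop :=
  p ≠ q ∧ {toPlane p, toPlane q} ∈ T.faces

/-- `p`, `q` and `r` are the three corners of a triangle of `T`. -/
def IsTriangle {d : ℕ} (T : Geometry.SimplicialComplex ℝ (ℝ × ℝ)) (p q r : latticeTriangle d) :
    Prop :=
  p ≠ q ∧ p ≠ r ∧ q ≠ r ∧ {toPlane p, toPlane q, toPlane r} ∈ T.faces

/-! ### The projective plane as a quotient of the diamond -/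

/-- The real diamond `|x| + |y| ≤ d`. -/
def diamond (d : ℕ) : Set (ℝ × ℝ) := {x | |x.1| + |x.2| ≤ d}

/-- Antipodal points of the boundary of the diamond are identified. -/
def antipodal (d : ℕ) : Setoid (diamond d) where
  r x y := x = y ∨ (|x.1.1| + |x.1.2| = d ∧ y.1 = -x.1)
  iseqv :=
    { refl := fun _ => Or.inl rfl
      symm := by
        rintro x y (h | ⟨h, h'⟩)
        · exact Or.inl h.symm
        · exact Or.inr ⟨by simpa [h'] using h, by simp [h']⟩
      trans := by
        rintro x y z (rfl | ⟨h, h'⟩) (rfl | ⟨k, k'⟩)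
        · exact Or.inl rfl
        · exact Or.inr ⟨k, k'⟩
        · exact Or.inr ⟨h, h'⟩
        · exact Or.inl (Subtype.ext (by simp [h', k'])) }

/-- The real projective plane, for `d ≥ 1`, with the quotient topology: the diamond with antipodal
boundary points identified. The space depends on `d` only, not on a triangulation. -/
abbrev ProjPlane (d : ℕ) : Type := Quotient (antipodal d)

/-- The point of the projective plane given by a lattice point of the diamond. -/
def latticePoint {d : ℕ} (u : latticeDiamond d) : ProjPlane d :=
  Quotient.mk (antipodal d) ⟨toPlane u, by
    have h : |u.1.1| + |u.1.2| ≤ (d : ℤ) := u.2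
    have h' : ((|u.1.1| + |u.1.2| : ℤ) : ℝ) ≤ ((d : ℤ) : ℝ) := Int.cast_le.mpr h
    simpa [diamond, toPlane] using h'⟩

/-- The vertex set `A^⋄/≡` of the cell decomposition of the projective plane. -/
abbrev Vertex (d : ℕ) : Type := Set.range (latticePoint (d := d))

/-! ### The patchworked curve -/

/-- The patchworked curve `C(T, σ)`, as a polygonal subset of the projective plane. For each of the
four reflected copies of each triangle of `T` and each edge of that copy whose endpoints have
distinct signs, it contains the segment from the midpoint of the edge to the barycenter of the
triangle. The two such segments at an edge form the dual edge, drawn in the first barycentric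
subdivision. -/
def patchworkedCurve {d : ℕ} (T : Geometry.SimplicialComplex ℝ (ℝ × ℝ)) (σ : SignDistribution d) :
    Set (ProjPlane d) :=
  Quotient.mk (antipodal d) '' {x | ∃ (g : Klein) (p q r : latticeTriangle d),
    IsTriangle T p q r ∧ extendSign σ (reflect g p) ≠ extendSign σ (reflect g q) ∧
    x.1 ∈ segment ℝ
      ((1 / 2 : ℝ) • (toPlane (reflect g p) + toPlane (reflect g q)))
      ((1 / 3 : ℝ) • (toPlane (reflect g p) + toPlane (reflect g q) + toPlane (reflect g r)))}

/-! ### Regions, ovals, and the root region -/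

/-- The `1`-skeleton of the cell decomposition of the projective plane induced by `T`, with all
edges removed whose endpoints have distinct signs. The signs of the endpoints are read off in the
diamond: for odd `d`, antipodal boundary points carry opposite signs. -/
def monochromaticGraph {d : ℕ} (T : Geometry.SimplicialComplex ℝ (ℝ × ℝ))
    (σ : SignDistribution d) : SimpleGraph (Vertex d) :=
  SimpleGraph.fromRel fun v w => ∃ (g : Klein) (p q : latticeTriangle d),
    IsEdge T p q ∧ extendSign σ (reflect g p) = extendSign σ (reflect g q) ∧
    v.1 = latticePoint (reflect g p) ∧ w.1 = latticePoint (reflect g q)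

/-- The regions induced by `σ`: connected components of the `1`-skeleton without its bicolored
edges. -/
abbrev Region {d : ℕ} (T : Geometry.SimplicialComplex ℝ (ℝ × ℝ)) (σ : SignDistribution d) : Type :=
  (monochromaticGraph T σ).ConnectedComponent

/-- `O` is an oval of the curve `C`: a connected component of `C` whose complement is
disconnected. -/
def IsOval {X : Type*} [TopologicalSpace X] (C O : Set X) : Prop :=
  (∃ x ∈ C, O = connectedComponentIn C x) ∧ ¬ IsPreconnected Oᶜ

/-- The inside of an oval `O` in the projective plane `X`. The complement of `O` consists of an
open disk, which is the inside, and an open Möbius strip. The disk is the component in which every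
loop is contractible in `X`; the core of the Möbius strip is not contractible in `X`. -/
def ovalInside {X : Type*} [TopologicalSpace X] (O : Set X) : Set X :=
  {x | x ∈ Oᶜ ∧ ∀ (y : X) (γ : Path y y), Set.range γ ⊆ connectedComponentIn Oᶜ x →
    γ.Homotopic (Path.refl y)}

/-- A region is a root region if it lies in the inside of no oval of the patchworked curve. -/
def IsRootRegion {d : ℕ} (T : Geometry.SimplicialComplex ℝ (ℝ × ℝ)) (σ : SignDistribution d)
    (R : Region T σ) : Prop :=
  ∀ O : Set (ProjPlane d), IsOval (patchworkedCurve T σ) O → ¬ ∀ v ∈ R.supp, v.1 ∈ ovalInside O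

/-- The vertex `v` lies in the root region of the patchworked curve. -/
def InRootRegion {d : ℕ} (T : Geometry.SimplicialComplex ℝ (ℝ × ℝ)) (σ : SignDistribution d)
    (v : Vertex d) : Prop :=
  ∃ R : Region T σ, IsRootRegion T σ R ∧ v ∈ R.supp

/-! ### Root isotopy -/

/-- Two subsets of a topological space are ambient isotopic. -/
def AmbientIsotopic {X : Type*} [TopologicalSpace X] (C C' : Set X) : Prop :=
  ∃ H : C(unitInterval × X, X), (∀ x, H (0, x) = x) ∧
    (∀ t, IsHomeomorph fun x => H (t, x)) ∧ (fun x => H (1, x)) '' C = C'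

/-- The patchworked curves of `(T, σ)` and `(T', σ')` are root isotopic: they are ambient isotopic
and some vertex lies in the root region of both. -/
def RootIsotopic {d : ℕ} (T : Geometry.SimplicialComplex ℝ (ℝ × ℝ)) (σ : SignDistribution d)
    (T' : Geometry.SimplicialComplex ℝ (ℝ × ℝ)) (σ' : SignDistribution d) : Prop :=
  AmbientIsotopic (patchworkedCurve T σ) (patchworkedCurve T' σ') ∧
    ∃ v : Vertex d, InRootRegion T σ v ∧ InRootRegion T' σ' v

end

end TCurve

/-!
The theorem follows from the effect of a single flip of the honeycomb triangulation, whose edges are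
parallel to the sides of the triangle.

The projective plane is the quotient of the octahedral sphere `|x| + |y| + |z| = d` by the antipodal
map. A unimodular triangulation of `d·Δ₂` is extended to the sphere by the coordinate reflections,
and so is the sign distribution; antipodal vertices have equal signs if and only if `d` is even.
Triangulations of the sphere are encoded by their triangles and by the barycentric coordinate
functions of the vertices (`OctTriangulation`), which makes flips explicit. The curve is the set of
points at which two vertices of different signs have maximal barycentric coordinate
(`patchworkedCurve_planeComplex`); its components are the classes of bicolored edges, where the two
bicolored edges of a triangle are equivalent (`component_eq_classSet`).

Let `abce` be a parallelogram formed by two triangles of the honeycomb triangulation. If the signs of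
its corners have sum zero, then they alternate on exactly one of its reflected copies and on the
antipode of this copy, since the reflections change the signs of the two diagonals and of the sides
in a controlled way. On all other copies the flip does not affect the curve combinatorially. On the
exceptional copy the flip is a surgery of the curve. Consider the strand of the curve that starts at
one side of this copy, up to the point where it meets the copy or its antipode again
(`IsBadQuad.strand`). It ends at one of the two neighbouring sides, in which case the surgery merges
two components or splits a component, so that the number of components changes; or `d` is even
and the strand leads to the antipode of the opposite side. In the latter case it is accompanied on
both sides by monochromatic paths. These connect antipodal vertices: vertices of sign one before the
flip, and vertices of sign zero after the flip (`IsFlip.components_or_monoPath`). In even degree, no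
walk along the curve leads to the antipode of its starting point (`not_sameCycle_antipode`).

If `d` is even and a monochromatic path connects `u₀` with `-u₀`, then each vertex `u` of the other
sign lies inside of an oval (`sign_eq_of_inRootRegion`). For, every cocycle modulo two on the sphere
is a coboundary; this holds for the honeycomb triangulation and is preserved by flips. The sign
distribution is the sum of the potentials of the components of the curve, hence one component
separates `u` from `u₀`. Its preimage in the sphere consists of two antipodal circles. The potential
of one of them agrees at `±u₀`, hence differs at `±u`, and the points where it differs from the
potential at the antipode project to the inside of an oval: a loop there lifts to a loop on the
sphere that misses the antipode of its starting point, and is contractible (`loop_contractible`).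
So the root region has sign one before the flip and sign zero after the flip, and the two curves are
not root isotopic.

Hence, under the hypothesis of the theorem, each parallelogram of the honeycomb triangulation has an
odd number of corners of sign one (`sum_honeycomb_quad_eq_one`). This forces the sign distribution to
be `xy` up to an affine function (`eq_quadratic_of_odd_quads`), that is, to be equivalent to the
Harnack distribution.
-/

namespace TCurve

noncomputable section

/-! ### Lattice points of the octahedral sphere -/

/-- The lattice points of the octahedral sphere `|x| + |y| + |z| = d`. -/
abbrev OctPoint (d : ℕ) : Type := {u : Fin 3 → ℤ // ∑ i, |u i| = d}

instance (d : ℕ) : InvolutiveNeg (OctPoint d) where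
  neg u := ⟨-u.1, by simpa using u.2⟩
  neg_neg u := Subtype.ext (neg_neg u.1)

/-- The octahedral sphere `|x| + |y| + |z| = d`, a double cover of the projective plane. -/
def octahedron (d : ℕ) : Set (Fin 3 → ℝ) := {x | ∑ i, |x i| = d}

/-- The action of the coordinate reflections on lattice points of the octahedron. -/
def octReflect {d : ℕ} (g : Fin 3 → ℤˣ) (u : OctPoint d) : OctPoint d :=
  ⟨fun i => g i * u.1 i, by
    refine (Finset.sum_congr rfl fun i _ => ?_).trans u.2
    rcases Int.units_eq_one_or (g i) with h | h <;> simp [h]⟩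

/-- A lattice point of the octahedron as a point of space. -/
def toSpace {d : ℕ} (u : OctPoint d) : Fin 3 → ℝ := fun i => u.1 i

/-- The action of the coordinate reflections on space. -/
def spaceReflect (g : Fin 3 → ℤˣ) (x : Fin 3 → ℝ) : Fin 3 → ℝ := fun i => ((g i : ℤ) : ℝ) * x i

variable {d : ℕ}

@[simp] lemma neg_val (u : OctPoint d) : (-u).1 = -u.1 := rfl

@[simp] lemma octReflect_val (g : Fin 3 → ℤˣ) (u : OctPoint d) (i : Fin 3) :
    (octReflect g u).1 i = g i * u.1 i := rfl

@[simp] lemma toSpace_apply (u : OctPoint d) (i : Fin 3) : toSpace u i = u.1 i := rfl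

lemma sq_unit (e : ℤˣ) : (e : ℤ) * e = 1 := by
  rcases Int.units_eq_one_or e with h | h <;> simp [h]

@[simp] lemma octReflect_octReflect (g : Fin 3 → ℤˣ) (u : OctPoint d) :
    octReflect g (octReflect g u) = u := by
  ext i
  simp only [octReflect_val, ← mul_assoc, sq_unit, one_mul]

lemma octReflect_injective (g : Fin 3 → ℤˣ) : Function.Injective (octReflect (d := d) g) :=
  Function.LeftInverse.injective (octReflect_octReflect g)

lemma octReflect_neg_one (u : OctPoint d) : octReflect (-1) u = -u := by
  ext i
  simp

lemma octReflect_neg (g : Fin 3 → ℤˣ) (u : OctPoint d) : octReflect (-g) u = -octReflect g u := by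
  ext i
  simp

lemma toSpace_injective : Function.Injective (toSpace (d := d)) := by
  intro u v h
  ext i
  have := congrFun h i
  simp only [toSpace_apply] at this
  exact_mod_cast this

lemma toSpace_neg (u : OctPoint d) : toSpace (-u) = -toSpace u := by
  ext i
  simp

lemma toSpace_octReflect (g : Fin 3 → ℤˣ) (u : OctPoint d) :
    toSpace (octReflect g u) = spaceReflect g (toSpace u) := by
  ext i
  simp [spaceReflect]

lemma toSpace_mem (u : OctPoint d) : toSpace u ∈ octahedron d := by
  have h := u.2
  have h' : ((∑ i, |u.1 i| : ℤ) : ℝ) = ((d : ℤ) : ℝ) := by rw [h]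
  simpa [octahedron] using h'

lemma spaceReflect_mem (g : Fin 3 → ℤˣ) {x : Fin 3 → ℝ} (hx : x ∈ octahedron d) :
    spaceReflect g x ∈ octahedron d := by
  have : ∀ i, |spaceReflect g x i| = |x i| := by
    intro i
    rcases Int.units_eq_one_or (g i) with h | h <;> simp [h, spaceReflect]
  simpa [octahedron, this] using hx

lemma spaceReflect_spaceReflect (g : Fin 3 → ℤˣ) (x : Fin 3 → ℝ) :
    spaceReflect g (spaceReflect g x) = x := by
  ext i
  rcases Int.units_eq_one_or (g i) with h | h <;> simp [h, spaceReflect]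

lemma neg_mem_octahedron {x : Fin 3 → ℝ} (hx : x ∈ octahedron d) : -x ∈ octahedron d := by
  simpa [octahedron] using hx

lemma neg_ne_self (hd : 1 ≤ d) (u : OctPoint d) : -u ≠ u := by
  intro h
  have h2 : ∀ i, u.1 i = 0 := by
    intro i
    have := congrFun (congrArg Subtype.val h) i
    simp only [neg_val, Pi.neg_apply] at this
    omega
  have := u.2
  simp [h2] at this
  omega

instance : Finite (OctPoint d) := by
  refine Set.Finite.to_subtype (Set.Finite.subset
    (Set.finite_Icc (fun _ : Fin 3 => -(d : ℤ)) (fun _ => (d : ℤ))) ?_)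
  intro u hu
  have hu' : ∑ i, |u i| = (d : ℤ) := hu
  have h : ∀ i, |u i| ≤ d := by
    intro i
    rw [← hu']
    exact Finset.single_le_sum (f := fun i => |u i|) (fun j _ => abs_nonneg _) (Finset.mem_univ i)
  exact ⟨fun i => (abs_le.1 (h i)).1, fun i => (abs_le.1 (h i)).2⟩

instance : Fintype (OctPoint d) := Fintype.ofFinite _

/-- The determinant of three lattice points; its sign orients triangles of the octahedron as seen
from the outside. -/
def orient (u v w : OctPoint d) : ℤ :=
  u.1 0 * (v.1 1 * w.1 2 - v.1 2 * w.1 1) - u.1 1 * (v.1 0 * w.1 2 - v.1 2 * w.1 0)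
    + u.1 2 * (v.1 0 * w.1 1 - v.1 1 * w.1 0)

lemma orient_swap (u v w : OctPoint d) : orient v u w = -orient u v w := by
  unfold orient; ring

lemma orient_rotate (u v w : OctPoint d) : orient v w u = orient u v w := by
  unfold orient; ring

lemma orient_neg (u v w : OctPoint d) : orient (-u) (-v) (-w) = -orient u v w := by
  simp only [orient, neg_val, Pi.neg_apply]; ring

lemma orient_octReflect (g : Fin 3 → ℤˣ) (u v w : OctPoint d) :
    orient (octReflect g u) (octReflect g v) (octReflect g w)
      = (g 0 * g 1 * g 2 : ℤ) * orient u v w := by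
  simp only [orient, octReflect_val]; ring

/-! ### Triangulations of the octahedral sphere -/

/-- A unimodular triangulation of the octahedral sphere which is symmetric under the coordinate
reflections. It is given by its triangles together with the barycentric coordinate functions
`hat · t` of the vertices `t`; their existence makes triangles intersect in common faces. -/
structure OctTriangulation (d : ℕ) where
  /-- The vertex sets of the triangles. -/
  tris : Set (Finset (OctPoint d))
  /-- `hat x t` is the barycentric coordinate of the point `x` at the vertex `t`. -/
  hat : (Fin 3 → ℝ) → OctPoint d → ℝ
  card_eq : ∀ S ∈ tris, S.card = 3
  sameOctant : ∀ S ∈ tris, ∀ i, (∀ u ∈ S, 0 ≤ u.1 i) ∨ (∀ u ∈ S, u.1 i ≤ 0)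
  reflect_mem : ∀ g, ∀ S ∈ tris, S.image (octReflect g) ∈ tris
  unimodular : ∀ u v w, {u, v, w} ∈ tris → |orient u v w| = d
  hat_continuous : ∀ t, Continuous fun x => hat x t
  hat_comb : ∀ u v w, {u, v, w} ∈ tris → ∀ a b c : ℝ, 0 ≤ a → 0 ≤ b → 0 ≤ c → a + b + c = 1 →
    hat (a • toSpace u + b • toSpace v + c • toSpace w) u = a ∧
    ∀ t, t ≠ u → t ≠ v → t ≠ w → hat (a • toSpace u + b • toSpace v + c • toSpace w) t = 0
  cover : ∀ x ∈ octahedron d, ∃ u v w, {u, v, w} ∈ tris ∧ ∃ a b c : ℝ, 0 ≤ a ∧ 0 ≤ b ∧ 0 ≤ c ∧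
    a + b + c = 1 ∧ x = a • toSpace u + b • toSpace v + c • toSpace w

namespace OctTriangulation

variable (K : OctTriangulation d)

/-- Two vertices span an edge if they are two corners of a triangle. They are different because
triangles have three elements. -/
def Edge (u v : OctPoint d) : Prop := ∃ w, {u, v, w} ∈ K.tris

variable {K}

lemma tri_rotate {u v w : OctPoint d} (h : {u, v, w} ∈ K.tris) : {v, w, u} ∈ K.tris := by
  convert h using 1; ext; simp; tauto

lemma tri_swap {u v w : OctPoint d} (h : {u, v, w} ∈ K.tris) : {v, u, w} ∈ K.tris := by
  convert h using 1; ext; simp; tauto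

lemma tri_swap' {u v w : OctPoint d} (h : {u, v, w} ∈ K.tris) : {u, w, v} ∈ K.tris := by
  convert h using 1; ext; simp; tauto

lemma tri_ne {u v w : OctPoint d} (h : {u, v, w} ∈ K.tris) : u ≠ v ∧ u ≠ w ∧ v ≠ w := by
  have := K.card_eq _ h
  refine ⟨?_, ?_, ?_⟩ <;> rintro rfl
  · simp only [Finset.mem_singleton, Finset.mem_insert, true_or, Finset.insert_eq_of_mem] at this
    have := (Finset.card_le_two (a := u) (b := w)); omega
  · have e : ({u, v, u} : Finset (OctPoint d)) = {u, v} := by ext; simp; tauto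
    rw [e] at this
    have := (Finset.card_le_two (a := u) (b := v)); omega
  · have e : ({u, v, v} : Finset (OctPoint d)) = {u, v} := by ext; simp
    rw [e] at this
    have := (Finset.card_le_two (a := u) (b := v)); omega

lemma tri_reflect (g : Fin 3 → ℤˣ) {u v w : OctPoint d} (h : {u, v, w} ∈ K.tris) :
    {octReflect g u, octReflect g v, octReflect g w} ∈ K.tris := by
  have := K.reflect_mem g _ h
  simpa [Finset.image_insert] using this

lemma tri_neg {u v w : OctPoint d} (h : {u, v, w} ∈ K.tris) : {-u, -v, -w} ∈ K.tris := by
  simpa only [octReflect_neg_one] using tri_reflect (-1) h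

lemma orient_ne_zero (hd : 1 ≤ d) {u v w : OctPoint d} (h : {u, v, w} ∈ K.tris) :
    orient u v w ≠ 0 := by
  intro h0
  have := K.unimodular _ _ _ h
  rw [h0] at this
  simp at this
  omega

lemma Edge.symm {u v : OctPoint d} (h : K.Edge u v) : K.Edge v u := by
  obtain ⟨w, hw⟩ := h
  exact ⟨w, tri_swap hw⟩

lemma Edge.ne {u v : OctPoint d} (h : K.Edge u v) : u ≠ v := by
  obtain ⟨w, hw⟩ := h
  exact (tri_ne hw).1

lemma Edge.reflect (g : Fin 3 → ℤˣ) {u v : OctPoint d} (h : K.Edge u v) :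
    K.Edge (octReflect g u) (octReflect g v) := by
  obtain ⟨w, hw⟩ := h
  exact ⟨_, tri_reflect g hw⟩

lemma Edge.neg {u v : OctPoint d} (h : K.Edge u v) : K.Edge (-u) (-v) := by
  obtain ⟨w, hw⟩ := h
  exact ⟨_, tri_neg hw⟩

lemma hat_three {u v w : OctPoint d} (h : {u, v, w} ∈ K.tris) {a b c : ℝ} (ha : 0 ≤ a) (hb : 0 ≤ b)
    (hc : 0 ≤ c) (hs : a + b + c = 1) {x : Fin 3 → ℝ}
    (hx : x = a • toSpace u + b • toSpace v + c • toSpace w) :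
    K.hat x u = a ∧ K.hat x v = b ∧ K.hat x w = c ∧
      ∀ t, t ≠ u → t ≠ v → t ≠ w → K.hat x t = 0 := by
  obtain ⟨h1, h2⟩ := K.hat_comb u v w h a b c ha hb hc hs
  obtain ⟨h3, -⟩ := K.hat_comb v w u (tri_rotate h) b c a hb hc ha (by linarith)
  obtain ⟨h4, -⟩ := K.hat_comb w u v (tri_rotate (tri_rotate h)) c a b hc ha hb (by linarith)
  have e1 : x = b • toSpace v + c • toSpace w + a • toSpace u := by rw [hx]; abel
  have e2 : x = c • toSpace w + a • toSpace u + b • toSpace v := by rw [hx]; abel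
  exact ⟨by rw [hx]; exact h1, by rw [e1]; exact h3, by rw [e2]; exact h4,
    by rw [hx]; exact h2⟩

/-- On the cone over a triangle the `ℓ¹`-norm is additive. -/
lemma sum_abs_cone {u v w : OctPoint d} (h : {u, v, w} ∈ K.tris) {a b c : ℝ} (ha : 0 ≤ a)
    (hb : 0 ≤ b) (hc : 0 ≤ c) :
    ∑ i, |(a • toSpace u + b • toSpace v + c • toSpace w) i| = (a + b + c) * d := by
  have key : ∀ i, |(a • toSpace u + b • toSpace v + c • toSpace w) i|
      = a * |toSpace u i| + b * |toSpace v i| + c * |toSpace w i| := by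
    intro i
    simp only [Pi.add_apply, Pi.smul_apply, smul_eq_mul, toSpace_apply]
    rcases K.sameOctant _ h i with h' | h'
    · have hu : (0 : ℝ) ≤ u.1 i := by exact_mod_cast h' u (by simp)
      have hv : (0 : ℝ) ≤ v.1 i := by exact_mod_cast h' v (by simp)
      have hw : (0 : ℝ) ≤ w.1 i := by exact_mod_cast h' w (by simp)
      rw [abs_of_nonneg (by positivity), abs_of_nonneg hu, abs_of_nonneg hv, abs_of_nonneg hw]
    · have hu : (u.1 i : ℝ) ≤ 0 := by exact_mod_cast h' u (by simp)
      have hv : (v.1 i : ℝ) ≤ 0 := by exact_mod_cast h' v (by simp)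
      have hw : (w.1 i : ℝ) ≤ 0 := by exact_mod_cast h' w (by simp)
      have h1 := mul_nonneg ha (neg_nonneg.2 hu)
      have h2 := mul_nonneg hb (neg_nonneg.2 hv)
      have h3 := mul_nonneg hc (neg_nonneg.2 hw)
      rw [abs_of_nonpos (by linarith), abs_of_nonpos hu, abs_of_nonpos hv, abs_of_nonpos hw]
      ring
  have e : ∀ t : OctPoint d, ∑ i, |toSpace t i| = d := fun t => toSpace_mem t
  rw [Finset.sum_congr rfl fun i _ => key i, Finset.sum_add_distrib, Finset.sum_add_distrib,
    ← Finset.mul_sum, ← Finset.mul_sum, ← Finset.mul_sum, e, e, e]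
  ring

lemma comb_mem_octahedron {u v w : OctPoint d} (h : {u, v, w} ∈ K.tris) {a b c : ℝ} (ha : 0 ≤ a)
    (hb : 0 ≤ b) (hc : 0 ≤ c) (hs : a + b + c = 1) :
    a • toSpace u + b • toSpace v + c • toSpace w ∈ octahedron d := by
  have := sum_abs_cone h ha hb hc
  rw [hs, one_mul] at this
  exact this

/-- Determinant of points of space, extending `orient`. -/
def det3 (x y z : Fin 3 → ℝ) : ℝ :=
  x 0 * (y 1 * z 2 - y 2 * z 1) - x 1 * (y 0 * z 2 - y 2 * z 0) + x 2 * (y 0 * z 1 - y 1 * z 0)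

lemma det3_toSpace (u v w : OctPoint d) :
    det3 (toSpace u) (toSpace v) (toSpace w) = orient u v w := by
  simp [det3, orient]

/-- At most one triangle lies on a given side of an edge. -/
lemma apex_unique (hd : 1 ≤ d) {u v w w' : OctPoint d} (h : {u, v, w} ∈ K.tris)
    (h' : {u, v, w'} ∈ K.tris) (ho : 0 < orient u v w * orient u v w') : w = w' := by
  by_contra hne
  set D : ℝ := ((orient u v w : ℤ) : ℝ) with hD
  have hD0 : D ≠ 0 := by
    rw [hD]; exact_mod_cast orient_ne_zero hd h
  -- Cramer's rule: write `w'` in the basis `u, v, w`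
  set α : ℝ := det3 (toSpace w') (toSpace v) (toSpace w) / D
  set β : ℝ := det3 (toSpace u) (toSpace w') (toSpace w) / D
  set γ : ℝ := orient u v w' / D with hγ
  have hcr : toSpace w' = α • toSpace u + β • toSpace v + γ • toSpace w := by
    have hα : α * D = det3 (toSpace w') (toSpace v) (toSpace w) := div_mul_cancel₀ _ hD0
    have hβ : β * D = det3 (toSpace u) (toSpace w') (toSpace w) := div_mul_cancel₀ _ hD0
    have hγ : γ * D = det3 (toSpace u) (toSpace v) (toSpace w') := by
      rw [det3_toSpace]; exact div_mul_cancel₀ _ hD0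
    have hDD : D = det3 (toSpace u) (toSpace v) (toSpace w) := by rw [det3_toSpace]
    have : ∀ i, D * toSpace w' i = D * (α • toSpace u + β • toSpace v + γ • toSpace w) i := by
      intro i
      have : D * (α • toSpace u + β • toSpace v + γ • toSpace w) i
          = (α * D) * toSpace u i + (β * D) * toSpace v i + (γ * D) * toSpace w i := by
        simp only [Pi.add_apply, Pi.smul_apply, smul_eq_mul]; ring
      rw [this, hα, hβ, hγ, hDD]
      fin_cases i <;> simp only [det3, Fin.zero_eta, Fin.mk_one, Fin.reduceFinMk] <;> ring
    ext i
    exact mul_left_cancel₀ hD0 (this i)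
  have hγ0 : 0 < γ := by
    have h1 : (0 : ℝ) < D * orient u v w' := by rw [hD]; exact_mod_cast ho
    have h2 : γ = D * orient u v w' / (D * D) := by rw [hγ]; field_simp
    rw [h2]
    exact div_pos h1 (mul_self_pos.2 hD0)
  -- a point close to the midpoint of the edge lies in both triangles
  set N : ℝ := 1 + |α| + |β| with hN
  have hNα : 0 < N + α := by have := neg_abs_le α; have := abs_nonneg β; linarith
  have hNβ : 0 < N + β := by have := neg_abs_le β; have := abs_nonneg α; linarith
  have hN0 : 0 < N := by positivity
  have hy : N • toSpace u + N • toSpace v + (1 : ℝ) • toSpace w'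
      = (N + α) • toSpace u + (N + β) • toSpace v + γ • toSpace w := by
    rw [hcr]; module
  have hnorm : (N + N + 1) * d = ((N + α) + (N + β) + γ) * d := by
    rw [← sum_abs_cone h' hN0.le hN0.le zero_le_one, hy, sum_abs_cone h hNα.le hNβ.le hγ0.le]
  have hd0 : (d : ℝ) ≠ 0 := by positivity
  have hsum : N + N + 1 = (N + α) + (N + β) + γ := mul_right_cancel₀ hd0 hnorm
  set M : ℝ := (N + N + 1)⁻¹ with hM
  have hM0 : 0 < M := by positivity
  have hM1 : M * (N + N + 1) = 1 := inv_mul_cancel₀ (by positivity)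
  set x : Fin 3 → ℝ := M • (N • toSpace u + N • toSpace v + (1 : ℝ) • toSpace w')
  have x1 := (hat_three (K := K) (x := x) h' (a := M * N) (b := M * N) (c := M * 1) (by positivity)
    (by positivity) (by positivity) (by linarith) (by simp only [x]; module)).2.2.2 w
    (tri_ne h).2.1.symm (tri_ne h).2.2.symm hne
  have x2 := (hat_three (K := K) (x := x) h (a := M * (N + α)) (b := M * (N + β)) (c := M * γ)
    (by positivity) (by positivity) (by positivity) (by rw [← hM1, hsum]; ring)
    (by simp only [x]; rw [hy]; module)).2.2.1
  rw [x1] at x2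
  have : 0 < M * γ := by positivity
  linarith

/-- Both sides of an edge are occupied by a triangle. -/
lemma apex_exists (hd : 1 ≤ d) {u v w : OctPoint d} (h : {u, v, w} ∈ K.tris) :
    ∃ w', {u, v, w'} ∈ K.tris ∧ orient u v w * orient u v w' < 0 := by
  set m : Fin 3 → ℝ := (1 / 2 : ℝ) • toSpace u + (1 / 2 : ℝ) • toSpace v + (0 : ℝ) • toSpace w
    with hm
  obtain ⟨hmu, hmv, -⟩ := hat_three (K := K) h (a := 1 / 2) (b := 1 / 2) (c := 0) (by norm_num)
    (by norm_num) le_rfl (by norm_num) hm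
  have hmX : m ∈ octahedron d :=
    comb_mem_octahedron h (by norm_num) (by norm_num) le_rfl (by norm_num)
  have hd0 : (0 : ℝ) < d := by positivity
  -- points on the other side of the edge, converging to the midpoint
  let y : ℝ → Fin 3 → ℝ := fun ε => m - ε • toSpace w
  let n : ℝ → ℝ := fun ε => d * (∑ i, |y ε i|)⁻¹
  have hy0 : y 0 = m := by simp [y]
  have hycont : Continuous y := by fun_prop
  have hs0 : ∑ i, |y 0 i| = d := by rw [hy0]; exact hmX
  have hscont : Continuous fun ε => ∑ i, |y ε i| := by fun_prop
  have hncont : ContinuousAt (fun ε => n ε • y ε) 0 := by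
    refine ContinuousAt.smul (ContinuousAt.mul continuousAt_const
      (hscont.continuousAt.inv₀ (by rw [hs0]; exact hd0.ne'))) hycont.continuousAt
  have hn0 : n 0 • y 0 = m := by
    simp only [n]; rw [hs0, mul_inv_cancel₀ hd0.ne', one_smul, hy0]
  have hu : ∀ᶠ ε in nhds (0 : ℝ), 0 < K.hat (n ε • y ε) u := by
    have := ((K.hat_continuous u).continuousAt (x := n 0 • y 0)).comp (f := fun ε => n ε • y ε)
      hncont
    refine this.eventually (lt_mem_nhds ?_)
    simp only [Function.comp]; rw [hn0, hmu]; norm_num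
  have hv : ∀ᶠ ε in nhds (0 : ℝ), 0 < K.hat (n ε • y ε) v := by
    have := ((K.hat_continuous v).continuousAt (x := n 0 • y 0)).comp (f := fun ε => n ε • y ε)
      hncont
    refine this.eventually (lt_mem_nhds ?_)
    simp only [Function.comp]; rw [hn0, hmv]; norm_num
  have hpos : ∀ᶠ ε in nhds (0 : ℝ), 0 < ∑ i, |y ε i| :=
    hscont.continuousAt.eventually (lt_mem_nhds (by change 0 < ∑ i, |y 0 i|; rw [hs0]; exact hd0))
  have hall := (hu.and (hv.and hpos))
  have hall' := hall.filter_mono (nhdsWithin_le_nhds (s := Set.Ioi (0 : ℝ)))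
  obtain ⟨ε, ⟨hεu, hεv, hεs⟩, hε⟩ := (hall'.and self_mem_nhdsWithin).exists
  have hε0 : 0 < ε := hε
  have hnpos : 0 < n ε := by simp only [n]; positivity
  have hxX : n ε • y ε ∈ octahedron d := by
    simp only [octahedron, Set.mem_ofPred_eq, Pi.smul_apply, smul_eq_mul, abs_mul, ← Finset.mul_sum,
      abs_of_pos hnpos]
    simp only [n]
    field_simp
  obtain ⟨p, q, r, hpqr, a, b, c, ha, hb, hc, hs, hx⟩ := K.cover _ hxX
  obtain ⟨h1, h2, h3, h4⟩ := hat_three hpqr ha hb hc hs hx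
  have memu : u = p ∨ u = q ∨ u = r := by
    by_contra hcon
    push Not at hcon
    rw [h4 u hcon.1 hcon.2.1 hcon.2.2] at hεu
    exact lt_irrefl _ hεu
  have memv : v = p ∨ v = q ∨ v = r := by
    by_contra hcon
    push Not at hcon
    rw [h4 v hcon.1 hcon.2.1 hcon.2.2] at hεv
    exact lt_irrefl _ hεv
  have huv := (tri_ne h).1
  -- the triangle containing the point has the given edge
  obtain ⟨w', hw', a', b', c', hc', hx'⟩ : ∃ w', {u, v, w'} ∈ K.tris ∧ ∃ a' b' c' : ℝ, 0 ≤ c' ∧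
      n ε • y ε = a' • toSpace u + b' • toSpace v + c' • toSpace w' := by
    rcases memu with rfl | rfl | rfl <;> rcases memv with rfl | rfl | rfl
    · exact absurd rfl huv
    · exact ⟨r, hpqr, a, b, c, hc, hx⟩
    · exact ⟨q, tri_swap' hpqr, a, c, b, hb, by rw [hx]; abel⟩
    · exact ⟨r, tri_swap hpqr, b, a, c, hc, by rw [hx]; abel⟩
    · exact absurd rfl huv
    · exact ⟨p, tri_rotate hpqr, b, c, a, ha, by rw [hx]; abel⟩
    · exact ⟨q, tri_rotate (tri_rotate hpqr), c, a, b, hb, by rw [hx]; abel⟩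
    · exact ⟨p, tri_swap (tri_rotate hpqr), c, b, a, ha, by rw [hx]; abel⟩
    · exact absurd rfl huv
  refine ⟨w', hw', ?_⟩
  have hdet : c' * orient u v w' = - (n ε * ε) * orient u v w := by
    have e1 : det3 (toSpace u) (toSpace v) (n ε • y ε) = c' * orient u v w' := by
      rw [hx', ← det3_toSpace]; simp [det3]; ring
    have e2 : det3 (toSpace u) (toSpace v) (n ε • y ε) = - (n ε * ε) * orient u v w := by
      rw [← det3_toSpace]; simp [det3, y, m]; ring
    rw [← e1, e2]
  have hw0 : (orient u v w : ℝ) ≠ 0 := by exact_mod_cast orient_ne_zero hd h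
  have hc0 : 0 < c' := by
    refine lt_of_le_of_ne hc' ?_
    rintro rfl
    have : n ε * ε * orient u v w = 0 := by linarith
    have h5 : n ε * ε ≠ 0 := (mul_pos hnpos hε0).ne'
    exact (mul_ne_zero h5 hw0) this
  have : c' * (orient u v w * orient u v w' : ℝ) < 0 := by
    have e : c' * (orient u v w * orient u v w' : ℝ) = -(n ε * ε * (orient u v w * orient u v w)) := by
      linear_combination (orient u v w : ℝ) * hdet
    rw [e]
    have := mul_pos (mul_pos hnpos hε0) (mul_self_pos.2 hw0)
    linarith
  have h6 : (orient u v w * orient u v w' : ℝ) < 0 := by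
    by_contra hcon
    push Not at hcon
    have := mul_nonneg hc' hcon
    linarith
  exact_mod_cast h6

end OctTriangulation

/-! ### The honeycomb triangulation -/

/-- The triangles of the honeycomb triangulation: triples of lattice points at pairwise
sup-distance at most one. -/
def honeycombTris (d : ℕ) : Set (Finset (OctPoint d)) :=
  {S | S.card = 3 ∧ ∀ u ∈ S, ∀ v ∈ S, ∀ i, |u.1 i - v.1 i| ≤ 1}

/-- The barycentric coordinates of the honeycomb triangulation: the hat functions of the
sup-norm. -/
def honeycombHat (x : Fin 3 → ℝ) (t : OctPoint d) : ℝ := max 0 (1 - ‖x - toSpace t‖)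

lemma abs_units_mul (e : ℤˣ) (z : ℤ) : |(e : ℤ) * z| = |z| := by
  rcases Int.units_eq_one_or e with h | h <;> simp [h]

lemma norm_spaceReflect (g : Fin 3 → ℤˣ) (x : Fin 3 → ℝ) : ‖spaceReflect g x‖ = ‖x‖ := by
  have key : ∀ i, ‖spaceReflect g x i‖ = ‖x i‖ := by
    intro i
    rcases Int.units_eq_one_or (g i) with h | h <;> simp [h, spaceReflect]
  apply le_antisymm <;> refine (pi_norm_le_iff_of_nonneg (norm_nonneg _)).2 fun i => ?_
  · rw [key]; exact norm_le_pi_norm x i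
  · rw [← key]; exact norm_le_pi_norm (spaceReflect g x) i

lemma spaceReflect_sub (g : Fin 3 → ℤˣ) (x y : Fin 3 → ℝ) :
    spaceReflect g (x - y) = spaceReflect g x - spaceReflect g y := by
  ext i; simp [spaceReflect, mul_sub]

lemma spaceReflect_comb (g : Fin 3 → ℤˣ) (a b c : ℝ) (x y z : Fin 3 → ℝ) :
    spaceReflect g (a • x + b • y + c • z)
      = a • spaceReflect g x + b • spaceReflect g y + c • spaceReflect g z := by
  ext i; simp only [spaceReflect, Pi.add_apply, Pi.smul_apply, smul_eq_mul]; ring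

lemma honeycombHat_reflect (g : Fin 3 → ℤˣ) (x : Fin 3 → ℝ) (t : OctPoint d) :
    honeycombHat (spaceReflect g x) (octReflect g t) = honeycombHat x t := by
  rw [honeycombHat, toSpace_octReflect, ← spaceReflect_sub, norm_spaceReflect, honeycombHat]

lemma honeycomb_sameOctant {S : Finset (OctPoint d)} (hS : S ∈ honeycombTris d) (i : Fin 3) :
    (∀ u ∈ S, 0 ≤ u.1 i) ∨ (∀ u ∈ S, u.1 i ≤ 0) := by
  by_contra! hcon
  obtain ⟨⟨u, hu, hu0⟩, v, hv, hv0⟩ := hcon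
  have := abs_le.1 (hS.2 u hu v hv i)
  omega

lemma exists_reflect_nonneg {S : Finset (OctPoint d)}
    (h : ∀ i, (∀ u ∈ S, 0 ≤ u.1 i) ∨ (∀ u ∈ S, u.1 i ≤ 0)) :
    ∃ g : Fin 3 → ℤˣ, ∀ u ∈ S, ∀ i, 0 ≤ (octReflect g u).1 i := by
  have : ∀ i, ∃ e : ℤˣ, ∀ u ∈ S, 0 ≤ (e : ℤ) * u.1 i := by
    intro i
    rcases h i with h | h
    · exact ⟨1, fun u hu => by simpa using h u hu⟩
    · exact ⟨-1, fun u hu => by simpa using h u hu⟩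
  choose g hg using this
  exact ⟨g, fun u hu i => hg i u hu⟩

lemma honeycomb_reflect (g : Fin 3 → ℤˣ) {S : Finset (OctPoint d)} (hS : S ∈ honeycombTris d) :
    S.image (octReflect g) ∈ honeycombTris d := by
  refine ⟨by rw [Finset.card_image_of_injective _ (octReflect_injective g)]; exact hS.1, ?_⟩
  simp only [Finset.mem_image, forall_exists_index, and_imp, forall_apply_eq_imp_iff₂]
  intro u hu v hv i
  rw [octReflect_val, octReflect_val, ← mul_sub, abs_units_mul]
  exact hS.2 u hu v hv i

lemma sum_of_nonneg {u : OctPoint d} (h : ∀ i, 0 ≤ u.1 i) : u.1 0 + u.1 1 + u.1 2 = d := by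
  have := u.2
  rw [Fin.sum_univ_three, abs_of_nonneg (h 0), abs_of_nonneg (h 1), abs_of_nonneg (h 2)] at this
  exact this

lemma exists_coord_ne {u v : OctPoint d} (h : u ≠ v) :
    u.1 0 ≠ v.1 0 ∨ u.1 1 ≠ v.1 1 ∨ u.1 2 ≠ v.1 2 := by
  by_contra! hcon
  refine h (Subtype.ext (funext fun i => ?_))
  fin_cases i
  exacts [hcon.1, hcon.2.1, hcon.2.2]

lemma mem_honeycombTris {u v w : OctPoint d} : {u, v, w} ∈ honeycombTris d ↔
    (u ≠ v ∧ u ≠ w ∧ v ≠ w) ∧ ∀ i, |u.1 i - v.1 i| ≤ 1 ∧ |u.1 i - w.1 i| ≤ 1 ∧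
      |v.1 i - w.1 i| ≤ 1 := by
  constructor
  · intro h
    refine ⟨?_, fun i => ⟨h.2 u (by simp) v (by simp) i, h.2 u (by simp) w (by simp) i,
      h.2 v (by simp) w (by simp) i⟩⟩
    have := h.1
    refine ⟨?_, ?_, ?_⟩ <;> rintro rfl
    · rw [Finset.insert_eq_of_mem (by simp)] at this
      have := (Finset.card_le_two (a := u) (b := w)); omega
    · rw [Finset.insert_eq_of_mem (by simp)] at this
      have := (Finset.card_le_two (a := v) (b := u)); omega
    · rw [Finset.pair_eq_singleton] at this
      have := (Finset.card_le_two (a := u) (b := v)); omega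
  · rintro ⟨⟨h1, h2, h3⟩, h⟩
    refine ⟨Finset.card_eq_three.2 ⟨u, v, w, h1, h2, h3, rfl⟩, ?_⟩
    have h0 : ∀ (t : OctPoint d) i, |t.1 i - t.1 i| ≤ 1 := by simp
    simp only [Finset.mem_insert, Finset.mem_singleton, forall_eq_or_imp, forall_eq]
    exact ⟨⟨h0 u, fun i => (h i).1, fun i => (h i).2.1⟩,
      ⟨fun i => by rw [abs_sub_comm]; exact (h i).1, h0 v, fun i => (h i).2.2⟩,
      fun i => by rw [abs_sub_comm]; exact (h i).2.1,
      fun i => by rw [abs_sub_comm]; exact (h i).2.2, h0 w⟩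

lemma forall_fin_three {P : Fin 3 → Prop} : (∀ i, P i) ↔ P 0 ∧ P 1 ∧ P 2 := by
  refine ⟨fun h => ⟨h 0, h 1, h 2⟩, fun h i => ?_⟩
  fin_cases i
  exacts [h.1, h.2.1, h.2.2]

/-- Four different vectors of the form `0` or `e_i - e_j` cannot be pairwise adjacent. -/
lemma hexagonal_no_four (p p' q q' r r' : ℤ) (hp : -1 ≤ p ∧ p ≤ 1) (hp' : -1 ≤ p' ∧ p' ≤ 1)
    (hp2 : -1 ≤ p + p' ∧ p + p' ≤ 1) (hq : -1 ≤ q ∧ q ≤ 1) (hq' : -1 ≤ q' ∧ q' ≤ 1)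
    (hq2 : -1 ≤ q + q' ∧ q + q' ≤ 1) (hr : -1 ≤ r ∧ r ≤ 1) (hr' : -1 ≤ r' ∧ r' ≤ 1)
    (hr2 : -1 ≤ r + r' ∧ r + r' ≤ 1) (hpq : -1 ≤ p - q ∧ p - q ≤ 1)
    (hpq' : -1 ≤ p' - q' ∧ p' - q' ≤ 1) (hpq2 : -1 ≤ p + p' - q - q' ∧ p + p' - q - q' ≤ 1)
    (hpr : -1 ≤ p - r ∧ p - r ≤ 1) (hpr' : -1 ≤ p' - r' ∧ p' - r' ≤ 1)
    (hpr2 : -1 ≤ p + p' - r - r' ∧ p + p' - r - r' ≤ 1) (hqr : -1 ≤ q - r ∧ q - r ≤ 1)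
    (hqr' : -1 ≤ q' - r' ∧ q' - r' ≤ 1) (hqr2 : -1 ≤ q + q' - r - r' ∧ q + q' - r - r' ≤ 1)
    (h1 : p ≠ 0 ∨ p' ≠ 0) (h2 : q ≠ 0 ∨ q' ≠ 0) (h3 : r ≠ 0 ∨ r' ≠ 0) (h4 : p ≠ q ∨ p' ≠ q')
    (h5 : p ≠ r ∨ p' ≠ r') (h6 : q ≠ r ∨ q' ≠ r') : False := by
  obtain ⟨hp, hp0⟩ := hp
  obtain ⟨hp', hp'0⟩ := hp'
  obtain ⟨hq, hq0⟩ := hq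
  obtain ⟨hq', hq'0⟩ := hq'
  interval_cases p <;> interval_cases p' <;> omega

/-- In the closed positive octant, a point at sup-distance at most one from the three corners of a
honeycomb triangle is one of these corners. -/
lemma honeycomb_no_four {u v w t : OctPoint d} (hS : {u, v, w} ∈ honeycombTris d)
    (hu : ∀ i, 0 ≤ u.1 i) (hv : ∀ i, 0 ≤ v.1 i) (hw : ∀ i, 0 ≤ w.1 i) (ht : ∀ i, 0 ≤ t.1 i)
    (h : ∀ i, |t.1 i - u.1 i| ≤ 1 ∧ |t.1 i - v.1 i| ≤ 1 ∧ |t.1 i - w.1 i| ≤ 1) :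
    t = u ∨ t = v ∨ t = w := by
  obtain ⟨⟨h1, h2, h3⟩, h4⟩ := mem_honeycombTris.1 hS
  by_contra! hcon
  have s1 := sum_of_nonneg hu
  have s2 := sum_of_nonneg hv
  have s3 := sum_of_nonneg hw
  have s4 := sum_of_nonneg ht
  simp only [abs_le, forall_fin_three] at h h4
  clear hS hu hv hw ht
  obtain ⟨⟨c1, c2, c3⟩, ⟨c4, c5, c6⟩, c7, c8, c9⟩ := h
  obtain ⟨⟨k1, k2, k3⟩, ⟨k4, k5, k6⟩, k7, k8, k9⟩ := h4
  refine hexagonal_no_four (v.1 0 - u.1 0) (v.1 1 - u.1 1) (w.1 0 - u.1 0) (w.1 1 - u.1 1)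
    (t.1 0 - u.1 0) (t.1 1 - u.1 1) ?_ ?_ ?_ ?_ ?_ ?_ ?_ ?_ ?_ ?_ ?_ ?_ ?_ ?_ ?_ ?_ ?_ ?_
    (by have := exists_coord_ne h1; omega) (by have := exists_coord_ne h2; omega)
    (by have := exists_coord_ne hcon.1; omega) (by have := exists_coord_ne h3; omega)
    (by have := exists_coord_ne hcon.2.1; omega) (by have := exists_coord_ne hcon.2.2; omega)
  all_goals omega

/-- One of the coordinates is constant on the side opposite to `u`, and changes by one between this
side and `u`. -/
lemma honeycomb_common_coord {u v w : OctPoint d} (hS : {u, v, w} ∈ honeycombTris d)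
    (hu : ∀ i, 0 ≤ u.1 i) (hv : ∀ i, 0 ≤ v.1 i) (hw : ∀ i, 0 ≤ w.1 i) :
    ∃ i, v.1 i = w.1 i ∧ |v.1 i - u.1 i| = 1 := by
  suffices h : ∃ i, v.1 i = w.1 i ∧ v.1 i ≠ u.1 i by
    obtain ⟨i, hi, hi'⟩ := h
    refine ⟨i, hi, ?_⟩
    have h1 := ((mem_honeycombTris.1 hS).2 i).1
    rw [abs_sub_comm] at h1
    exact le_antisymm h1 (Int.one_le_abs (sub_ne_zero.2 hi'))
  obtain ⟨⟨h1, h2, h3⟩, h4⟩ := mem_honeycombTris.1 hS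
  have b1 := exists_coord_ne h1
  have b2 := exists_coord_ne h2
  have b3 := exists_coord_ne h3
  have s1 := sum_of_nonneg hu
  have s2 := sum_of_nonneg hv
  have s3 := sum_of_nonneg hw
  simp only [abs_le, forall_fin_three]  at h4
  by_contra! hcon
  have c0 := hcon 0
  have c1 := hcon 1
  have c2 := hcon 2
  clear hcon hS
  omega

/-- The hat functions of the sup-norm restrict to the barycentric coordinates on the triangles of the
positive octant. -/
lemma honeycomb_hat_nonneg {u v w : OctPoint d} (hS : {u, v, w} ∈ honeycombTris d)
    (hu : ∀ i, 0 ≤ u.1 i) (hv : ∀ i, 0 ≤ v.1 i) (hw : ∀ i, 0 ≤ w.1 i) {a b c : ℝ} (ha : 0 ≤ a)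
    (hb : 0 ≤ b) (hc : 0 ≤ c) (hs : a + b + c = 1) :
    honeycombHat (a • toSpace u + b • toSpace v + c • toSpace w) u = a ∧
    ∀ t, t ≠ u → t ≠ v → t ≠ w →
      honeycombHat (a • toSpace u + b • toSpace v + c • toSpace w) t = 0 := by
  have h4 := (mem_honeycombTris.1 hS).2
  set x : Fin 3 → ℝ := a • toSpace u + b • toSpace v + c • toSpace w with hx
  have hxi : ∀ i, x i = a * u.1 i + b * v.1 i + c * w.1 i := fun i => by simp [hx]
  constructor
  · have hnorm : ‖x - toSpace u‖ = b + c := by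
      apply le_antisymm
      · refine (pi_norm_le_iff_of_nonneg (by positivity)).2 fun i => ?_
        have e : (x - toSpace u) i = b * (v.1 i - u.1 i : ℤ) + c * (w.1 i - u.1 i : ℤ) := by
          rw [Pi.sub_apply, hxi, toSpace_apply]; push_cast
          linear_combination (u.1 i : ℝ) * hs
        have e1 : |((v.1 i - u.1 i : ℤ) : ℝ)| ≤ 1 := by
          rw [← Int.cast_abs, abs_sub_comm]; exact_mod_cast (h4 i).1
        have e2 : |((w.1 i - u.1 i : ℤ) : ℝ)| ≤ 1 := by
          rw [← Int.cast_abs, abs_sub_comm]; exact_mod_cast (h4 i).2.1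
        rw [e, Real.norm_eq_abs]
        refine (abs_add_le _ _).trans ?_
        rw [abs_mul, abs_mul, abs_of_nonneg hb, abs_of_nonneg hc]
        nlinarith
      -- the sup-norm is attained at the coordinate which is constant on the opposite side
      · obtain ⟨i, hi1, hi2⟩ := honeycomb_common_coord hS hu hv hw
        refine le_trans (le_of_eq ?_) (norm_le_pi_norm (x - toSpace u) i)
        have e : (x - toSpace u) i = (b + c) * (v.1 i - u.1 i : ℤ) := by
          rw [Pi.sub_apply, hxi, toSpace_apply, ← hi1]; push_cast
          linear_combination (u.1 i : ℝ) * hs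
        rw [e, Real.norm_eq_abs, abs_mul, ← Int.cast_abs, hi2, abs_of_nonneg (by positivity)]
        simp
    rw [honeycombHat, hnorm, max_eq_right] <;> linarith
  · intro t t1 t2 t3
    rw [honeycombHat]
    refine max_eq_left ?_
    by_contra! hcon
    -- a vertex `t` with positive weight is adjacent to all three corners, by integrality
    have hlt : ∀ i, |x i - t.1 i| < 1 := by
      intro i
      have := norm_le_pi_norm (x - toSpace t) i
      rw [Pi.sub_apply, toSpace_apply, Real.norm_eq_abs] at this
      linarith
    have hx0 : ∀ i, 0 ≤ x i := by
      intro i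
      have e1 : (0 : ℝ) ≤ u.1 i := by exact_mod_cast hu i
      have e2 : (0 : ℝ) ≤ v.1 i := by exact_mod_cast hv i
      have e3 : (0 : ℝ) ≤ w.1 i := by exact_mod_cast hw i
      rw [hxi]; positivity
    have ht : ∀ i, 0 ≤ t.1 i := by
      intro i
      have h1 := (abs_lt.1 (hlt i)).2
      have h2 := hx0 i
      have : (-1 : ℝ) < t.1 i := by linarith
      have : (-1 : ℤ) < t.1 i := by exact_mod_cast this
      omega
    have hup : ∀ i (n : ℤ), u.1 i ≤ n → v.1 i ≤ n → w.1 i ≤ n → t.1 i ≤ n := by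
      intro i n k1 k2 k3
      have l1 : (u.1 i : ℝ) ≤ n := by exact_mod_cast k1
      have l2 : (v.1 i : ℝ) ≤ n := by exact_mod_cast k2
      have l3 : (w.1 i : ℝ) ≤ n := by exact_mod_cast k3
      have h1 := (abs_lt.1 (hlt i)).1
      have := mul_le_mul_of_nonneg_left l1 ha
      have := mul_le_mul_of_nonneg_left l2 hb
      have := mul_le_mul_of_nonneg_left l3 hc
      have hn : (a + b + c) * (n : ℝ) = n := by rw [hs, one_mul]
      have e := hxi i
      have : (t.1 i : ℝ) < n + 1 := by linarith
      have : t.1 i < n + 1 := by exact_mod_cast this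
      omega
    have hlow : ∀ i (n : ℤ), n ≤ u.1 i → n ≤ v.1 i → n ≤ w.1 i → n ≤ t.1 i := by
      intro i n k1 k2 k3
      have l1 : (n : ℝ) ≤ u.1 i := by exact_mod_cast k1
      have l2 : (n : ℝ) ≤ v.1 i := by exact_mod_cast k2
      have l3 : (n : ℝ) ≤ w.1 i := by exact_mod_cast k3
      have h1 := (abs_lt.1 (hlt i)).2
      have := mul_le_mul_of_nonneg_left l1 ha
      have := mul_le_mul_of_nonneg_left l2 hb
      have := mul_le_mul_of_nonneg_left l3 hc
      have hn : (a + b + c) * (n : ℝ) = n := by rw [hs, one_mul]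
      have e := hxi i
      have : (n : ℝ) - 1 < t.1 i := by linarith
      have : n - 1 < t.1 i := by exact_mod_cast this
      omega
    have := honeycomb_no_four hS hu hv hw ht fun i => by
      obtain ⟨k1, k2, k3⟩ := h4 i
      rw [abs_le] at k1 k2 k3 ⊢
      rw [abs_le, abs_le]
      have u1 := hup i (u.1 i + 1) (by omega) (by omega) (by omega)
      have u2 := hup i (v.1 i + 1) (by omega) (by omega) (by omega)
      have u3 := hup i (w.1 i + 1) (by omega) (by omega) (by omega)
      have v1 := hlow i (u.1 i - 1) (by omega) (by omega) (by omega)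
      have v2 := hlow i (v.1 i - 1) (by omega) (by omega) (by omega)
      have v3 := hlow i (w.1 i - 1) (by omega) (by omega) (by omega)
      omega
    tauto

/-- The triangles of the positive octant are unimodular: `|orient|` is `d` times the normalized
area. -/
lemma honeycomb_orient_nonneg {u v w : OctPoint d} (hS : {u, v, w} ∈ honeycombTris d)
    (hu : ∀ i, 0 ≤ u.1 i) (hv : ∀ i, 0 ≤ v.1 i) (hw : ∀ i, 0 ≤ w.1 i) :
    |orient u v w| = d := by
  obtain ⟨⟨h1, h2, h3⟩, h4⟩ := mem_honeycombTris.1 hS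
  have b1 := exists_coord_ne h1
  have b2 := exists_coord_ne h2
  have b3 := exists_coord_ne h3
  have s1 := sum_of_nonneg hu
  have s2 := sum_of_nonneg hv
  have s3 := sum_of_nonneg hw
  simp only [abs_le, forall_fin_three]  at h4
  obtain ⟨p, hp⟩ : ∃ p, p = v.1 0 - u.1 0 := ⟨_, rfl⟩
  obtain ⟨p', hp'⟩ : ∃ p, p = v.1 1 - u.1 1 := ⟨_, rfl⟩
  obtain ⟨q, hq⟩ : ∃ p, p = w.1 0 - u.1 0 := ⟨_, rfl⟩
  obtain ⟨q', hq'⟩ : ∃ p, p = w.1 1 - u.1 1 := ⟨_, rfl⟩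
  have e : orient u v w = (p * q' - p' * q) * d := by
    have e1 : v.1 0 = u.1 0 + p := by omega
    have e2 : v.1 1 = u.1 1 + p' := by omega
    have e3 : w.1 0 = u.1 0 + q := by omega
    have e4 : w.1 1 = u.1 1 + q' := by omega
    have e5 : v.1 2 = u.1 2 - p - p' := by omega
    have e6 : w.1 2 = u.1 2 - q - q' := by omega
    rw [← s1, orient, e1, e2, e3, e4, e5, e6]; ring
  have hD : p * q' - p' * q = 1 ∨ p * q' - p' * q = -1 := by
    have r1 : -1 ≤ p ∧ p ≤ 1 := by omega
    have r2 : -1 ≤ p' ∧ p' ≤ 1 := by omega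
    have r3 : -1 ≤ q ∧ q ≤ 1 := by omega
    have r4 : -1 ≤ q' ∧ q' ≤ 1 := by omega
    have r5 : -1 ≤ p + p' ∧ p + p' ≤ 1 := by omega
    have r6 : -1 ≤ q + q' ∧ q + q' ≤ 1 := by omega
    have r7 : -1 ≤ p - q ∧ p - q ≤ 1 := by omega
    have r8 : -1 ≤ p' - q' ∧ p' - q' ≤ 1 := by omega
    have r9 : -1 ≤ p + p' - q - q' ∧ p + p' - q - q' ≤ 1 := by omega
    have t1 : p ≠ 0 ∨ p' ≠ 0 := by omega
    have t2 : q ≠ 0 ∨ q' ≠ 0 := by omega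
    have t3 : p ≠ q ∨ p' ≠ q' := by omega
    clear e hp hp' hq hq' h4 b1 b2 b3
    obtain ⟨r1, r1'⟩ := r1
    obtain ⟨r2, r2'⟩ := r2
    obtain ⟨r3, r3'⟩ := r3
    obtain ⟨r4, r4'⟩ := r4
    interval_cases p <;> interval_cases p' <;> interval_cases q <;> interval_cases q' <;> omega
  rcases hD with h | h <;> rw [e, h] <;> simp

lemma octReflect_comb (g : Fin 3 → ℤˣ) (a b c : ℝ) (u v w : OctPoint d) :
    spaceReflect g (a • toSpace u + b • toSpace v + c • toSpace w)
      = a • toSpace (octReflect g u) + b • toSpace (octReflect g v)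
        + c • toSpace (octReflect g w) := by
  rw [spaceReflect_comb, toSpace_octReflect, toSpace_octReflect, toSpace_octReflect]

/-- The triangles in the positive octant cover it: the fractional parts of the coordinates of a point
add up to `0`, `1` or `2`, and the point is a lattice point, or belongs to a triangle `m + eᵢ` or
`m - eᵢ`, respectively. -/
lemma honeycomb_cover_nonneg (hd : 1 ≤ d) {x : Fin 3 → ℝ} (hx : x ∈ octahedron d)
    (h0 : ∀ i, 0 ≤ x i) :
    ∃ u v w, {u, v, w} ∈ honeycombTris d ∧ ∃ a b c : ℝ, 0 ≤ a ∧ 0 ≤ b ∧ 0 ≤ c ∧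
      a + b + c = 1 ∧ x = a • toSpace u + b • toSpace v + c • toSpace w := by
  have hsum : x 0 + x 1 + x 2 = d := by
    have : ∑ i, |x i| = d := hx
    rwa [Fin.sum_univ_three, abs_of_nonneg (h0 0), abs_of_nonneg (h0 1), abs_of_nonneg (h0 2)]
      at this
  -- upward triangles
  have up : ∀ (m : Fin 3 → ℤ) (l : Fin 3 → ℝ), (∀ i, 0 ≤ m i) → m 0 + m 1 + m 2 + 1 = d →
      (∀ i, 0 ≤ l i) → l 0 + l 1 + l 2 = 1 → (∀ i, x i = m i + l i) →
      ∃ u v w, {u, v, w} ∈ honeycombTris d ∧ ∃ a b c : ℝ, 0 ≤ a ∧ 0 ≤ b ∧ 0 ≤ c ∧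
      a + b + c = 1 ∧ x = a • toSpace u + b • toSpace v + c • toSpace w := by
    intro m l hm hmd hl hl1 hxm
    have m0 := hm 0
    have m1 := hm 1
    have m2 := hm 2
    refine ⟨⟨![m 0 + 1, m 1, m 2], ?_⟩, ⟨![m 0, m 1 + 1, m 2], ?_⟩, ⟨![m 0, m 1, m 2 + 1], ?_⟩, ?_,
      l 0, l 1, l 2, hl 0, hl 1, hl 2, hl1, ?_⟩
    · simp [Fin.sum_univ_three, abs_of_nonneg, m1, m2, add_nonneg, m0]; omega
    · simp [Fin.sum_univ_three, abs_of_nonneg, m1, m2, add_nonneg, m0]; omega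
    · simp [Fin.sum_univ_three, abs_of_nonneg, m1, m2, add_nonneg, m0]; omega
    · rw [mem_honeycombTris]
      refine ⟨⟨?_, ?_, ?_⟩, fun i => ?_⟩
      · intro h; have := congrFun (congrArg Subtype.val h) 0; simp at this
      · intro h; have := congrFun (congrArg Subtype.val h) 0; simp at this
      · intro h; have := congrFun (congrArg Subtype.val h) 1; simp at this
      · fin_cases i <;> simp
    · ext i
      rw [hxm]
      fin_cases i <;> simp <;> linear_combination (-(m _ : ℝ)) * hl1
  -- downward triangles
  have down : ∀ (m : Fin 3 → ℤ) (l : Fin 3 → ℝ), (∀ i, 1 ≤ m i) → m 0 + m 1 + m 2 - 1 = d →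
      (∀ i, 0 ≤ l i) → l 0 + l 1 + l 2 = 1 → (∀ i, x i = m i - l i) →
      ∃ u v w, {u, v, w} ∈ honeycombTris d ∧ ∃ a b c : ℝ, 0 ≤ a ∧ 0 ≤ b ∧ 0 ≤ c ∧
      a + b + c = 1 ∧ x = a • toSpace u + b • toSpace v + c • toSpace w := by
    intro m l hm hmd hl hl1 hxm
    have m0 := hm 0
    have m1 := hm 1
    have m2 := hm 2
    refine ⟨⟨![m 0 - 1, m 1, m 2], ?_⟩, ⟨![m 0, m 1 - 1, m 2], ?_⟩, ⟨![m 0, m 1, m 2 - 1], ?_⟩, ?_,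
      l 0, l 1, l 2, hl 0, hl 1, hl 2, hl1, ?_⟩
    · simp only [Fin.sum_univ_three, Matrix.cons_val]
      rw [abs_of_nonneg (by omega), abs_of_nonneg (by omega), abs_of_nonneg (by omega)]; omega
    · simp only [Fin.sum_univ_three, Matrix.cons_val]
      rw [abs_of_nonneg (by omega), abs_of_nonneg (by omega), abs_of_nonneg (by omega)]; omega
    · simp only [Fin.sum_univ_three, Matrix.cons_val]
      rw [abs_of_nonneg (by omega), abs_of_nonneg (by omega), abs_of_nonneg (by omega)]; omega
    · rw [mem_honeycombTris]
      refine ⟨⟨?_, ?_, ?_⟩, fun i => ?_⟩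
      · intro h; have := congrFun (congrArg Subtype.val h) 0; simp at this
      · intro h; have := congrFun (congrArg Subtype.val h) 0; simp at this
      · intro h; have := congrFun (congrArg Subtype.val h) 1; simp at this
      · fin_cases i <;> simp
    · ext i
      rw [hxm]
      fin_cases i <;> simp <;> linear_combination (-(m _ : ℝ)) * hl1
  have f0 : ∀ i, 0 ≤ Int.fract (x i) := fun i => Int.fract_nonneg _
  have f1 : ∀ i, Int.fract (x i) < 1 := fun i => Int.fract_lt_one _
  have ff : ∀ i, x i = ⌊x i⌋ + Int.fract (x i) := fun i => (Int.floor_add_fract _).symm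
  have fl : ∀ i, 0 ≤ ⌊x i⌋ := fun i => Int.floor_nonneg.2 (h0 i)
  have l0 := fl 0
  have l1 := fl 1
  have l2 := fl 2
  obtain ⟨n, hn⟩ : ∃ n : ℤ, n = d - (⌊x 0⌋ + ⌊x 1⌋ + ⌊x 2⌋) := ⟨_, rfl⟩
  have hnf : (n : ℝ) = Int.fract (x 0) + Int.fract (x 1) + Int.fract (x 2) := by
    rw [hn]; push_cast; linarith [ff 0, ff 1, ff 2]
  have hn0 : 0 ≤ n := by
    have : (0 : ℝ) ≤ n := by rw [hnf]; linarith [f0 0, f0 1, f0 2]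
    exact_mod_cast this
  have hn3 : n < 3 := by
    have : (n : ℝ) < 3 := by rw [hnf]; linarith [f1 0, f1 1, f1 2]
    exact_mod_cast this
  have hcase : n = 0 ∨ n = 1 ∨ n = 2 := by omega
  rcases hcase with rfl | rfl | rfl
  · -- a lattice point
    have z : ∀ i, Int.fract (x i) = 0 := by
      have := f0 0; have := f0 1; have := f0 2
      push_cast at hnf
      intro i
      fin_cases i <;> simp <;> linarith
    obtain ⟨k, hk⟩ : ∃ k, 1 ≤ ⌊x k⌋ := by
      by_contra! hcon
      have := hcon 0; have := hcon 1; have := hcon 2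
      omega
    refine up (fun i => ⌊x i⌋ - if i = k then 1 else 0) (fun i => if i = k then 1 else 0)
      (fun i => ?_) ?_ (fun i => ?_) ?_ (fun i => ?_)
    · have := fl i
      by_cases h : i = k
      · simp only [h, ite_true]; omega
      · simp only [h, ite_false]; omega
    · fin_cases k <;> simp <;> omega
    · by_cases h : i = k <;> simp [h]
    · fin_cases k <;> simp
    · have e := ff i
      rw [z i] at e
      push_cast
      linarith
  · exact up (fun i => ⌊x i⌋) (fun i => Int.fract (x i)) fl (by omega) f0
      (by rw [← hnf]; simp) ff
  · exact down (fun i => ⌊x i⌋ + 1) (fun i => 1 - Int.fract (x i)) (fun i => by have := fl i; omega)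
      (by omega) (fun i => by have := f1 i; linarith) (by push_cast at hnf; linarith)
      (fun i => by push_cast; linarith [ff i])

/-- The honeycomb triangulation of the octahedral sphere: each octant is subdivided by the lines
parallel to its sides. -/
def honeycomb (d : ℕ) (hd : 1 ≤ d) : OctTriangulation d where
  tris := honeycombTris d
  hat := honeycombHat
  card_eq _ h := h.1
  sameOctant _ h i := honeycomb_sameOctant h i
  reflect_mem g _ h := honeycomb_reflect g h
  unimodular u v w h := by
    obtain ⟨g, hg⟩ := exists_reflect_nonneg (honeycomb_sameOctant h)
    have h' := honeycomb_reflect g h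
    simp only [Finset.image_insert, Finset.image_singleton] at h'
    have := honeycomb_orient_nonneg h' (hg u (by simp)) (hg v (by simp)) (hg w (by simp))
    rw [orient_octReflect] at this
    rw [← this]
    rcases Int.units_eq_one_or (g 0) with h0 | h0 <;> rcases Int.units_eq_one_or (g 1) with h1 | h1 <;>
      rcases Int.units_eq_one_or (g 2) with h2 | h2 <;> simp [h0, h1, h2]
  hat_continuous t := by unfold honeycombHat; fun_prop
  hat_comb u v w h a b c ha hb hc hs := by
    obtain ⟨g, hg⟩ := exists_reflect_nonneg (honeycomb_sameOctant h)
    have h' := honeycomb_reflect g h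
    simp only [Finset.image_insert, Finset.image_singleton] at h'
    have := honeycomb_hat_nonneg h' (hg u (by simp)) (hg v (by simp)) (hg w (by simp)) ha hb hc hs
    rw [← octReflect_comb, honeycombHat_reflect] at this
    refine ⟨this.1, fun t t1 t2 t3 => ?_⟩
    have h5 := this.2 (octReflect g t) ((octReflect_injective g).ne t1)
      ((octReflect_injective g).ne t2) ((octReflect_injective g).ne t3)
    rwa [honeycombHat_reflect] at h5
  cover x hx := by
    have : ∀ i, ∃ e : ℤˣ, 0 ≤ ((e : ℤ) : ℝ) * x i := by
      intro i
      rcases le_total 0 (x i) with h | h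
      · exact ⟨1, by simpa using h⟩
      · exact ⟨-1, by simpa using h⟩
    choose g hg using this
    obtain ⟨u, v, w, h, a, b, c, ha, hb, hc, hs, he⟩ :=
      honeycomb_cover_nonneg hd (spaceReflect_mem g hx) hg
    have h' := honeycomb_reflect g h
    simp only [Finset.image_insert, Finset.image_singleton] at h'
    refine ⟨_, _, _, h', a, b, c, ha, hb, hc, hs, ?_⟩
    rw [← octReflect_comb, ← he, spaceReflect_spaceReflect]

/-! ### Flips -/

lemma octReflect_mul (g h : Fin 3 → ℤˣ) (u : OctPoint d) :
    octReflect g (octReflect h u) = octReflect (g * h) u := by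
  ext i; simp [mul_assoc]

lemma eq_of_octReflect_eq {g h : Fin 3 → ℤˣ} {u v : OctPoint d} (hu : ∀ i, 0 ≤ u.1 i)
    (hv : ∀ i, 0 ≤ v.1 i) (e : octReflect g u = octReflect h v) : u = v := by
  ext i
  have := congrArg abs (congrFun (congrArg Subtype.val e) i)
  rwa [octReflect_val, octReflect_val, abs_units_mul, abs_units_mul, abs_of_nonneg (hu i),
    abs_of_nonneg (hv i)] at this

lemma triple_eq {α : Type*} [DecidableEq α] {u v w p q r : α} (huv : u ≠ v) (huw : u ≠ w)
    (hvw : v ≠ w) (h : ({u, v, w} : Finset α) = {p, q, r}) :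
    (u = p ∧ v = q ∧ w = r) ∨ (u = p ∧ v = r ∧ w = q) ∨ (u = q ∧ v = p ∧ w = r) ∨
    (u = q ∧ v = r ∧ w = p) ∨ (u = r ∧ v = p ∧ w = q) ∨ (u = r ∧ v = q ∧ w = p) := by
  have h1 : u ∈ ({p, q, r} : Finset α) := h ▸ by simp
  have h2 : v ∈ ({p, q, r} : Finset α) := h ▸ by simp
  have h3 : w ∈ ({p, q, r} : Finset α) := h ▸ by simp
  simp only [Finset.mem_insert, Finset.mem_singleton] at h1 h2 h3
  grind

namespace OctTriangulation

/-- The triangles `abc` and `ace` of `K` lie in the positive octant and form a parallelogram with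
diagonal `ac`. -/
structure IsQuad (K : OctTriangulation d) (a b c e : OctPoint d) : Prop where
  tri_abc : {a, b, c} ∈ K.tris
  tri_ace : {a, c, e} ∈ K.tris
  add_eq : ∀ i, a.1 i + c.1 i = b.1 i + e.1 i
  nonneg_a : ∀ i, 0 ≤ a.1 i
  nonneg_b : ∀ i, 0 ≤ b.1 i
  nonneg_c : ∀ i, 0 ≤ c.1 i
  nonneg_e : ∀ i, 0 ≤ e.1 i

variable {K : OctTriangulation d} {a b c e : OctPoint d}

lemma IsQuad.swap (h : K.IsQuad a b c e) : K.IsQuad a e c b :=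
  ⟨tri_swap' h.tri_ace, tri_swap' h.tri_abc, fun i => by rw [h.add_eq, add_comm], h.nonneg_a,
    h.nonneg_e, h.nonneg_c, h.nonneg_b⟩

lemma IsQuad.swap' (h : K.IsQuad a b c e) : K.IsQuad c b a e :=
  ⟨tri_swap (tri_rotate h.tri_abc), tri_swap h.tri_ace,
    fun i => by rw [← h.add_eq, add_comm], h.nonneg_c, h.nonneg_b, h.nonneg_a, h.nonneg_e⟩

lemma IsQuad.orient_e (h : K.IsQuad a b c e) : orient a c e = -orient a c b := by
  have h0 := h.add_eq 0
  have h1 := h.add_eq 1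
  have h2 := h.add_eq 2
  have e0 : e.1 0 = a.1 0 + c.1 0 - b.1 0 := by linarith
  have e1 : e.1 1 = a.1 1 + c.1 1 - b.1 1 := by linarith
  have e2 : e.1 2 = a.1 2 + c.1 2 - b.1 2 := by linarith
  unfold orient
  rw [e0, e1, e2]; ring

lemma IsQuad.orient_abe (h : K.IsQuad a b c e) : orient a b e = orient a b c := by
  have h0 := h.add_eq 0
  have h1 := h.add_eq 1
  have h2 := h.add_eq 2
  have e0 : e.1 0 = a.1 0 + c.1 0 - b.1 0 := by linarith
  have e1 : e.1 1 = a.1 1 + c.1 1 - b.1 1 := by linarith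
  have e2 : e.1 2 = a.1 2 + c.1 2 - b.1 2 := by linarith
  unfold orient
  rw [e0, e1, e2]; ring

lemma IsQuad.ne_be (hd : 1 ≤ d) (h : K.IsQuad a b c e) : b ≠ e := by
  rintro rfl
  have := h.orient_e
  have h0 := orient_ne_zero hd h.tri_ace
  omega

/-- A copy of the parallelogram is determined by the ends of its diagonal. -/
lemma IsQuad.reflect_inj (hd : 1 ≤ d) (h : K.IsQuad a b c e) {g g' : Fin 3 → ℤˣ}
    (ha : octReflect g a = octReflect g' a) (hc : octReflect g c = octReflect g' c) : g = g' := by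
  ext i
  have ha' := congrFun (congrArg Subtype.val ha) i
  have hc' := congrFun (congrArg Subtype.val hc) i
  simp only [octReflect_val] at ha' hc'
  by_cases h1 : a.1 i = 0
  · by_cases h2 : c.1 i = 0
    · exfalso
      have hb := h.nonneg_b i
      have he := h.nonneg_e i
      have := h.add_eq i
      have hb0 : b.1 i = 0 := by omega
      apply orient_ne_zero hd h.tri_abc
      unfold orient
      fin_cases i <;> simp only [Fin.zero_eta, Fin.mk_one, Fin.reduceFinMk] at h1 h2 hb0 <;>
        rw [h1, h2, hb0] <;> ring
    · exact mul_right_cancel₀ h2 hc'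
  · exact mul_right_cancel₀ h1 ha'

/-- The only triangles at a copy of the diagonal `ac` are the two triangles of the parallelogram. -/
lemma IsQuad.tri_at_diagonal (hd : 1 ≤ d) (h : K.IsQuad a b c e) {g : Fin 3 → ℤˣ} {w : OctPoint d}
    (hw : {octReflect g a, octReflect g c, w} ∈ K.tris) :
    w = octReflect g b ∨ w = octReflect g e := by
  have h1 := tri_reflect g (tri_swap' h.tri_abc)
  have h2 := tri_reflect g h.tri_ace
  have hn := orient_ne_zero hd hw
  have hneg : orient (octReflect g a) (octReflect g c) (octReflect g e)
      = -orient (octReflect g a) (octReflect g c) (octReflect g b) := by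
    rw [orient_octReflect, orient_octReflect, h.orient_e]; ring
  have hn1 := orient_ne_zero hd h1
  rcases lt_or_gt_of_ne (mul_ne_zero hn hn1) with hlt | hgt
  · right
    refine apex_unique hd hw h2 ?_
    rw [hneg]; linarith
  · left
    exact apex_unique hd hw h1 hgt

lemma tri_of_mem {S : Finset (OctPoint d)} (hS : S ∈ K.tris) {u v : OctPoint d} (hu : u ∈ S)
    (hv : v ∈ S) (huv : u ≠ v) : ∃ w, S = {u, v, w} := by
  obtain ⟨x, y, z, hxy, hxz, hyz, rfl⟩ := Finset.card_eq_three.1 (K.card_eq S hS)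
  simp only [Finset.mem_insert, Finset.mem_singleton] at hu hv
  rcases hu with rfl | rfl | rfl <;> rcases hv with rfl | rfl | rfl
  · exact absurd rfl huv
  · exact ⟨z, rfl⟩
  · exact ⟨y, by ext; simp; tauto⟩
  · exact ⟨z, by ext; simp; tauto⟩
  · exact absurd rfl huv
  · exact ⟨x, by ext; simp; tauto⟩
  · exact ⟨y, by ext; simp; tauto⟩
  · exact ⟨x, by ext; simp; tauto⟩
  · exact absurd rfl huv

/-- The triangles after flipping the diagonals of all copies of a parallelogram. -/
def flipTris (K : OctTriangulation d) (a b c e : OctPoint d) : Set (Finset (OctPoint d)) :=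
  {S | (S ∈ K.tris ∧ ∀ g, ¬ (octReflect g a ∈ S ∧ octReflect g c ∈ S)) ∨
    ∃ g, S = {octReflect g a, octReflect g b, octReflect g e} ∨
      S = {octReflect g c, octReflect g b, octReflect g e}}

open Classical in
/-- The barycentric coordinates after flipping the diagonals of all copies of a parallelogram: in
each copy, the smaller one of the weights of the ends `a`, `c` of the old diagonal moves to the ends
`b`, `e` of the new diagonal. -/
def flipHat (K : OctTriangulation d) (a b c e : OctPoint d) (x : Fin 3 → ℝ) (t : OctPoint d) : ℝ :=
  K.hat x t + ∑ g : Fin 3 → ℤˣ,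
    (((if t = octReflect g b then 1 else 0) + (if t = octReflect g e then 1 else 0))
      - ((if t = octReflect g a then 1 else 0) + (if t = octReflect g c then 1 else 0)))
      * min (K.hat x (octReflect g a)) (K.hat x (octReflect g c))

lemma flipHat_swap (x : Fin 3 → ℝ) (t : OctPoint d) :
    flipHat K a e c b x t = flipHat K a b c e x t := by
  unfold flipHat
  congr 1
  refine Finset.sum_congr rfl fun g _ => ?_
  ring

lemma flipHat_swap' (x : Fin 3 → ℝ) (t : OctPoint d) :
    flipHat K c b a e x t = flipHat K a b c e x t := by
  unfold flipHat
  congr 1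
  refine Finset.sum_congr rfl fun g _ => ?_
  rw [min_comm]; ring

lemma hat_nonneg_of_comb {u v w : OctPoint d} (h : {u, v, w} ∈ K.tris) {α β γ : ℝ} (hα : 0 ≤ α)
    (hβ : 0 ≤ β) (hγ : 0 ≤ γ) (hs : α + β + γ = 1) {x : Fin 3 → ℝ}
    (hx : x = α • toSpace u + β • toSpace v + γ • toSpace w) (t : OctPoint d) : 0 ≤ K.hat x t := by
  obtain ⟨h1, h2, h3, h4⟩ := hat_three h hα hβ hγ hs hx
  by_cases t1 : t = u
  · rw [t1, h1]; exact hα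
  by_cases t2 : t = v
  · rw [t2, h2]; exact hβ
  by_cases t3 : t = w
  · rw [t3, h3]; exact hγ
  · rw [h4 t t1 t2 t3]

lemma flipHat_old {u v w : OctPoint d} (h : {u, v, w} ∈ K.tris)
    (h' : ∀ g, ¬ (octReflect g a ∈ ({u, v, w} : Finset (OctPoint d)) ∧
      octReflect g c ∈ ({u, v, w} : Finset (OctPoint d))))
    {α β γ : ℝ} (hα : 0 ≤ α)
    (hβ : 0 ≤ β) (hγ : 0 ≤ γ) (hs : α + β + γ = 1) {x : Fin 3 → ℝ}
    (hx : x = α • toSpace u + β • toSpace v + γ • toSpace w) (t : OctPoint d) :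
    flipHat K a b c e x t = K.hat x t := by
  have h4 := (hat_three h hα hβ hγ hs hx).2.2.2
  have hnn := hat_nonneg_of_comb h hα hβ hγ hs hx
  unfold flipHat
  rw [Finset.sum_eq_zero, add_zero]
  intro g _
  have hg := h' g
  simp only [Finset.mem_insert, Finset.mem_singleton] at hg
  have : min (K.hat x (octReflect g a)) (K.hat x (octReflect g c)) = 0 := by
    by_cases ha : octReflect g a = u ∨ octReflect g a = v ∨ octReflect g a = w
    · have hc : ¬ (octReflect g c = u ∨ octReflect g c = v ∨ octReflect g c = w) :=
        fun hc => hg ⟨ha, hc⟩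
      push Not at hc
      rw [h4 _ hc.1 hc.2.1 hc.2.2, min_eq_right (hnn _)]
    · push Not at ha
      rw [h4 _ ha.1 ha.2.1 ha.2.2, min_eq_left (hnn _)]
  rw [this, mul_zero]

open Classical in
/-- The new barycentric coordinates on a triangle of the old triangulation which belongs to a copy
of the parallelogram. -/
lemma IsQuad.flipHat_copy (hd : 1 ≤ d) (h : K.IsQuad a b c e) (g : Fin 3 → ℤˣ) {α β γ : ℝ}
    (hα : 0 ≤ α) (hβ : 0 ≤ β) (hγ : 0 ≤ γ) (hs : α + β + γ = 1) {x : Fin 3 → ℝ}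
    (hx : x = α • toSpace (octReflect g a) + β • toSpace (octReflect g b)
      + γ • toSpace (octReflect g c)) (t : OctPoint d) :
    flipHat K a b c e x t = K.hat x t +
      (((if t = octReflect g b then 1 else 0) + (if t = octReflect g e then 1 else 0))
      - ((if t = octReflect g a then 1 else 0) + (if t = octReflect g c then 1 else 0)))
      * min α γ := by
  have htri := tri_reflect g h.tri_abc
  obtain ⟨h1, h2, h3, h4⟩ := hat_three htri hα hβ hγ hs hx
  have hnn := hat_nonneg_of_comb htri hα hβ hγ hs hx
  obtain ⟨nab, nac, nbc⟩ := tri_ne h.tri_abc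
  unfold flipHat
  rw [Finset.sum_eq_single g, h1, h3]
  · intro g' _ hg'
    have : min (K.hat x (octReflect g' a)) (K.hat x (octReflect g' c)) = 0 := by
      by_cases ha : octReflect g' a = octReflect g a
      · have hc : octReflect g' c ≠ octReflect g c := fun hc => hg' (h.reflect_inj hd ha hc)
        rw [h4 (octReflect g' c) (fun k => nac (eq_of_octReflect_eq h.nonneg_c h.nonneg_a k).symm)
          (fun k => nbc (eq_of_octReflect_eq h.nonneg_c h.nonneg_b k).symm) hc,
          min_eq_right (hnn _)]
      · rw [h4 (octReflect g' a) ha (fun k => nab (eq_of_octReflect_eq h.nonneg_a h.nonneg_b k))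
          (fun k => nac (eq_of_octReflect_eq h.nonneg_a h.nonneg_c k)), min_eq_left (hnn _)]
    rw [this, mul_zero]
  · simp

lemma IsQuad.toSpace_add (h : K.IsQuad a b c e) (g : Fin 3 → ℤˣ) :
    toSpace (octReflect g a) + toSpace (octReflect g c)
      = toSpace (octReflect g b) + toSpace (octReflect g e) := by
  ext i
  simp only [Pi.add_apply, toSpace_apply, octReflect_val]
  have := h.add_eq i
  have : (g i : ℤ) * a.1 i + g i * c.1 i = g i * b.1 i + g i * e.1 i := by
    rw [← mul_add, ← mul_add, this]
  exact_mod_cast this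

/-- `flipHat` gives the barycentric coordinates on the triangle `pqr`. -/
def FlipGood (K : OctTriangulation d) (a b c e p q r : OctPoint d) : Prop :=
  ∀ (α β γ : ℝ), 0 ≤ α → 0 ≤ β → 0 ≤ γ → α + β + γ = 1 → ∀ x : Fin 3 → ℝ,
    x = α • toSpace p + β • toSpace q + γ • toSpace r →
    flipHat K a b c e x p = α ∧ flipHat K a b c e x q = β ∧ flipHat K a b c e x r = γ ∧
      ∀ t, t ≠ p → t ≠ q → t ≠ r → flipHat K a b c e x t = 0

lemma FlipGood.swap {p q r : OctPoint d} (h : FlipGood K a b c e p q r) :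
    FlipGood K a b c e q p r := by
  intro α β γ hα hβ hγ hs x hx
  obtain ⟨h1, h2, h3, h4⟩ := h β α γ hβ hα hγ (by linarith) x (by rw [hx]; abel)
  exact ⟨h2, h1, h3, fun t t1 t2 t3 => h4 t t2 t1 t3⟩

lemma FlipGood.rotate {p q r : OctPoint d} (h : FlipGood K a b c e p q r) :
    FlipGood K a b c e q r p := by
  intro α β γ hα hβ hγ hs x hx
  obtain ⟨h1, h2, h3, h4⟩ := h γ α β hγ hα hβ (by linarith) x (by rw [hx]; abel)
  exact ⟨h2, h3, h1, fun t t1 t2 t3 => h4 t t3 t1 t2⟩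

lemma IsQuad.flipGood_new_le (hd : 1 ≤ d) (h : K.IsQuad a b c e) (g : Fin 3 → ℤˣ) {α β γ : ℝ}
    (hα : 0 ≤ α) (hγ : 0 ≤ γ) (hγβ : γ ≤ β) (hs : α + β + γ = 1) {x : Fin 3 → ℝ}
    (hx : x = α • toSpace (octReflect g a) + β • toSpace (octReflect g b)
      + γ • toSpace (octReflect g e)) :
    flipHat K a b c e x (octReflect g a) = α ∧ flipHat K a b c e x (octReflect g b) = β ∧
    flipHat K a b c e x (octReflect g e) = γ ∧ ∀ t, t ≠ octReflect g a → t ≠ octReflect g b →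
      t ≠ octReflect g e → flipHat K a b c e x t = 0 := by
  have htri := tri_reflect g h.tri_abc
  have htri' := tri_reflect g h.tri_ace
  have hx' : x = (α + γ) • toSpace (octReflect g a) + (β - γ) • toSpace (octReflect g b)
      + γ • toSpace (octReflect g c) := by
    have e1 : toSpace (octReflect g c) = toSpace (octReflect g b) + toSpace (octReflect g e)
        - toSpace (octReflect g a) := by rw [← h.toSpace_add]; abel
    rw [hx, e1]; module
  obtain ⟨h1, h2, h3, h4⟩ := hat_three htri (add_nonneg hα hγ) (sub_nonneg.2 hγβ) hγ (by linarith)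
    hx'
  have key := h.flipHat_copy hd g (add_nonneg hα hγ) (sub_nonneg.2 hγβ) hγ (by linarith) hx'
  have hmin : min (α + γ) γ = γ := min_eq_right (by linarith)
  rw [hmin] at key
  obtain ⟨nab, nac, nbc⟩ := tri_ne htri
  obtain ⟨-, nae, nce⟩ := tri_ne htri'
  have nbe := (octReflect_injective g).ne (h.ne_be hd)
  refine ⟨?_, ?_, ?_, fun t t1 t2 t3 => ?_⟩
  · rw [key, h1]; simp [nab, nac, nae]
  · rw [key, h2]; simp [nab.symm, nbc, nbe]
  · rw [key, h4 _ nae.symm nbe.symm nce.symm]; simp [nae.symm, nce.symm, nbe.symm]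
  · by_cases t4 : t = octReflect g c
    · subst t4
      rw [key, h3]; simp [nac.symm, nbc.symm, nce]
    · rw [key, h4 t t1 t2 t4]; simp [t1, t2, t3, t4]

lemma IsQuad.flipGood_new (hd : 1 ≤ d) (h : K.IsQuad a b c e) (g : Fin 3 → ℤˣ) :
    FlipGood K a b c e (octReflect g a) (octReflect g b) (octReflect g e) := by
  intro α β γ hα hβ hγ hs x hx
  rcases le_total γ β with hle | hle
  · exact h.flipGood_new_le hd g hα hγ hle hs hx
  · obtain ⟨h1, h2, h3, h4⟩ := h.swap.flipGood_new_le hd g hα hβ hle (by linarith) (x := x)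
      (by rw [hx]; abel)
    simp only [flipHat_swap] at h1 h2 h3 h4
    exact ⟨h1, h3, h2, fun t t1 t2 t3 => h4 t t1 t3 t2⟩

lemma IsQuad.flipGood_new' (hd : 1 ≤ d) (h : K.IsQuad a b c e) (g : Fin 3 → ℤˣ) :
    FlipGood K a b c e (octReflect g c) (octReflect g b) (octReflect g e) := by
  have := h.swap'.flipGood_new hd g
  unfold FlipGood at this
  simp only [flipHat_swap'] at this
  exact this

lemma IsQuad.flipGood (hd : 1 ≤ d) (h : K.IsQuad a b c e) {u v w : OctPoint d} (huv : u ≠ v)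
    (huw : u ≠ w) (hvw : v ≠ w) (hS : {u, v, w} ∈ flipTris K a b c e) :
    FlipGood K a b c e u v w := by
  have perm : ∀ p q r, FlipGood K a b c e p q r → ({u, v, w} : Finset (OctPoint d)) = {p, q, r} →
      FlipGood K a b c e u v w := by
    intro p q r hg heq
    rcases triple_eq huv huw hvw heq with ⟨rfl, rfl, rfl⟩ | ⟨rfl, rfl, rfl⟩ | ⟨rfl, rfl, rfl⟩ |
      ⟨rfl, rfl, rfl⟩ | ⟨rfl, rfl, rfl⟩ | ⟨rfl, rfl, rfl⟩
    · exact hg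
    · exact hg.rotate.rotate.swap
    · exact hg.swap
    · exact hg.rotate
    · exact hg.rotate.rotate
    · exact hg.rotate.swap
  rcases hS with ⟨hS, hS'⟩ | ⟨g, hS | hS⟩
  · intro α β γ hα hβ hγ hs x hx
    simp only [flipHat_old hS hS' hα hβ hγ hs hx]
    exact hat_three hS hα hβ hγ hs hx
  · exact perm _ _ _ (h.flipGood_new hd g) hS
  · exact perm _ _ _ (h.flipGood_new' hd g) hS

lemma flip_cover_aux (h : K.IsQuad a b c e) (g : Fin 3 → ℤˣ) {α β γ : ℝ} (hα : 0 ≤ α) (hβ : 0 ≤ β)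
    (hγ : 0 ≤ γ) (hs : α + γ + β = 1) :
    ∃ u v w, {u, v, w} ∈ flipTris K a b c e ∧ ∃ α' β' γ' : ℝ, 0 ≤ α' ∧ 0 ≤ β' ∧ 0 ≤ γ' ∧
      α' + β' + γ' = 1 ∧ α • toSpace (octReflect g a) + γ • toSpace (octReflect g c)
        + β • toSpace (octReflect g b)
        = α' • toSpace u + β' • toSpace v + γ' • toSpace w := by
  have hadd := h.toSpace_add g
  rcases le_total α γ with hle | hle
  · refine ⟨_, _, _, Or.inr ⟨g, Or.inr rfl⟩, γ - α, β + α, α, by linarith, by linarith, hα,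
      by linarith, ?_⟩
    have e1 : toSpace (octReflect g a) = toSpace (octReflect g b) + toSpace (octReflect g e)
        - toSpace (octReflect g c) := by rw [← hadd]; abel
    rw [e1]; module
  · refine ⟨_, _, _, Or.inr ⟨g, Or.inl rfl⟩, α - γ, β + γ, γ, by linarith, by linarith, hγ,
      by linarith, ?_⟩
    have e1 : toSpace (octReflect g c) = toSpace (octReflect g b) + toSpace (octReflect g e)
        - toSpace (octReflect g a) := by rw [← hadd]; abel
    rw [e1]; module

lemma flipTris_swap (S : Finset (OctPoint d)) (hS : S ∈ flipTris K a e c b) :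
    S ∈ flipTris K a b c e := by
  rcases hS with hS | ⟨g, hS | hS⟩
  · exact Or.inl hS
  · exact Or.inr ⟨g, Or.inl (by rw [hS]; ext; simp; tauto)⟩
  · exact Or.inr ⟨g, Or.inr (by rw [hS]; ext; simp; tauto)⟩

lemma abs_orient_perm {u v w p q r : OctPoint d} (huv : u ≠ v) (huw : u ≠ w)
    (hvw : v ≠ w) (h : ({u, v, w} : Finset (OctPoint d)) = {p, q, r}) :
    |orient u v w| = |orient p q r| := by
  rcases triple_eq huv huw hvw h with ⟨rfl, rfl, rfl⟩ | ⟨rfl, rfl, rfl⟩ | ⟨rfl, rfl, rfl⟩ |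
      ⟨rfl, rfl, rfl⟩ | ⟨rfl, rfl, rfl⟩ | ⟨rfl, rfl, rfl⟩
  · rfl
  · rw [← abs_neg]; congr 1; unfold orient; ring
  · rw [← abs_neg]; congr 1; unfold orient; ring
  · congr 1; unfold orient; ring
  · congr 1; unfold orient; ring
  · rw [← abs_neg]; congr 1; unfold orient; ring

lemma abs_orient_octReflect (g : Fin 3 → ℤˣ) (u v w : OctPoint d) :
    |orient (octReflect g u) (octReflect g v) (octReflect g w)| = |orient u v w| := by
  rw [orient_octReflect, abs_mul, abs_mul, abs_mul]
  have : ∀ e : ℤˣ, |(e : ℤ)| = 1 := fun e => by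
    rcases Int.units_eq_one_or e with h | h <;> simp [h]
  simp [this]

lemma IsQuad.ne_all (hd : 1 ≤ d) (h : K.IsQuad a b c e) :
    a ≠ b ∧ a ≠ c ∧ a ≠ e ∧ b ≠ c ∧ b ≠ e ∧ c ≠ e := by
  obtain ⟨nab, nac, nbc⟩ := tri_ne h.tri_abc
  obtain ⟨-, nae, nce⟩ := tri_ne h.tri_ace
  exact ⟨nab, nac, nae, nbc, h.ne_be hd, nce⟩

lemma IsQuad.card_flip (hd : 1 ≤ d) (h : K.IsQuad a b c e) {S : Finset (OctPoint d)}
    (hS : S ∈ flipTris K a b c e) : S.card = 3 := by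
  obtain ⟨nab, nac, nae, nbc, nbe, nce⟩ := h.ne_all hd
  rcases hS with ⟨hS, -⟩ | ⟨g, rfl | rfl⟩
  · exact K.card_eq S hS
  · exact Finset.card_eq_three.2 ⟨_, _, _, (octReflect_injective g).ne nab,
      (octReflect_injective g).ne nae, (octReflect_injective g).ne nbe, rfl⟩
  · exact Finset.card_eq_three.2 ⟨_, _, _, (octReflect_injective g).ne nbc.symm,
      (octReflect_injective g).ne nce, (octReflect_injective g).ne nbe, rfl⟩

lemma ne_of_card_three {u v w : OctPoint d} (h : ({u, v, w} : Finset (OctPoint d)).card = 3) :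
    u ≠ v ∧ u ≠ w ∧ v ≠ w := by
  obtain ⟨x, y, z, hxy, hxz, hyz, he⟩ := Finset.card_eq_three.1 h
  rcases triple_eq hxy hxz hyz he.symm with ⟨rfl, rfl, rfl⟩ | ⟨rfl, rfl, rfl⟩ | ⟨rfl, rfl, rfl⟩ |
      ⟨rfl, rfl, rfl⟩ | ⟨rfl, rfl, rfl⟩ | ⟨rfl, rfl, rfl⟩ <;>
    refine ⟨?_, ?_, ?_⟩ <;> first | assumption | (apply Ne.symm; assumption)

/-- The triangulation obtained by flipping the diagonals of all copies of a parallelogram. -/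
def flip (K : OctTriangulation d) (a b c e : OctPoint d) (hd : 1 ≤ d) (h : K.IsQuad a b c e) :
    OctTriangulation d where
  tris := flipTris K a b c e
  hat := flipHat K a b c e
  card_eq _ hS := h.card_flip hd hS
  sameOctant S hS i := by
    rcases hS with ⟨hS, -⟩ | ⟨g, rfl | rfl⟩
    · exact K.sameOctant S hS i
    all_goals
      have ha := h.nonneg_a i
      have hb := h.nonneg_b i
      have hc := h.nonneg_c i
      have he := h.nonneg_e i
      rcases Int.units_eq_one_or (g i) with hg | hg <;> simp [hg] <;> tauto
  reflect_mem g S hS := by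
    rcases hS with ⟨hS, hS'⟩ | ⟨g', rfl | rfl⟩
    · refine Or.inl ⟨K.reflect_mem g S hS, fun g' => ?_⟩
      rintro ⟨ha, hc⟩
      apply hS' (g * g')
      rw [Finset.mem_image] at ha hc
      obtain ⟨x, hx, hxa⟩ := ha
      obtain ⟨y, hy, hyc⟩ := hc
      rw [← octReflect_mul, ← octReflect_mul, ← hxa, ← hyc, octReflect_octReflect,
        octReflect_octReflect]
      exact ⟨hx, hy⟩
    · exact Or.inr ⟨g * g', Or.inl (by simp [Finset.image_insert, octReflect_mul])⟩
    · exact Or.inr ⟨g * g', Or.inr (by simp [Finset.image_insert, octReflect_mul])⟩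
  unimodular u v w hS := by
    obtain ⟨n1, n2, n3⟩ := ne_of_card_three (h.card_flip hd hS)
    rcases hS with ⟨hS, -⟩ | ⟨g, hS | hS⟩
    · exact K.unimodular u v w hS
    · rw [abs_orient_perm n1 n2 n3 hS, abs_orient_octReflect, h.orient_abe]
      exact K.unimodular _ _ _ h.tri_abc
    · rw [abs_orient_perm n1 n2 n3 hS, abs_orient_octReflect, h.swap'.orient_abe]
      exact K.unimodular _ _ _ h.swap'.tri_abc
  hat_continuous t := by
    unfold flipHat
    refine (K.hat_continuous t).add (continuous_finsetSum _ fun g _ => ?_)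
    exact continuous_const.mul ((K.hat_continuous _).min (K.hat_continuous _))
  hat_comb u v w hS α β γ hα hβ hγ hs := by
    obtain ⟨n1, n2, n3⟩ := ne_of_card_three (h.card_flip hd hS)
    have := h.flipGood hd n1 n2 n3 hS α β γ hα hβ hγ hs _ rfl
    exact ⟨this.1, this.2.2.2⟩
  cover x hx := by
    obtain ⟨u, v, w, hS, α, β, γ, hα, hβ, hγ, hs, rfl⟩ := K.cover x hx
    by_cases hcase : ∃ g, octReflect g a ∈ ({u, v, w} : Finset (OctPoint d)) ∧
      octReflect g c ∈ ({u, v, w} : Finset (OctPoint d))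
    · obtain ⟨g, ha, hc⟩ := hcase
      obtain ⟨n1, n2, n3⟩ := tri_ne hS
      obtain ⟨w', hw'⟩ := tri_of_mem hS ha hc
        ((octReflect_injective g).ne (h.ne_all hd).2.1)
      have hS' := hS
      rw [hw'] at hS'
      -- rearrange the weights so that the ends of the diagonal come first
      obtain ⟨α', γ', β', hα', hγ', hβ', hs', he⟩ : ∃ α' γ' β' : ℝ, 0 ≤ α' ∧ 0 ≤ γ' ∧ 0 ≤ β' ∧
          α' + γ' + β' = 1 ∧ α • toSpace u + β • toSpace v + γ • toSpace w
            = α' • toSpace (octReflect g a) + γ' • toSpace (octReflect g c) + β' • toSpace w' := by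
        rcases triple_eq n1 n2 n3 hw' with ⟨rfl, rfl, rfl⟩ | ⟨rfl, rfl, rfl⟩ | ⟨rfl, rfl, rfl⟩ |
          ⟨rfl, rfl, rfl⟩ | ⟨rfl, rfl, rfl⟩ | ⟨rfl, rfl, rfl⟩
        · exact ⟨α, β, γ, hα, hβ, hγ, hs, rfl⟩
        · exact ⟨α, γ, β, hα, hγ, hβ, by linarith, by abel⟩
        · exact ⟨β, α, γ, hβ, hα, hγ, by linarith, by abel⟩
        · exact ⟨γ, α, β, hγ, hα, hβ, by linarith, by abel⟩
        · exact ⟨β, γ, α, hβ, hγ, hα, by linarith, by abel⟩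
        · exact ⟨γ, β, α, hγ, hβ, hα, by linarith, by abel⟩
      rw [he]
      rcases h.tri_at_diagonal hd hS' with rfl | rfl
      · exact flip_cover_aux h g hα' hβ' hγ' hs'
      · obtain ⟨u, v, w, hS, hrest⟩ := flip_cover_aux h.swap g hα' hβ' hγ' hs'
        exact ⟨u, v, w, flipTris_swap _ hS, hrest⟩
    · push Not at hcase
      exact ⟨u, v, w, Or.inl ⟨hS, fun g hg => hcase g hg.1 hg.2⟩, α, β, γ, hα, hβ, hγ, hs, rfl⟩

end OctTriangulation

/-! ### Cocycles modulo two -/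

namespace OctTriangulation

/-- Every one-cocycle modulo two on the triangulated sphere is a coboundary. A cochain is a symmetric
function on all pairs of vertices, of which only the values on edges matter. -/
def CocyclesExact (K : OctTriangulation d) : Prop :=
  ∀ ω : OctPoint d → OctPoint d → ZMod 2, (∀ u v, ω u v = ω v u) →
    (∀ u v w, {u, v, w} ∈ K.tris → ω u v + ω v w + ω u w = 0) →
    ∃ f : OctPoint d → ZMod 2, ∀ u v, K.Edge u v → ω u v = f u + f v

/-- A function which is constant along edges is constant. -/
def EdgeConnected (K : OctTriangulation d) : Prop :=
  ∀ f : OctPoint d → ZMod 2, (∀ u v, K.Edge u v → f u = f v) → ∀ u v, f u = f v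

end OctTriangulation

lemma zmod_add_self (x : ZMod 2) : x + x = 0 := CharTwo.add_self_eq_zero x

lemma zmod_add_eq_zero {x y : ZMod 2} : x + y = 0 ↔ x = y := CharTwo.add_eq_zero

/-- A cocycle on a triangular grid of side length `d` is the coboundary of `G`, if this is true on
the vertical edges and on the edges of the bottom line. -/
lemma grid_potential (H V D : ℕ → ℕ → ZMod 2) (G : ℕ → ℕ → ZMod 2)
    (hup : ∀ i j, i + j + 1 ≤ d → H i j + V i j + D i j = 0)
    (hdown : ∀ i j, i + j + 2 ≤ d → D i j + V (i + 1) j + H i (j + 1) = 0)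
    (hV : ∀ i j, i + j + 1 ≤ d → V i j = G i j + G i (j + 1))
    (hH : ∀ i, i + 1 ≤ d → H i 0 = G i 0 + G (i + 1) 0) :
    (∀ j i, i + j + 1 ≤ d → H i j = G i j + G (i + 1) j) ∧
    (∀ i j, i + j + 1 ≤ d → D i j = G (i + 1) j + G i (j + 1)) := by
  have diag : ∀ i j, i + j + 1 ≤ d → H i j = G i j + G (i + 1) j →
      D i j = G (i + 1) j + G i (j + 1) := by
    intro i j hij h
    have h1 := hup i j hij
    rw [h, hV i j hij] at h1
    have : D i j = G i j + G (i + 1) j + (G i j + G i (j + 1)) := (zmod_add_eq_zero.1 h1).symm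
    rw [this]
    linear_combination zmod_add_self (G i j)
  have hor : ∀ j i, i + j + 1 ≤ d → H i j = G i j + G (i + 1) j := by
    intro j
    induction j with
    | zero => intro i hi; exact hH i (by omega)
    | succ j ih =>
      intro i hi
      have h1 := hdown i j (by omega)
      rw [diag i j (by omega) (ih i (by omega)), hV (i + 1) j (by omega)] at h1
      have : H i (j + 1) = G (i + 1) j + G i (j + 1) + (G (i + 1) j + G (i + 1) (j + 1)) :=
        (zmod_add_eq_zero.1 h1).symm
      rw [this]
      linear_combination zmod_add_self (G (i + 1) j)
  exact ⟨hor, fun i j hij => diag i j hij (hor j i hij)⟩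

/-- The lattice point over `(x, y)` in the hemisphere given by the sign `γ` of the last coordinate,
with a junk value outside of the diamond. -/
def hemiPoint (d : ℕ) (γ : ℤˣ) (x y : ℤ) : OctPoint d :=
  if h : |x| + |y| ≤ d then ⟨![x, y, γ * (d - |x| - |y|)], by
    rw [Fin.sum_univ_three]
    simp only [Matrix.cons_val]
    rw [abs_units_mul, abs_of_nonneg (by omega : (0 : ℤ) ≤ d - |x| - |y|)]
    ring⟩
  else ⟨![d, 0, 0], by simp [Fin.sum_univ_three]⟩

lemma hemiPoint_val {γ : ℤˣ} {x y : ℤ} (h : |x| + |y| ≤ d) :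
    (hemiPoint d γ x y).1 = ![x, y, γ * (d - |x| - |y|)] := by
  rw [hemiPoint, dif_pos h]

lemma eq_hemiPoint {γ : ℤˣ} {u : OctPoint d} (h : 0 ≤ (γ : ℤ) * u.1 2) :
    u = hemiPoint d γ (u.1 0) (u.1 1) := by
  have hs := u.2
  rw [Fin.sum_univ_three] at hs
  have hle : |u.1 0| + |u.1 1| ≤ d := by have := abs_nonneg (u.1 2); omega
  apply Subtype.ext
  rw [hemiPoint_val hle]
  ext i
  fin_cases i
  · simp
  · simp
  · simp only [Fin.reduceFinMk, Matrix.cons_val]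
    have h2 : |u.1 2| = γ * u.1 2 := by rw [← abs_units_mul γ, abs_of_nonneg h]
    have : (d : ℤ) - |u.1 0| - |u.1 1| = γ * u.1 2 := by omega
    rw [this, ← mul_assoc, sq_unit, one_mul]

/-- Points of the octant with signs `α, β, γ`. -/
def octantPoint (d : ℕ) (α β γ : ℤˣ) (i j : ℕ) : OctPoint d := hemiPoint d γ (α * i) (β * j)

lemma octantPoint_val {α β γ : ℤˣ} {i j : ℕ} (h : i + j ≤ d) :
    (octantPoint d α β γ i j).1 = ![(α : ℤ) * i, (β : ℤ) * j, (γ : ℤ) * (d - i - j)] := by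
  rw [octantPoint, hemiPoint_val, abs_units_mul, abs_units_mul, Nat.abs_cast, Nat.abs_cast]
  rw [abs_units_mul, abs_units_mul, Nat.abs_cast, Nat.abs_cast]
  exact_mod_cast h

lemma exists_octantPoint {α β γ : ℤˣ} {u : OctPoint d} (h0 : 0 ≤ (α : ℤ) * u.1 0)
    (h1 : 0 ≤ (β : ℤ) * u.1 1) (h2 : 0 ≤ (γ : ℤ) * u.1 2) :
    ∃ i j : ℕ, i + j ≤ d ∧ u = octantPoint d α β γ i j := by
  have hs := u.2
  rw [Fin.sum_univ_three] at hs
  refine ⟨(u.1 0).natAbs, (u.1 1).natAbs, ?_, ?_⟩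
  · have := abs_nonneg (u.1 2)
    zify
    omega
  · have a0 : |u.1 0| = α * u.1 0 := by rw [← abs_units_mul α, abs_of_nonneg h0]
    have a1 : |u.1 1| = β * u.1 1 := by rw [← abs_units_mul β, abs_of_nonneg h1]
    rw [octantPoint, Int.natCast_natAbs, Int.natCast_natAbs, a0, a1, ← mul_assoc, ← mul_assoc,
      sq_unit, sq_unit, one_mul, one_mul]
    exact eq_hemiPoint h2

lemma ne_of_val_ne {u v : OctPoint d} (i : Fin 3) (h : u.1 i ≠ v.1 i) : u ≠ v := by
  rintro rfl; exact h rfl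

lemma abs_units_mul_sub (e : ℤˣ) (x y : ℤ) : |(e : ℤ) * x - e * y| = |x - y| := by
  rw [← mul_sub, abs_units_mul]

lemma units_mul_ne (e : ℤˣ) {x y : ℤ} (h : x ≠ y) : (e : ℤ) * x ≠ e * y := by
  intro h'
  exact h (mul_left_cancel₀ (by simp) h')

lemma octant_up (α β γ : ℤˣ) {i j : ℕ} (h : i + j + 1 ≤ d) :
    {octantPoint d α β γ i j, octantPoint d α β γ (i + 1) j, octantPoint d α β γ i (j + 1)}
      ∈ honeycombTris d := by
  rw [mem_honeycombTris]
  refine ⟨⟨ne_of_val_ne 0 ?_, ne_of_val_ne 1 ?_, ne_of_val_ne 0 ?_⟩, ?_⟩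
  · rw [octantPoint_val (by omega), octantPoint_val (by omega)]
    exact units_mul_ne α (by push_cast; omega)
  · rw [octantPoint_val (by omega), octantPoint_val (by omega)]
    exact units_mul_ne β (by push_cast; omega)
  · rw [octantPoint_val (by omega), octantPoint_val (by omega)]
    exact units_mul_ne α (by push_cast; omega)
  · intro k
    rw [octantPoint_val (by omega), octantPoint_val (by omega), octantPoint_val (by omega)]
    fin_cases k <;> simp only [Fin.zero_eta, Fin.mk_one, Fin.reduceFinMk, Matrix.cons_val,
      abs_units_mul_sub] <;> simp only [abs_le] <;> push_cast <;> omega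

lemma octant_down (α β γ : ℤˣ) {i j : ℕ} (h : i + j + 2 ≤ d) :
    {octantPoint d α β γ (i + 1) j, octantPoint d α β γ i (j + 1),
      octantPoint d α β γ (i + 1) (j + 1)} ∈ honeycombTris d := by
  rw [mem_honeycombTris]
  refine ⟨⟨ne_of_val_ne 0 ?_, ne_of_val_ne 1 ?_, ne_of_val_ne 0 ?_⟩, ?_⟩
  · rw [octantPoint_val (by omega), octantPoint_val (by omega)]
    exact units_mul_ne α (by push_cast; omega)
  · rw [octantPoint_val (by omega), octantPoint_val (by omega)]
    exact units_mul_ne β (by push_cast; omega)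
  · rw [octantPoint_val (by omega), octantPoint_val (by omega)]
    exact units_mul_ne α (by push_cast; omega)
  · intro k
    rw [octantPoint_val (by omega), octantPoint_val (by omega), octantPoint_val (by omega)]
    fin_cases k <;> simp only [Fin.zero_eta, Fin.mk_one, Fin.reduceFinMk, Matrix.cons_val,
      abs_units_mul_sub] <;> simp only [abs_le] <;> push_cast <;> omega

/-- The sum of `ω` along the path in the hemisphere `γ` which leads from the pole along the first
axis to `(x, 0)` and from there to `(x, y)`. -/
def hemiIntegral (ω : OctPoint d → OctPoint d → ZMod 2) (γ : ℤˣ) (x y : ℤ) : ZMod 2 :=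
  ∑ k ∈ Finset.range x.natAbs,
      ω (hemiPoint d γ (x.sign * k) 0) (hemiPoint d γ (x.sign * (k + 1 : ℕ)) 0)
    + ∑ k ∈ Finset.range y.natAbs,
      ω (hemiPoint d γ x (y.sign * k)) (hemiPoint d γ x (y.sign * (k + 1 : ℕ)))

lemma sum_range_signed (F : ℤ → ℤ → ZMod 2) (e : ℤˣ) (n : ℕ) :
    ∑ k ∈ Finset.range ((e : ℤ) * n).natAbs,
      F (((e : ℤ) * n).sign * k) (((e : ℤ) * n).sign * (k + 1 : ℕ))
      = ∑ k ∈ Finset.range n, F (e * k) (e * (k + 1 : ℕ)) := by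
  rcases Nat.eq_zero_or_pos n with rfl | hn
  · simp
  · have h1 : ((e : ℤ) * n).natAbs = n := by
      rcases Int.units_eq_one_or e with h | h <;> simp [h]
    have h2 : ((e : ℤ) * n).sign = e := by
      rcases Int.units_eq_one_or e with h | h
      · simp [h, Int.sign_eq_one_of_pos (by omega : (0 : ℤ) < n)]
      · simp [h, Int.sign_eq_one_of_pos (by omega : (0 : ℤ) < n)]
    rw [h1, h2]

lemma hemiIntegral_octant (ω : OctPoint d → OctPoint d → ZMod 2) (α β γ : ℤˣ) (i j : ℕ) :
    hemiIntegral ω γ (α * i) (β * j)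
      = ∑ k ∈ Finset.range i, ω (octantPoint d α β γ k 0) (octantPoint d α β γ (k + 1) 0)
        + ∑ k ∈ Finset.range j, ω (octantPoint d α β γ i k) (octantPoint d α β γ i (k + 1)) := by
  unfold hemiIntegral octantPoint
  rw [sum_range_signed (fun s t => ω (hemiPoint d γ s 0) (hemiPoint d γ t 0)) α i,
    sum_range_signed (fun s t => ω (hemiPoint d γ (α * i) s) (hemiPoint d γ (α * i) t)) β j]
  simp

/-- On every octant, a cocycle is the coboundary of its integral. -/
lemma octant_exact (ω : OctPoint d → OctPoint d → ZMod 2) (hsymm : ∀ u v, ω u v = ω v u)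
    (hω : ∀ u v w, {u, v, w} ∈ honeycombTris d → ω u v + ω v w + ω u w = 0) (α β γ : ℤˣ) :
    (∀ i j, i + j + 1 ≤ d → ω (octantPoint d α β γ i j) (octantPoint d α β γ (i + 1) j)
      = hemiIntegral ω γ (α * i) (β * j) + hemiIntegral ω γ (α * (i + 1 : ℕ)) (β * j)) ∧
    (∀ i j, i + j + 1 ≤ d → ω (octantPoint d α β γ i j) (octantPoint d α β γ i (j + 1))
      = hemiIntegral ω γ (α * i) (β * j) + hemiIntegral ω γ (α * i) (β * (j + 1 : ℕ))) ∧
    (∀ i j, i + j + 1 ≤ d → ω (octantPoint d α β γ (i + 1) j) (octantPoint d α β γ i (j + 1))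
      = hemiIntegral ω γ (α * (i + 1 : ℕ)) (β * j)
        + hemiIntegral ω γ (α * i) (β * (j + 1 : ℕ))) := by
  set G : ℕ → ℕ → ZMod 2 := fun i j => hemiIntegral ω γ (α * i) (β * j) with hG
  have hGe : ∀ i j, G i j = _ := fun i j => hemiIntegral_octant ω α β γ i j
  have hV : ∀ i j, ω (octantPoint d α β γ i j) (octantPoint d α β γ i (j + 1))
      = G i j + G i (j + 1) := by
    intro i j
    rw [hGe, hGe, Finset.sum_range_succ]
    generalize (∑ k ∈ Finset.range i, _ : ZMod 2) = s
    generalize (∑ k ∈ Finset.range j, _ : ZMod 2) = t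
    linear_combination -zmod_add_self s - zmod_add_self t
  have hH : ∀ i, ω (octantPoint d α β γ i 0) (octantPoint d α β γ (i + 1) 0)
      = G i 0 + G (i + 1) 0 := by
    intro i
    rw [hGe, hGe, Finset.sum_range_succ]
    generalize (∑ k ∈ Finset.range i, _ : ZMod 2) = s
    simp only [Finset.range_zero, Finset.sum_empty]
    linear_combination -zmod_add_self s
  have := grid_potential (d := d)
    (fun i j => ω (octantPoint d α β γ i j) (octantPoint d α β γ (i + 1) j))
    (fun i j => ω (octantPoint d α β γ i j) (octantPoint d α β γ i (j + 1)))
    (fun i j => ω (octantPoint d α β γ (i + 1) j) (octantPoint d α β γ i (j + 1))) G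
    (fun i j hij => by
      have := hω _ _ _ (octant_up α β γ hij)
      linear_combination this)
    (fun i j hij => by
      have := hω _ _ _ (octant_down α β γ hij)
      simp only [hsymm (octantPoint d α β γ i (j + 1)) (octantPoint d α β γ (i + 1) (j + 1))]
        at this ⊢
      linear_combination this)
    (fun i j _ => hV i j) (fun i _ => hH i)
  exact ⟨fun i j hij => this.1 j i hij, fun i j _ => hV i j, this.2⟩

lemma hemiPoint_equator (γ γ' : ℤˣ) {x y : ℤ} (h : |x| + |y| = d) :
    hemiPoint d γ x y = hemiPoint d γ' x y := by
  apply Subtype.ext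
  rw [hemiPoint_val h.le, hemiPoint_val h.le]
  have : (d : ℤ) - |x| - |y| = 0 := by omega
  rw [this]; simp

/-- The integrals over the two hemispheres differ by a constant on the equator. -/
lemma equator_const (ω : OctPoint d → OctPoint d → ZMod 2) (hsymm : ∀ u v, ω u v = ω v u)
    (hω : ∀ u v w, {u, v, w} ∈ honeycombTris d → ω u v + ω v w + ω u w = 0) :
    ∃ c, ∀ x y : ℤ, |x| + |y| = d → hemiIntegral ω 1 x y = hemiIntegral ω (-1) x y + c := by
  set D : ℤ → ℤ → ZMod 2 := fun x y => hemiIntegral ω 1 x y + hemiIntegral ω (-1) x y with hD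
  have step : ∀ (α β : ℤˣ) (i j : ℕ), i + j + 1 = d →
      D (α * (i + 1 : ℕ)) (β * j) = D (α * i) (β * (j + 1 : ℕ)) := by
    intro α β i j hij
    have h1 := (octant_exact ω hsymm hω α β 1).2.2 i j hij.le
    have h2 := (octant_exact ω hsymm hω α β (-1)).2.2 i j hij.le
    have e1 : octantPoint d α β 1 (i + 1) j = octantPoint d α β (-1) (i + 1) j := by
      refine hemiPoint_equator _ _ ?_
      rw [abs_units_mul, abs_units_mul, Nat.abs_cast, Nat.abs_cast]; omega
    have e2 : octantPoint d α β 1 i (j + 1) = octantPoint d α β (-1) i (j + 1) := by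
      refine hemiPoint_equator _ _ ?_
      rw [abs_units_mul, abs_units_mul, Nat.abs_cast, Nat.abs_cast]; omega
    rw [e1, e2, h2] at h1
    simp only [hD]
    rw [← zmod_add_eq_zero]
    rw [← zmod_add_eq_zero] at h1
    linear_combination h1
  have side : ∀ (α β : ℤˣ) (i j : ℕ), i + j = d → D (α * i) (β * j) = D 0 (β * d) := by
    intro α β i
    induction i with
    | zero => intro j hj; simp at hj; simp [hj]
    | succ i ih =>
      intro j hj
      rw [step α β i j (by omega)]
      exact ih (j + 1) (by omega)
  have side' : ∀ (α β : ℤˣ), D 0 (β * d) = D (α * d) 0 := by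
    intro α β
    have := side α β d 0 (by omega)
    simpa using this.symm
  have all : ∀ x y : ℤ, |x| + |y| = d → D x y = D d 0 := by
    intro x y h
    obtain ⟨α, hα⟩ : ∃ α : ℤˣ, x = α * x.natAbs := by
      rcases Int.natAbs_eq x with h | h
      · exact ⟨1, by simpa using h⟩
      · exact ⟨-1, by simpa using h⟩
    obtain ⟨β, hβ⟩ : ∃ α : ℤˣ, y = α * y.natAbs := by
      rcases Int.natAbs_eq y with h | h
      · exact ⟨1, by simpa using h⟩
      · exact ⟨-1, by simpa using h⟩
    rw [hα, hβ, side α β _ _ (by zify; exact h), side' 1 β]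
    simp
  refine ⟨D d 0, fun x y h => ?_⟩
  rw [← all x y h]
  simp only [hD]
  linear_combination -zmod_add_self (hemiIntegral ω (-1) x y)

/-- Every edge of the honeycomb triangulation is one of the three kinds of edges of the grid of some
octant. -/
lemma honeycomb_edge_cases {u v w : OctPoint d} (h : {u, v, w} ∈ honeycombTris d) :
    ∃ (α β γ : ℤˣ) (i j : ℕ), i + j + 1 ≤ d ∧
    (0 ≤ (γ : ℤ) * u.1 2 ∧ 0 ≤ (γ : ℤ) * v.1 2) ∧
    ((u = octantPoint d α β γ i j ∧ v = octantPoint d α β γ (i + 1) j) ∨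
     (v = octantPoint d α β γ i j ∧ u = octantPoint d α β γ (i + 1) j) ∨
     (u = octantPoint d α β γ i j ∧ v = octantPoint d α β γ i (j + 1)) ∨
     (v = octantPoint d α β γ i j ∧ u = octantPoint d α β γ i (j + 1)) ∨
     (u = octantPoint d α β γ (i + 1) j ∧ v = octantPoint d α β γ i (j + 1)) ∨
     (v = octantPoint d α β γ (i + 1) j ∧ u = octantPoint d α β γ i (j + 1))) := by
  obtain ⟨g, hg⟩ := exists_reflect_nonneg (honeycomb_sameOctant h)
  have hu := hg u (by simp)
  have hv := hg v (by simp)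
  simp only [octReflect_val] at hu hv
  obtain ⟨i, j, hij, hui⟩ := exists_octantPoint (hu 0) (hu 1) (hu 2)
  obtain ⟨i', j', hij', hvi⟩ := exists_octantPoint (hv 0) (hv 1) (hv 2)
  obtain ⟨⟨huv, -, -⟩, hadj⟩ := mem_honeycombTris.1 h
  have hadj0 := (hadj 0).1
  have hadj1 := (hadj 1).1
  have hadj2 := (hadj 2).1
  have hu2 := hu 2
  have hv2 := hv 2
  rw [hui, hvi, octantPoint_val hij, octantPoint_val hij'] at hadj0 hadj1 hadj2
  simp only [Matrix.cons_val, abs_units_mul_sub] at hadj0 hadj1 hadj2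
  rw [abs_le] at hadj0 hadj1 hadj2
  have hne : i ≠ i' ∨ j ≠ j' := by
    by_contra! hcon
    exact huv (by rw [hui, hvi, hcon.1, hcon.2])
  have cases6 : (i' = i + 1 ∧ j' = j) ∨ (i = i' + 1 ∧ j' = j) ∨ (i' = i ∧ j' = j + 1) ∨
      (i' = i ∧ j = j' + 1) ∨ (i = i' + 1 ∧ j' = j + 1) ∨ (i' = i + 1 ∧ j = j' + 1) := by omega
  rcases cases6 with ⟨rfl, rfl⟩ | ⟨rfl, rfl⟩ | ⟨rfl, rfl⟩ | ⟨rfl, rfl⟩ | ⟨rfl, rfl⟩ | ⟨rfl, rfl⟩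
  · exact ⟨g 0, g 1, g 2, i, j', by omega, ⟨hu2, hv2⟩, by tauto⟩
  · exact ⟨g 0, g 1, g 2, i', j', by omega, ⟨hu2, hv2⟩, by tauto⟩
  · exact ⟨g 0, g 1, g 2, i', j, by omega, ⟨hu2, hv2⟩, by tauto⟩
  · exact ⟨g 0, g 1, g 2, i', j', by omega, ⟨hu2, hv2⟩, by tauto⟩
  · exact ⟨g 0, g 1, g 2, i', j, by omega, ⟨hu2, hv2⟩, by tauto⟩
  · exact ⟨g 0, g 1, g 2, i, j', by omega, ⟨hu2, hv2⟩, by tauto⟩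

/-- The potential of a cocycle is its integral from the poles of the two hemispheres; on the lower
hemisphere it is corrected by the constant by which the integrals differ on the equator. -/
lemma honeycomb_cocyclesExact (hd : 1 ≤ d) : (honeycomb d hd).CocyclesExact := by
  intro ω hsymm hω
  replace hω : ∀ u v w, {u, v, w} ∈ honeycombTris d → ω u v + ω v w + ω u w = 0 := hω
  obtain ⟨c, hc⟩ := equator_const ω hsymm hω
  set f : OctPoint d → ZMod 2 := fun u =>
    if 0 ≤ u.1 2 then hemiIntegral ω 1 (u.1 0) (u.1 1)
    else hemiIntegral ω (-1) (u.1 0) (u.1 1) + c with hf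
  have hfp : ∀ u : OctPoint d, 0 ≤ u.1 2 → f u = hemiIntegral ω 1 (u.1 0) (u.1 1) :=
    fun u hu => if_pos hu
  have hfn : ∀ u : OctPoint d, u.1 2 ≤ 0 → f u = hemiIntegral ω (-1) (u.1 0) (u.1 1) + c := by
    intro u hu
    rcases hu.lt_or_eq with h | h
    · exact if_neg (not_le.2 h)
    · rw [hfp u h.ge]
      refine hc _ _ ?_
      have := u.2
      rw [Fin.sum_univ_three, h] at this
      simpa using this
  -- on one octant, `f` is the integral up to a constant
  have hfo : ∀ γ : ℤˣ, ∃ c', ∀ u : OctPoint d, 0 ≤ (γ : ℤ) * u.1 2 →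
      f u = hemiIntegral ω γ (u.1 0) (u.1 1) + c' := by
    intro γ
    rcases Int.units_eq_one_or γ with rfl | rfl
    · exact ⟨0, fun u hu => by rw [hfp u (by simpa using hu), add_zero]⟩
    · exact ⟨c, fun u hu => hfn u (by simpa using hu)⟩
  have hval : ∀ (α β γ : ℤˣ) (i j : ℕ), i + j ≤ d →
      (octantPoint d α β γ i j).1 0 = α * i ∧ (octantPoint d α β γ i j).1 1 = β * j := by
    intro α β γ i j h
    rw [octantPoint_val h]; simp
  refine ⟨f, ?_⟩
  rintro u v ⟨w, h⟩
  obtain ⟨α, β, γ, i, j, hij, ⟨hu, hv⟩, hcases⟩ := honeycomb_edge_cases h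
  obtain ⟨c', hc'⟩ := hfo γ
  obtain ⟨h1, h2, h3⟩ := octant_exact ω hsymm hω α β γ
  have e1 := h1 i j hij
  have e2 := h2 i j hij
  have e3 := h3 i j hij
  obtain ⟨p1, p2⟩ := hval α β γ i j (by omega)
  obtain ⟨p3, p4⟩ := hval α β γ (i + 1) j (by omega)
  obtain ⟨p5, p6⟩ := hval α β γ i (j + 1) (by omega)
  have cc := zmod_add_self c'
  rw [hc' u hu, hc' v hv]
  rcases hcases with ⟨rfl, rfl⟩ | ⟨rfl, rfl⟩ | ⟨rfl, rfl⟩ | ⟨rfl, rfl⟩ | ⟨rfl, rfl⟩ | ⟨rfl, rfl⟩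
  · rw [e1, p1, p2, p3, p4]; linear_combination -cc
  · rw [hsymm, e1, p1, p2, p3, p4]; linear_combination -cc
  · rw [e2, p1, p2, p5, p6]; linear_combination -cc
  · rw [hsymm, e2, p1, p2, p5, p6]; linear_combination -cc
  · rw [e3, p3, p4, p5, p6]; linear_combination -cc
  · rw [hsymm, e3, p3, p4, p5, p6]; linear_combination -cc

lemma honeycomb_edgeConnected (hd : 1 ≤ d) : (honeycomb d hd).EdgeConnected := by
  intro f hf
  have hor : ∀ (α β γ : ℤˣ) (i j : ℕ), i + j + 1 ≤ d →
      f (octantPoint d α β γ i j) = f (octantPoint d α β γ (i + 1) j) :=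
    fun α β γ i j h => hf _ _ ⟨_, octant_up α β γ h⟩
  have ver : ∀ (α β γ : ℤˣ) (i j : ℕ), i + j + 1 ≤ d →
      f (octantPoint d α β γ i j) = f (octantPoint d α β γ i (j + 1)) :=
    fun α β γ i j h => hf _ _ ⟨_, OctTriangulation.tri_swap' (K := honeycomb d hd)
      (octant_up α β γ h)⟩
  -- every vertex of an octant is connected to its pole, and the poles via the equator
  have hor0 : ∀ (α β γ : ℤˣ) (i : ℕ), i ≤ d →
      f (octantPoint d α β γ i 0) = f (octantPoint d α β γ 0 0) := by
    intro α β γ i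
    induction i with
    | zero => intro _; rfl
    | succ i ih => intro hi; rw [← hor α β γ i 0 (by omega), ih (by omega)]
  have all : ∀ (α β γ : ℤˣ) (j i : ℕ), i + j ≤ d →
      f (octantPoint d α β γ i j) = f (octantPoint d α β γ 0 0) := by
    intro α β γ j
    induction j with
    | zero => intro i hi; exact hor0 α β γ i hi
    | succ j ih => intro i hi; rw [← ver α β γ i j (by omega), ih i (by omega)]
  have pole : ∀ (α β γ : ℤˣ), octantPoint d α β γ 0 0 = hemiPoint d γ 0 0 := by
    intro α β γ; simp [octantPoint]
  have poles : ∀ γ : ℤˣ, f (hemiPoint d γ 0 0) = f (hemiPoint d 1 0 0) := by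
    intro γ
    rw [← pole 1 1 γ, ← pole 1 1 1, ← all 1 1 γ 0 d (by omega), ← all 1 1 1 0 d (by omega)]
    congr 1
    refine hemiPoint_equator _ _ ?_
    simp
  have single : ∀ u, f u = f (hemiPoint d 1 0 0) := by
    intro u
    have hs : ∀ x : ℤ, ∃ α : ℤˣ, 0 ≤ (α : ℤ) * x := by
      intro x
      rcases le_total 0 x with h | h
      · exact ⟨1, by simpa using h⟩
      · exact ⟨-1, by simpa using h⟩
    obtain ⟨α, hα⟩ := hs (u.1 0)
    obtain ⟨β, hβ⟩ := hs (u.1 1)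
    obtain ⟨γ, hγ⟩ := hs (u.1 2)
    obtain ⟨i, j, hij, rfl⟩ := exists_octantPoint hα hβ hγ
    rw [all α β γ j i hij, pole, poles]
  intro u v
  rw [single u, single v]

namespace OctTriangulation

/-! ### Flips and cocycles -/

/-- `uv` is a copy of the diagonal `ac`. -/
def IsDiag (a c u v : OctPoint d) : Prop :=
  ∃ g, (u = octReflect g a ∧ v = octReflect g c) ∨ (u = octReflect g c ∧ v = octReflect g a)

lemma IsDiag.symm {a c u v : OctPoint d} (h : IsDiag a c u v) : IsDiag a c v u := by
  obtain ⟨g, h | h⟩ := h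
  · exact ⟨g, Or.inr ⟨h.2, h.1⟩⟩
  · exact ⟨g, Or.inl ⟨h.2, h.1⟩⟩

/-- `K'` arises from `K` by flipping the diagonal `ac` of the parallelogram `abce` to `be`, in all
copies. -/
structure IsFlip (K K' : OctTriangulation d) (a b c e : OctPoint d) : Prop where
  quad : K.IsQuad a b c e
  tris_eq : K'.tris = flipTris K a b c e

variable {K K' : OctTriangulation d} {a b c e : OctPoint d}

lemma isFlip_flip (hd : 1 ≤ d) (h : K.IsQuad a b c e) : IsFlip K (flip K a b c e hd h) a b c e :=
  ⟨h, rfl⟩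

lemma octReflect_one (u : OctPoint d) : octReflect 1 u = u := by
  ext i; simp

lemma IsFlip.tri_new (h : IsFlip K K' a b c e) (g : Fin 3 → ℤˣ) :
    {octReflect g a, octReflect g b, octReflect g e} ∈ K'.tris ∧
    {octReflect g c, octReflect g b, octReflect g e} ∈ K'.tris := by
  rw [h.tris_eq]
  exact ⟨Or.inr ⟨g, Or.inl rfl⟩, Or.inr ⟨g, Or.inr rfl⟩⟩

lemma IsFlip.quad' (h : IsFlip K K' a b c e) : K'.IsQuad b c e a := by
  have h1 := (h.tri_new 1).1
  have h2 := (h.tri_new 1).2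
  simp only [octReflect_one] at h1 h2
  exact ⟨tri_swap h2, tri_rotate h1, fun i => by rw [← h.quad.add_eq, add_comm], h.quad.nonneg_b,
    h.quad.nonneg_c, h.quad.nonneg_e, h.quad.nonneg_a⟩

lemma midpoint_hat {u v w : OctPoint d} (h : {u, v, w} ∈ K.tris) :
    K.hat ((1 / 2 : ℝ) • (toSpace u + toSpace v)) u = 1 / 2 ∧
    ∀ t, t ≠ u → t ≠ v → K.hat ((1 / 2 : ℝ) • (toSpace u + toSpace v)) t = 0 := by
  have := hat_three h (a := 1 / 2) (b := 1 / 2) (c := 0) (by norm_num) (by norm_num) le_rfl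
    (by norm_num) (x := (1 / 2 : ℝ) • (toSpace u + toSpace v)) (by module)
  refine ⟨this.1, fun t t1 t2 => ?_⟩
  by_cases t3 : t = w
  · rw [t3, this.2.2.1]
  · exact this.2.2.2 t t1 t2 t3

/-- The other diagonal of a parallelogram is not an edge. -/
lemma IsQuad.no_cross (hd : 1 ≤ d) (h : K.IsQuad a b c e) {S : Finset (OctPoint d)}
    (hS : S ∈ K.tris) (g : Fin 3 → ℤˣ) : ¬ (octReflect g b ∈ S ∧ octReflect g e ∈ S) := by
  rintro ⟨hb, he⟩
  obtain ⟨nab, nac, nae, nbc, nbe, nce⟩ := h.ne_all hd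
  obtain ⟨w, rfl⟩ := tri_of_mem hS hb he ((octReflect_injective g).ne nbe)
  have h1 := (midpoint_hat hS).1
  rw [← h.toSpace_add g] at h1
  rw [(midpoint_hat (tri_reflect g (tri_swap' h.tri_abc))).2 _ ((octReflect_injective g).ne nab.symm)
    ((octReflect_injective g).ne nbc)] at h1
  norm_num at h1

lemma IsFlip.symm (hd : 1 ≤ d) (h : IsFlip K K' a b c e) : IsFlip K' K b c e a := by
  refine ⟨h.quad', ?_⟩
  obtain ⟨nab, nac, nae, nbc, nbe, nce⟩ := h.quad.ne_all hd
  ext S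
  constructor
  · intro hS
    by_cases hcase : ∃ g, octReflect g a ∈ S ∧ octReflect g c ∈ S
    · obtain ⟨g, ha, hc⟩ := hcase
      obtain ⟨w, rfl⟩ := tri_of_mem hS ha hc ((octReflect_injective g).ne nac)
      rcases h.quad.tri_at_diagonal hd hS with rfl | rfl
      · exact Or.inr ⟨g, Or.inl (by ext; simp; tauto)⟩
      · exact Or.inr ⟨g, Or.inr (by ext; simp; tauto)⟩
    · push Not at hcase
      refine Or.inl ⟨?_, fun g => h.quad.no_cross hd hS g⟩
      rw [h.tris_eq]
      exact Or.inl ⟨hS, fun g hg => hcase g hg.1 hg.2⟩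
  · rintro (⟨hS, hS'⟩ | ⟨g, rfl | rfl⟩)
    · rw [h.tris_eq] at hS
      rcases hS with ⟨hS, -⟩ | ⟨g, rfl | rfl⟩
      · exact hS
      · exact absurd ⟨by simp, by simp⟩ (hS' g)
      · exact absurd ⟨by simp, by simp⟩ (hS' g)
    · have := tri_reflect g h.quad.tri_abc
      convert this using 1; ext; simp; tauto
    · have := tri_reflect g h.quad.tri_ace
      convert this using 1; ext; simp; tauto

/-- A triangle of `K` is a triangle of `K'`, or one of the two halves of a copy of the
parallelogram. -/
lemma IsFlip.tri_cases (hd : 1 ≤ d) (h : IsFlip K K' a b c e) {S : Finset (OctPoint d)}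
    (hS : S ∈ K.tris) : (S ∈ K'.tris ∧ ∀ g, ¬ (octReflect g a ∈ S ∧ octReflect g c ∈ S)) ∨
      ∃ g, S = {octReflect g a, octReflect g c, octReflect g b} ∨
        S = {octReflect g a, octReflect g c, octReflect g e} := by
  by_cases hcase : ∃ g, octReflect g a ∈ S ∧ octReflect g c ∈ S
  · obtain ⟨g, ha, hc⟩ := hcase
    obtain ⟨w, rfl⟩ := tri_of_mem hS ha hc
      ((octReflect_injective g).ne (h.quad.ne_all hd).2.1)
    rcases h.quad.tri_at_diagonal hd hS with rfl | rfl
    · exact Or.inr ⟨g, Or.inl rfl⟩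
    · exact Or.inr ⟨g, Or.inr rfl⟩
  · push Not at hcase
    refine Or.inl ⟨?_, fun g hg => hcase g hg.1 hg.2⟩
    rw [h.tris_eq]
    exact Or.inl ⟨hS, fun g hg => hcase g hg.1 hg.2⟩

/-- No side of a parallelogram is a copy of its diagonal. -/
lemma IsQuad.side_not_diag (hd : 1 ≤ d) (h : K.IsQuad a b c e) (g : Fin 3 → ℤˣ) :
    ¬ IsDiag a c (octReflect g a) (octReflect g b) ∧ ¬ IsDiag a c (octReflect g c) (octReflect g b) ∧
    ¬ IsDiag a c (octReflect g a) (octReflect g e) ∧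
    ¬ IsDiag a c (octReflect g c) (octReflect g e) := by
  obtain ⟨nab, nac, nae, nbc, nbe, nce⟩ := h.ne_all hd
  refine ⟨?_, ?_, ?_, ?_⟩ <;> rintro ⟨g', ⟨h1, h2⟩ | ⟨h1, h2⟩⟩
  · exact nbc (eq_of_octReflect_eq h.nonneg_b h.nonneg_c h2)
  · exact nac (eq_of_octReflect_eq h.nonneg_a h.nonneg_c h1)
  · exact nbc (eq_of_octReflect_eq h.nonneg_b h.nonneg_c h2)
  · exact nab (eq_of_octReflect_eq h.nonneg_b h.nonneg_a h2).symm
  · exact nce (eq_of_octReflect_eq h.nonneg_e h.nonneg_c h2).symm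
  · exact nac (eq_of_octReflect_eq h.nonneg_a h.nonneg_c h1)
  · exact nce (eq_of_octReflect_eq h.nonneg_e h.nonneg_c h2).symm
  · exact nae (eq_of_octReflect_eq h.nonneg_e h.nonneg_a h2).symm

/-- All edges of `K` except for the copies of the diagonal `ac` are edges of `K'`. -/
lemma IsFlip.edge (hd : 1 ≤ d) (h : IsFlip K K' a b c e) {u v : OctPoint d} (huv : K.Edge u v)
    (hnd : ¬ IsDiag a c u v) : K'.Edge u v := by
  obtain ⟨w, hw⟩ := huv
  obtain ⟨n1, n2, n3⟩ := tri_ne hw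
  rcases h.tri_cases hd hw with ⟨hS, -⟩ | ⟨g, hS | hS⟩
  · exact ⟨w, hS⟩
  · have t1 := (h.tri_new g).1
    have t2 := (h.tri_new g).2
    rcases triple_eq n1 n2 n3 hS with ⟨rfl, rfl, rfl⟩ | ⟨rfl, rfl, rfl⟩ | ⟨rfl, rfl, rfl⟩ |
          ⟨rfl, rfl, rfl⟩ | ⟨rfl, rfl, rfl⟩ | ⟨rfl, rfl, rfl⟩
    · exact absurd ⟨g, Or.inl ⟨rfl, rfl⟩⟩ hnd
    · exact ⟨_, t1⟩
    · exact absurd ⟨g, Or.inr ⟨rfl, rfl⟩⟩ hnd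
    · exact ⟨_, t2⟩
    · exact Edge.symm ⟨_, t1⟩
    · exact Edge.symm ⟨_, t2⟩
  · have t1 := tri_swap' (h.tri_new g).1
    have t2 := tri_swap' (h.tri_new g).2
    rcases triple_eq n1 n2 n3 hS with ⟨rfl, rfl, rfl⟩ | ⟨rfl, rfl, rfl⟩ | ⟨rfl, rfl, rfl⟩ |
          ⟨rfl, rfl, rfl⟩ | ⟨rfl, rfl, rfl⟩ | ⟨rfl, rfl, rfl⟩
    · exact absurd ⟨g, Or.inl ⟨rfl, rfl⟩⟩ hnd
    · exact ⟨_, t1⟩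
    · exact absurd ⟨g, Or.inr ⟨rfl, rfl⟩⟩ hnd
    · exact ⟨_, t2⟩
    · exact Edge.symm ⟨_, t1⟩
    · exact Edge.symm ⟨_, t2⟩

lemma cocycle_perm (ω : OctPoint d → OctPoint d → ZMod 2) (hsymm : ∀ u v, ω u v = ω v u)
    {u v w p q r : OctPoint d} (h1 : u ≠ v) (h2 : u ≠ w) (h3 : v ≠ w)
    (h : ({u, v, w} : Finset (OctPoint d)) = {p, q, r}) (hp : ω p q + ω q r + ω p r = 0) :
    ω u v + ω v w + ω u w = 0 := by
  have s1 := hsymm p q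
  have s2 := hsymm q r
  have s3 := hsymm p r
  rcases triple_eq h1 h2 h3 h with ⟨rfl, rfl, rfl⟩ | ⟨rfl, rfl, rfl⟩ | ⟨rfl, rfl, rfl⟩ |
      ⟨rfl, rfl, rfl⟩ | ⟨rfl, rfl, rfl⟩ | ⟨rfl, rfl, rfl⟩
  · exact hp
  · linear_combination hp - s2
  · linear_combination hp - s1
  · linear_combination hp - s1 - s3
  · linear_combination hp - s3 - s2
  · linear_combination hp - s1 - s2 - s3

/-- Exactness is preserved by flips: a cocycle of the new triangulation is transferred to the old one
by summing it along two sides of each copy of the parallelogram. -/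
lemma IsFlip.cocyclesExact (hd : 1 ≤ d) (h : IsFlip K K' a b c e) (hK : K.CocyclesExact) :
    K'.CocyclesExact := by
  classical
  intro ω' hsymm' hω'
  obtain ⟨nab, nac, nae, nbc, nbe, nce⟩ := h.quad.ne_all hd
  -- the value on the old diagonal is forced by the triangles `abc`
  set ω : OctPoint d → OctPoint d → ZMod 2 := fun u v =>
    if hD : IsDiag a c u v then
      ω' (octReflect hD.choose a) (octReflect hD.choose b)
        + ω' (octReflect hD.choose b) (octReflect hD.choose c)
    else ω' u v with hω
  have hnd : ∀ u v, ¬ IsDiag a c u v → ω u v = ω' u v := fun u v huv => dif_neg huv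
  have hdiag : ∀ g u v, (u = octReflect g a ∧ v = octReflect g c) ∨
      (u = octReflect g c ∧ v = octReflect g a) →
      ω u v = ω' (octReflect g a) (octReflect g b) + ω' (octReflect g b) (octReflect g c) := by
    intro g u v huv
    have hD : IsDiag a c u v := ⟨g, huv⟩
    have hc := hD.choose_spec
    have hg : hD.choose = g := by
      rcases huv with ⟨rfl, rfl⟩ | ⟨rfl, rfl⟩ <;> rcases hc with ⟨h1, h2⟩ | ⟨h1, h2⟩
      · exact (h.quad.reflect_inj hd h1 h2).symm
      · exact absurd (eq_of_octReflect_eq h.quad.nonneg_a h.quad.nonneg_c h1) nac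
      · exact absurd (eq_of_octReflect_eq h.quad.nonneg_c h.quad.nonneg_a h1).symm nac
      · exact (h.quad.reflect_inj hd h2 h1).symm
    simp only [hω, dif_pos hD, hg]
  have hsymm : ∀ u v, ω u v = ω v u := by
    intro u v
    by_cases hD : IsDiag a c u v
    · obtain ⟨g, hg⟩ := hD
      rw [hdiag g u v hg, hdiag g v u (by tauto)]
    · rw [hnd u v hD, hnd v u (fun h => hD h.symm), hsymm']
  have hcoc : ∀ u v w, {u, v, w} ∈ K.tris → ω u v + ω v w + ω u w = 0 := by
    intro u v w hS
    obtain ⟨n1, n2, n3⟩ := tri_ne hS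
    rcases h.tri_cases hd hS with ⟨hS', hno⟩ | ⟨g, hg | hg⟩
    · have nd : ∀ x ∈ ({u, v, w} : Finset (OctPoint d)), ∀ y ∈ ({u, v, w} : Finset (OctPoint d)),
          ω x y = ω' x y := by
        intro x hx y hy
        refine hnd x y ?_
        rintro ⟨g, ⟨rfl, rfl⟩ | ⟨rfl, rfl⟩⟩
        · exact hno g ⟨hx, hy⟩
        · exact hno g ⟨hy, hx⟩
      rw [nd u (by simp) v (by simp), nd v (by simp) w (by simp), nd u (by simp) w (by simp)]
      exact hω' u v w hS'
    · refine cocycle_perm ω hsymm n1 n2 n3 hg ?_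
      obtain ⟨s1, s2, -, -⟩ := h.quad.side_not_diag hd g
      rw [hdiag g _ _ (Or.inl ⟨rfl, rfl⟩), hnd _ _ s1, hnd _ _ s2,
        hsymm' (octReflect g c) (octReflect g b)]
      linear_combination zmod_add_self (ω' (octReflect g a) (octReflect g b))
        + zmod_add_self (ω' (octReflect g b) (octReflect g c))
    · refine cocycle_perm ω hsymm n1 n2 n3 hg ?_
      obtain ⟨-, -, s1, s2⟩ := h.quad.side_not_diag hd g
      rw [hdiag g _ _ (Or.inl ⟨rfl, rfl⟩), hnd _ _ s1, hnd _ _ s2]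
      have t1 := hω' _ _ _ (h.tri_new g).1
      have t2 := hω' _ _ _ (h.tri_new g).2
      rw [hsymm' (octReflect g c) (octReflect g b)] at t2
      linear_combination t1 + t2 - zmod_add_self (ω' (octReflect g b) (octReflect g e))
  obtain ⟨f, hf⟩ := hK ω hsymm hcoc
  have old : ∀ u v, K.Edge u v → ¬ IsDiag a c u v → ω' u v = f u + f v := by
    intro u v huv hn
    rw [← hnd u v hn, hf u v huv]
  refine ⟨f, fun u v huv => ?_⟩
  by_cases hD : IsDiag b e u v
  · have key : ∀ g, ω' (octReflect g b) (octReflect g e)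
        = f (octReflect g b) + f (octReflect g e) := by
      intro g
      obtain ⟨s1, -, s2, -⟩ := h.quad.side_not_diag hd g
      have e1 := old _ _ (Edge.reflect g ⟨_, h.quad.tri_abc⟩) s1
      have e2 := old _ _ (Edge.reflect g ⟨_, tri_swap' h.quad.tri_ace⟩) s2
      have t1 := hω' _ _ _ (h.tri_new g).1
      rw [e1, e2] at t1
      have hw := zmod_add_self (f (octReflect g a))
      have hw1 := zmod_add_self (f (octReflect g b))
      have hw2 := zmod_add_self (f (octReflect g e))
      linear_combination t1 - hw - hw1 - hw2
    obtain ⟨g, ⟨rfl, rfl⟩ | ⟨rfl, rfl⟩⟩ := hD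
    · exact key g
    · rw [hsymm', key g, add_comm]
  · have hsym := h.symm hd
    have he := hsym.edge hd huv hD
    refine old u v he ?_
    rintro ⟨g, hg⟩
    obtain ⟨w, hw⟩ := huv
    have hno := h.quad'.no_cross hd hw g
    rcases hg with ⟨rfl, rfl⟩ | ⟨rfl, rfl⟩
    · exact hno ⟨by simp, by simp⟩
    · exact hno ⟨by simp, by simp⟩

lemma IsFlip.edgeConnected (hd : 1 ≤ d) (h : IsFlip K K' a b c e) (hK : K.EdgeConnected) :
    K'.EdgeConnected := by
  intro f hf
  refine hK f fun u v huv => ?_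
  by_cases hD : IsDiag a c u v
  · have key : ∀ g, f (octReflect g a) = f (octReflect g c) := by
      intro g
      rw [hf _ _ ⟨_, (h.tri_new g).1⟩, hf _ _ ⟨_, (h.tri_new g).2⟩]
    obtain ⟨g, ⟨rfl, rfl⟩ | ⟨rfl, rfl⟩⟩ := hD
    · exact key g
    · exact (key g).symm
  · exact hf u v (h.edge hd huv hD)

end OctTriangulation

/-! ### The triangulation of the plane triangle -/

/-- The lattice point of the positive octant over a point of `A`. -/
def octLift (p : latticeTriangle d) : OctPoint d :=
  ⟨![p.1.1, p.1.2, d - p.1.1 - p.1.2], by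
    obtain ⟨⟨x, y⟩, hx, hy, hxy⟩ := p
    simp only at hx hy hxy
    rw [Fin.sum_univ_three]
    simp only [Matrix.cons_val]
    rw [abs_of_nonneg hx, abs_of_nonneg hy, abs_of_nonneg (by omega : (0 : ℤ) ≤ d - x - y)]
    ring⟩

lemma octLift_nonneg (p : latticeTriangle d) (i : Fin 3) : 0 ≤ (octLift p).1 i := by
  obtain ⟨⟨x, y⟩, hx, hy, hxy⟩ := p
  simp only at hx hy hxy
  fin_cases i
  · exact hx
  · exact hy
  · simp only [octLift, Fin.reduceFinMk, Matrix.cons_val]; omega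

lemma octLift_injective : Function.Injective (octLift (d := d)) := by
  intro p q h
  have h0 := congrFun (congrArg Subtype.val h) 0
  have h1 := congrFun (congrArg Subtype.val h) 1
  exact Subtype.ext (Prod.ext h0 h1)

lemma exists_octLift {u : OctPoint d} (h : ∀ i, 0 ≤ u.1 i) : ∃ p, u = octLift p := by
  have hs := sum_of_nonneg h
  refine ⟨⟨(u.1 0, u.1 1), h 0, h 1, by have := h 2; simp only; omega⟩, ?_⟩
  apply Subtype.ext
  funext i
  fin_cases i
  · rfl
  · rfl
  · simp only [octLift, Fin.reduceFinMk, Matrix.cons_val]; omega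

/-- The projection of a lattice point of the octahedron to the plane. -/
def planePoint (u : OctPoint d) : ℝ × ℝ := (u.1 0, u.1 1)

lemma planePoint_injOn {u v : OctPoint d} (hu : ∀ i, 0 ≤ u.1 i) (hv : ∀ i, 0 ≤ v.1 i)
    (h : planePoint u = planePoint v) : u = v := by
  have h0 : u.1 0 = v.1 0 := Int.cast_injective (congrArg Prod.fst h)
  have h1 : u.1 1 = v.1 1 := Int.cast_injective (congrArg Prod.snd h)
  have hu' := sum_of_nonneg hu
  have hv' := sum_of_nonneg hv
  by_contra hne
  rcases exists_coord_ne hne with h | h | h <;> omega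

/-- The point of the plane of the positive face of the octahedron over a point of the plane. -/
def liftPoint (d : ℕ) (x : ℝ × ℝ) : Fin 3 → ℝ := ![x.1, x.2, d - x.1 - x.2]

lemma liftPoint_planePoint {u : OctPoint d} (hu : ∀ i, 0 ≤ u.1 i) :
    liftPoint d (planePoint u) = toSpace u := by
  have h := sum_of_nonneg hu
  have h' : ((u.1 0 + u.1 1 + u.1 2 : ℤ) : ℝ) = (d : ℤ) := by rw [h]
  push_cast at h'
  funext i
  fin_cases i
  · rfl
  · rfl
  · simp only [liftPoint, planePoint, Fin.reduceFinMk, Matrix.cons_val, toSpace_apply]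
    linarith

lemma liftPoint_comb (x y z : ℝ × ℝ) {a b c : ℝ} (h : a + b + c = 1) :
    liftPoint d (a • x + b • y + c • z)
      = a • liftPoint d x + b • liftPoint d y + c • liftPoint d z := by
  funext i
  fin_cases i
  · simp [liftPoint]
  · simp [liftPoint]
  · simp only [liftPoint, Prod.fst_add, Prod.smul_fst, smul_eq_mul, Prod.snd_add, Prod.smul_snd,
      Fin.reduceFinMk, Matrix.cons_val, Pi.add_apply, Pi.smul_apply]
    linear_combination (-(d : ℝ)) * h

namespace OctTriangulation

variable {K : OctTriangulation d}

/-- The nonempty subsets of the projections of the triangles in the positive octant. -/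
def planeFaces (K : OctTriangulation d) : Set (Finset (ℝ × ℝ)) :=
  {s | s.Nonempty ∧ ∃ u v w, {u, v, w} ∈ K.tris ∧ ((∀ i, 0 ≤ u.1 i) ∧ (∀ i, 0 ≤ v.1 i) ∧
    ∀ i, 0 ≤ w.1 i) ∧ s ⊆ {planePoint u, planePoint v, planePoint w}}

lemma planePoint_ne {u v : OctPoint d} (hu : ∀ i, 0 ≤ u.1 i) (hv : ∀ i, 0 ≤ v.1 i)
    (h : u ≠ v) : planePoint u ≠ planePoint v := fun h' => h (planePoint_injOn hu hv h')

/-- On a face, a point is the combination of the vertices with the barycentric coordinates as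
coefficients, and only the vertices of the face contribute. -/
lemma planeFaces_coords {u v w : OctPoint d} (h : {u, v, w} ∈ K.tris) (hu : ∀ i, 0 ≤ u.1 i)
    (hv : ∀ i, 0 ≤ v.1 i) (hw : ∀ i, 0 ≤ w.1 i) {s : Finset (ℝ × ℝ)}
    (hs : s ⊆ {planePoint u, planePoint v, planePoint w}) {x : ℝ × ℝ}
    (hx : x ∈ convexHull ℝ (s : Set (ℝ × ℝ))) :
    (∀ t, 0 ≤ K.hat (liftPoint d x) t) ∧
    (∀ t, K.hat (liftPoint d x) t ≠ 0 → (∀ i, 0 ≤ t.1 i) ∧ planePoint t ∈ s ∧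
      t ∈ ({u, v, w} : Finset (OctPoint d))) ∧
    ∑ t ∈ ({u, v, w} : Finset (OctPoint d)), K.hat (liftPoint d x) t = 1 ∧
    ∑ t ∈ ({u, v, w} : Finset (OctPoint d)), K.hat (liftPoint d x) t • planePoint t = x := by
  classical
  obtain ⟨n1, n2, n3⟩ := tri_ne h
  have m1 := planePoint_ne hu hv n1
  have m2 := planePoint_ne hu hw n2
  have m3 := planePoint_ne hv hw n3
  rw [Finset.mem_convexHull'] at hx
  obtain ⟨f, hf0, hf1, hfx⟩ := hx
  -- the coefficients, extended by zero to all corners of the triangle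
  set F : ℝ × ℝ → ℝ := fun y => if y ∈ s then f y else 0 with hF
  have hF0 : ∀ y, 0 ≤ F y := by
    intro y
    simp only [hF]
    split_ifs with hy
    · exact hf0 y hy
    · exact le_rfl
  have e1 : ∑ y ∈ ({planePoint u, planePoint v, planePoint w} : Finset (ℝ × ℝ)), F y = 1 := by
    rw [← hf1, ← Finset.sum_subset hs]
    · exact Finset.sum_congr rfl fun y hy => if_pos hy
    · intro y _ hy; exact if_neg hy
  have e2 : ∑ y ∈ ({planePoint u, planePoint v, planePoint w} : Finset (ℝ × ℝ)), F y • y = x := by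
    rw [← hfx, ← Finset.sum_subset hs]
    · exact Finset.sum_congr rfl fun y hy => by simp only [hF, if_pos hy]
    · intro y _ hy; simp only [hF, if_neg hy, zero_smul]
  rw [Finset.sum_insert (by simp [m1, m2]), Finset.sum_insert (by simp [m3]),
    Finset.sum_singleton, ← add_assoc] at e1 e2
  have hlift : liftPoint d x = F (planePoint u) • toSpace u + F (planePoint v) • toSpace v
      + F (planePoint w) • toSpace w := by
    rw [← e2, liftPoint_comb _ _ _ e1, liftPoint_planePoint hu, liftPoint_planePoint hv,
      liftPoint_planePoint hw]
  obtain ⟨k1, k2, k3, k4⟩ := hat_three h (hF0 _) (hF0 _) (hF0 _) e1 hlift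
  refine ⟨fun t => ?_, fun t ht => ?_, ?_, ?_⟩
  · by_cases t1 : t = u
    · rw [t1, k1]; exact hF0 _
    by_cases t2 : t = v
    · rw [t2, k2]; exact hF0 _
    by_cases t3 : t = w
    · rw [t3, k3]; exact hF0 _
    rw [k4 t t1 t2 t3]
  · have hmem : ∀ y, F y ≠ 0 → y ∈ s := fun y hy => by
      by_contra hc; exact hy (if_neg hc)
    by_cases t1 : t = u
    · subst t1; exact ⟨hu, hmem _ (k1 ▸ ht), by simp⟩
    by_cases t2 : t = v
    · subst t2; exact ⟨hv, hmem _ (k2 ▸ ht), by simp⟩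
    by_cases t3 : t = w
    · subst t3; exact ⟨hw, hmem _ (k3 ▸ ht), by simp⟩
    exact absurd (k4 t t1 t2 t3) ht
  · rw [Finset.sum_insert (by simp [n1, n2]), Finset.sum_insert (by simp [n3]),
      Finset.sum_singleton, k1, k2, k3, ← add_assoc, e1]
  · rw [Finset.sum_insert (by simp [n1, n2]), Finset.sum_insert (by simp [n3]),
      Finset.sum_singleton, k1, k2, k3, ← add_assoc, e2]

lemma orient_eq_of_nonneg {u v w : OctPoint d} (hu : ∀ i, 0 ≤ u.1 i) (hv : ∀ i, 0 ≤ v.1 i)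
    (hw : ∀ i, 0 ≤ w.1 i) : orient u v w
      = d * ((v.1 0 - u.1 0) * (w.1 1 - u.1 1) - (w.1 0 - u.1 0) * (v.1 1 - u.1 1)) := by
  have h1 : u.1 2 = d - u.1 0 - u.1 1 := by linarith [sum_of_nonneg hu]
  have h2 : v.1 2 = d - v.1 0 - v.1 1 := by linarith [sum_of_nonneg hv]
  have h3 : w.1 2 = d - w.1 0 - w.1 1 := by linarith [sum_of_nonneg hw]
  rw [orient, h1, h2, h3]
  ring

lemma abs_planeDet (hd : 1 ≤ d) {u v w : OctPoint d} (h : {u, v, w} ∈ K.tris)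
    (hu : ∀ i, 0 ≤ u.1 i) (hv : ∀ i, 0 ≤ v.1 i) (hw : ∀ i, 0 ≤ w.1 i) :
    |(v.1 0 - u.1 0) * (w.1 1 - u.1 1) - (w.1 0 - u.1 0) * (v.1 1 - u.1 1)| = 1 := by
  have h1 := K.unimodular _ _ _ h
  rw [orient_eq_of_nonneg hu hv hw, abs_mul, Nat.abs_cast] at h1
  have hd' : (d : ℤ) ≠ 0 := by omega
  exact mul_left_cancel₀ hd' (h1.trans (mul_one _).symm)

lemma planePoint_affineIndependent (hd : 1 ≤ d) {u v w : OctPoint d} (h : {u, v, w} ∈ K.tris)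
    (hu : ∀ i, 0 ≤ u.1 i) (hv : ∀ i, 0 ≤ v.1 i) (hw : ∀ i, 0 ≤ w.1 i) :
    AffineIndependent ℝ ![planePoint u, planePoint v, planePoint w] := by
  classical
  have hdet := abs_planeDet hd h hu hv hw
  set D : ℤ := (v.1 0 - u.1 0) * (w.1 1 - u.1 1) - (w.1 0 - u.1 0) * (v.1 1 - u.1 1) with hD
  have hD0 : (D : ℝ) ≠ 0 := by
    have : D ≠ 0 := by rintro h0; rw [h0] at hdet; simp at hdet
    exact_mod_cast this
  have hDR : (D : ℝ) = ((v.1 0 : ℝ) - u.1 0) * (w.1 1 - u.1 1)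
      - (w.1 0 - u.1 0) * (v.1 1 - u.1 1) := by rw [hD]; push_cast; ring
  rw [affineIndependent_iff]
  intro s f h0 h1
  set F : Fin 3 → ℝ := fun i => if i ∈ s then f i else 0 with hF
  have e0 : ∑ i, F i = 0 := by
    rw [← h0, ← Finset.sum_subset (Finset.subset_univ s)]
    · exact Finset.sum_congr rfl fun y hy => if_pos hy
    · intro y _ hy; exact if_neg hy
  have e1 : ∑ i, F i • ![planePoint u, planePoint v, planePoint w] i = 0 := by
    rw [← h1, ← Finset.sum_subset (Finset.subset_univ s)]
    · exact Finset.sum_congr rfl fun y hy => by simp only [hF, if_pos hy]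
    · intro y _ hy; simp only [hF, if_neg hy, zero_smul]
  rw [Fin.sum_univ_three] at e0 e1
  have ex := congrArg Prod.fst e1
  have ey := congrArg Prod.snd e1
  simp only [planePoint, Matrix.cons_val, Prod.smul_mk, smul_eq_mul, Prod.mk_add_mk,
    Prod.fst_zero, Prod.snd_zero] at ex ey
  have z : ∀ i, F i = 0 := by
    intro i
    refine (mul_eq_zero.1 ?_).resolve_left hD0
    rw [hDR]
    fin_cases i
    · simp only [Fin.zero_eta]
      linear_combination ((v.1 0 : ℝ) * w.1 1 - w.1 0 * v.1 1) * e0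
        + ((v.1 1 : ℝ) - w.1 1) * ex + ((w.1 0 : ℝ) - v.1 0) * ey
    · simp only [Fin.mk_one]
      linear_combination ((w.1 0 : ℝ) * u.1 1 - u.1 0 * w.1 1) * e0
        + ((w.1 1 : ℝ) - u.1 1) * ex + ((u.1 0 : ℝ) - w.1 0) * ey
    · simp only [Fin.reduceFinMk]
      linear_combination ((u.1 0 : ℝ) * v.1 1 - v.1 0 * u.1 1) * e0
        + ((u.1 1 : ℝ) - v.1 1) * ex + ((v.1 0 : ℝ) - u.1 0) * ey
  intro i hi
  have := z i
  simpa only [hF, if_pos hi] using this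

/-- The simplicial complex in the plane formed by the triangles in the positive octant. -/
def planeComplex (K : OctTriangulation d) (hd : 1 ≤ d) : Geometry.SimplicialComplex ℝ (ℝ × ℝ) where
  faces := K.planeFaces
  isRelLowerSet_faces := by
    rintro s ⟨hs, u, v, w, h, hn, hsub⟩
    exact ⟨hs, fun t hts ht => ⟨ht, u, v, w, h, hn, hts.trans hsub⟩⟩
  indep := by
    rintro s ⟨-, u, v, w, h, ⟨hu, hv, hw⟩, hsub⟩
    refine (planePoint_affineIndependent hd h hu hv hw).range.mono ?_
    intro y hy
    have := hsub hy
    simp only [Finset.mem_insert, Finset.mem_singleton] at this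
    rcases this with rfl | rfl | rfl
    exacts [⟨0, rfl⟩, ⟨1, rfl⟩, ⟨2, rfl⟩]
  inter_subset_convexHull := by
    rintro s t ⟨-, u, v, w, h, ⟨hu, hv, hw⟩, hsub⟩ ⟨-, u', v', w', h', ⟨hu', hv', hw'⟩, hsub'⟩
      x ⟨hxs, hxt⟩
    obtain ⟨p0, pmem, psum, px⟩ := planeFaces_coords h hu hv hw hsub hxs
    obtain ⟨-, qmem, -, -⟩ := planeFaces_coords h' hu' hv' hw' hsub' hxt
    rw [← px, ← Finset.sum_filter_of_ne (p := fun y => K.hat (liftPoint d x) y ≠ 0)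
      fun y _ hy h0 => hy (by rw [h0, zero_smul])]
    refine (convex_convexHull ℝ _).sum_mem (fun y _ => p0 y) ?_ fun y hy => ?_
    · rw [Finset.sum_filter_ne_zero, psum]
    · rw [Finset.mem_filter] at hy
      exact subset_convexHull ℝ _ ⟨(pmem y hy.2).2.1, (qmem y hy.2).2.1⟩

lemma tri_nonneg_of_nonneg {u v w : OctPoint d} (h : {u, v, w} ∈ K.tris) (hu : ∀ i, 0 ≤ u.1 i)
    (hv : ∀ i, 0 ≤ v.1 i) : ∃ w', {u, v, w'} ∈ K.tris ∧ ∀ i, 0 ≤ w'.1 i := by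
  obtain ⟨g, hg⟩ := exists_reflect_nonneg (K.sameOctant _ h)
  have h1 : octReflect g u = u := eq_of_octReflect_eq (g := 1) (h := g) (u := octReflect g u)
    (v := u) (hg u (by simp)) hu (by ext; simp)
  have h2 : octReflect g v = v := eq_of_octReflect_eq (g := 1) (h := g) (u := octReflect g v)
    (v := v) (hg v (by simp)) hv (by ext; simp)
  refine ⟨octReflect g w, ?_, hg w (by simp)⟩
  have := tri_reflect g h
  rwa [h1, h2] at this

lemma triangle_mem_planeFaces {u v w : OctPoint d} (hu : ∀ i, 0 ≤ u.1 i) (hv : ∀ i, 0 ≤ v.1 i)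
    (hw : ∀ i, 0 ≤ w.1 i) (n1 : u ≠ v) (n2 : u ≠ w) (n3 : v ≠ w) :
    {planePoint u, planePoint v, planePoint w} ∈ K.planeFaces ↔ {u, v, w} ∈ K.tris := by
  constructor
  · rintro ⟨-, u', v', w', h, ⟨hu', hv', hw'⟩, hsub⟩
    have hmem : ∀ y : OctPoint d, (∀ i, 0 ≤ y.1 i) →
        planePoint y ∈ ({planePoint u, planePoint v, planePoint w} : Finset (ℝ × ℝ)) →
        y ∈ ({u', v', w'} : Finset (OctPoint d)) := by
      intro y hy hy'
      have := hsub hy'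
      simp only [Finset.mem_insert, Finset.mem_singleton] at this ⊢
      exact this.imp (planePoint_injOn hy hu') (Or.imp (planePoint_injOn hy hv')
        (planePoint_injOn hy hw'))
    have hs : ({u, v, w} : Finset (OctPoint d)) ⊆ {u', v', w'} := by
      intro y hy
      simp only [Finset.mem_insert, Finset.mem_singleton] at hy
      rcases hy with rfl | rfl | rfl
      exacts [hmem _ hu (by simp), hmem _ hv (by simp), hmem _ hw (by simp)]
    have hc : ({u', v', w'} : Finset (OctPoint d)).card ≤ ({u, v, w} : Finset (OctPoint d)).card := by
      rw [K.card_eq _ h, Finset.card_eq_three.2 ⟨u, v, w, n1, n2, n3, rfl⟩]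
    rw [Finset.eq_of_subset_of_card_le hs hc]
    exact h
  · intro h
    exact ⟨by simp, u, v, w, h, ⟨hu, hv, hw⟩, subset_rfl⟩

lemma edge_mem_planeFaces {u v : OctPoint d} (hu : ∀ i, 0 ≤ u.1 i) (hv : ∀ i, 0 ≤ v.1 i)
    (hne : u ≠ v) : {planePoint u, planePoint v} ∈ K.planeFaces ↔ K.Edge u v := by
  constructor
  · rintro ⟨-, u', v', w', h, ⟨hu', hv', hw'⟩, hsub⟩
    have hmem : ∀ y : OctPoint d, (∀ i, 0 ≤ y.1 i) →
        planePoint y ∈ ({planePoint u, planePoint v} : Finset (ℝ × ℝ)) →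
        y ∈ ({u', v', w'} : Finset (OctPoint d)) := by
      intro y hy hy'
      have := hsub hy'
      simp only [Finset.mem_insert, Finset.mem_singleton] at this ⊢
      exact this.imp (planePoint_injOn hy hu') (Or.imp (planePoint_injOn hy hv')
        (planePoint_injOn hy hw'))
    obtain ⟨w, hw⟩ := tri_of_mem h (hmem u hu (by simp)) (hmem v hv (by simp)) hne
    exact ⟨w, hw ▸ h⟩
  · rintro ⟨w, h⟩
    obtain ⟨w', h', hw'⟩ := tri_nonneg_of_nonneg h hu hv
    exact ⟨by simp, u, v, w', h', ⟨hu, hv, hw'⟩, by intro y; simp; tauto⟩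

lemma isTriangle_planeComplex (hd : 1 ≤ d) {p q r : latticeTriangle d} :
    IsTriangle (K.planeComplex hd) p q r ↔ {octLift p, octLift q, octLift r} ∈ K.tris := by
  constructor
  · rintro ⟨n1, n2, n3, h⟩
    exact (triangle_mem_planeFaces (octLift_nonneg p) (octLift_nonneg q) (octLift_nonneg r)
      (octLift_injective.ne n1) (octLift_injective.ne n2) (octLift_injective.ne n3)).1 h
  · intro h
    obtain ⟨n1, n2, n3⟩ := tri_ne h
    exact ⟨fun h => n1 (h ▸ rfl), fun h => n2 (h ▸ rfl), fun h => n3 (h ▸ rfl),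
      (triangle_mem_planeFaces (octLift_nonneg p) (octLift_nonneg q) (octLift_nonneg r) n1 n2 n3).2
        h⟩

lemma isEdge_planeComplex (hd : 1 ≤ d) {p q : latticeTriangle d} :
    IsEdge (K.planeComplex hd) p q ↔ K.Edge (octLift p) (octLift q) := by
  constructor
  · rintro ⟨n, h⟩
    exact (edge_mem_planeFaces (octLift_nonneg p) (octLift_nonneg q) (octLift_injective.ne n)).1 h
  · intro h
    exact ⟨fun h' => h.ne (h' ▸ rfl),
      (edge_mem_planeFaces (octLift_nonneg p) (octLift_nonneg q) h.ne).2 h⟩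

lemma convexHull_bigTriangle (hd : 1 ≤ d) :
    convexHull ℝ {((0 : ℝ), (0 : ℝ)), ((d : ℝ), (0 : ℝ)), ((0 : ℝ), (d : ℝ))}
      = {x : ℝ × ℝ | 0 ≤ x.1 ∧ 0 ≤ x.2 ∧ x.1 + x.2 ≤ d} := by
  have hd' : (0 : ℝ) < d := by exact_mod_cast hd
  apply Set.Subset.antisymm
  · refine convexHull_min ?_ ?_
    · rintro x (rfl | rfl | rfl) <;> simp
    · rintro x ⟨x1, x2, x3⟩ y ⟨y1, y2, y3⟩ a b ha hb hab
      refine ⟨?_, ?_, ?_⟩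
      · simp only [Prod.fst_add, Prod.smul_fst, smul_eq_mul]; positivity
      · simp only [Prod.snd_add, Prod.smul_snd, smul_eq_mul]; positivity
      · simp only [Prod.fst_add, Prod.smul_fst, smul_eq_mul, Prod.snd_add, Prod.smul_snd]
        nlinarith
  · rintro x ⟨h1, h2, h3⟩
    have hc := convex_convexHull ℝ
      ({((0 : ℝ), (0 : ℝ)), ((d : ℝ), (0 : ℝ)), ((0 : ℝ), (d : ℝ))} : Set (ℝ × ℝ))
    have hs := subset_convexHull ℝ
      ({((0 : ℝ), (0 : ℝ)), ((d : ℝ), (0 : ℝ)), ((0 : ℝ), (d : ℝ))} : Set (ℝ × ℝ))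
    have := hc.sum_mem (t := Finset.univ) (w := ![(d - x.1 - x.2) / d, x.1 / d, x.2 / d])
      (z := ![((0 : ℝ), (0 : ℝ)), ((d : ℝ), (0 : ℝ)), ((0 : ℝ), (d : ℝ))]) ?_ ?_ ?_
    · rw [Fin.sum_univ_three] at this
      convert this using 1
      ext
      · simp; field_simp
      · simp; field_simp
    · intro i _
      fin_cases i
      · exact div_nonneg (by linarith) hd'.le
      · exact div_nonneg h1 hd'.le
      · exact div_nonneg h2 hd'.le
    · rw [Fin.sum_univ_three]; simp; field_simp; ring
    · intro i _
      fin_cases i <;> exact hs (by simp)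

lemma planePoint_mem {u : OctPoint d} (hu : ∀ i, 0 ≤ u.1 i) :
    planePoint u ∈ {x : ℝ × ℝ | 0 ≤ x.1 ∧ 0 ≤ x.2 ∧ x.1 + x.2 ≤ d} := by
  have h := sum_of_nonneg hu
  have h' : ((u.1 0 + u.1 1 + u.1 2 : ℤ) : ℝ) = (d : ℤ) := by rw [h]
  have h0 : (0 : ℝ) ≤ u.1 0 := by exact_mod_cast hu 0
  have h1 : (0 : ℝ) ≤ u.1 1 := by exact_mod_cast hu 1
  have h2 : (0 : ℝ) ≤ u.1 2 := by exact_mod_cast hu 2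
  push_cast at h'
  exact ⟨h0, h1, by simp only [planePoint]; linarith⟩

/-- Every point of the positive octant lies in a triangle of the positive octant. -/
lemma cover_nonneg {x : Fin 3 → ℝ} (hx : x ∈ octahedron d) (h0 : ∀ i, 0 ≤ x i) :
    ∃ u v w, {u, v, w} ∈ K.tris ∧ ((∀ i, 0 ≤ u.1 i) ∧ (∀ i, 0 ≤ v.1 i) ∧ ∀ i, 0 ≤ w.1 i) ∧
      ∃ a b c : ℝ, 0 ≤ a ∧ 0 ≤ b ∧ 0 ≤ c ∧
        a + b + c = 1 ∧ x = a • toSpace u + b • toSpace v + c • toSpace w := by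
  obtain ⟨u, v, w, h, a, b, c, ha, hb, hc, hs, rfl⟩ := K.cover x hx
  obtain ⟨g, hg⟩ := exists_reflect_nonneg (K.sameOctant _ h)
  have hu := hg u (by simp)
  have hv := hg v (by simp)
  have hw := hg w (by simp)
  refine ⟨_, _, _, tri_reflect g h, ⟨hu, hv, hw⟩, a, b, c, ha, hb, hc, hs, ?_⟩
  rw [← octReflect_comb]
  funext i
  have e : spaceReflect g (a • toSpace u + b • toSpace v + c • toSpace w) i
      = ((g i : ℤ) : ℝ) * (a • toSpace u + b • toSpace v + c • toSpace w) i := rfl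
  have nn : 0 ≤ spaceReflect g (a • toSpace u + b • toSpace v + c • toSpace w) i := by
    rw [octReflect_comb]
    have hu' : (0 : ℝ) ≤ ((octReflect g u).1 i : ℤ) := by exact_mod_cast hu i
    have hv' : (0 : ℝ) ≤ ((octReflect g v).1 i : ℤ) := by exact_mod_cast hv i
    have hw' : (0 : ℝ) ≤ ((octReflect g w).1 i : ℤ) := by exact_mod_cast hw i
    simp only [Pi.add_apply, Pi.smul_apply, smul_eq_mul, toSpace_apply]
    positivity
  have h0i := h0 i
  rcases Int.units_eq_one_or (g i) with hgi | hgi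
  · rw [e, hgi]; simp
  · rw [e, hgi] at nn ⊢
    simp only [Units.val_neg, Units.val_one, Int.cast_neg, Int.cast_one, neg_mul, one_mul] at nn ⊢
    linarith

lemma isUnimodularTriangulation_planeComplex (hd : 1 ≤ d) :
    IsUnimodularTriangulation d (K.planeComplex hd) where
  space_eq := by
    rw [convexHull_bigTriangle hd]
    apply Set.Subset.antisymm
    · intro x hx
      rw [Geometry.SimplicialComplex.mem_space_iff] at hx
      obtain ⟨s, ⟨-, u, v, w, h, ⟨hu, hv, hw⟩, hsub⟩, hx⟩ := hx
      rw [← convexHull_bigTriangle hd]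
      refine convexHull_min ?_ (convex_convexHull ℝ _) hx
      rw [convexHull_bigTriangle hd]
      intro y hy
      have := hsub hy
      simp only [Finset.mem_insert, Finset.mem_singleton] at this
      rcases this with rfl | rfl | rfl
      exacts [planePoint_mem hu, planePoint_mem hv, planePoint_mem hw]
    -- lift the point to the positive face of the octahedron, and project the triangle there
    · rintro x ⟨h1, h2, h3⟩
      have hx0 : ∀ i, 0 ≤ liftPoint d x i := by
        intro i
        fin_cases i
        · exact h1
        · exact h2
        · simp only [liftPoint, Fin.reduceFinMk, Matrix.cons_val]; linarith
      have hx : liftPoint d x ∈ octahedron d := by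
        have : ∑ i, |liftPoint d x i| = ∑ i, liftPoint d x i :=
          Finset.sum_congr rfl fun i _ => abs_of_nonneg (hx0 i)
        simp only [octahedron, Set.mem_ofPred_eq, this]
        rw [Fin.sum_univ_three]
        simp [liftPoint]
      obtain ⟨u, v, w, h, ⟨hu, hv, hw⟩, a, b, c, ha, hb, hc, hs, hxe⟩ := cover_nonneg (K := K) hx hx0
      rw [Geometry.SimplicialComplex.mem_space_iff]
      refine ⟨{planePoint u, planePoint v, planePoint w},
        ⟨by simp, u, v, w, h, ⟨hu, hv, hw⟩, subset_rfl⟩, ?_⟩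
      have hxe' : x = a • planePoint u + b • planePoint v + c • planePoint w := by
        have e0 := congrFun hxe 0
        have e1 := congrFun hxe 1
        ext
        · simpa [liftPoint, planePoint] using e0
        · simpa [liftPoint, planePoint] using e1
      have hsub := subset_convexHull ℝ
        (({planePoint u, planePoint v, planePoint w} : Finset (ℝ × ℝ)) : Set (ℝ × ℝ))
      have := (convex_convexHull ℝ (({planePoint u, planePoint v, planePoint w} :
        Finset (ℝ × ℝ)) : Set (ℝ × ℝ))).sum_mem (t := Finset.univ) (w := ![a, b, c])
        (z := ![planePoint u, planePoint v, planePoint w]) ?_ ?_ ?_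
      · rw [Fin.sum_univ_three] at this
        rw [hxe']
        exact this
      · intro i _
        fin_cases i
        exacts [ha, hb, hc]
      · rw [Fin.sum_univ_three]; exact hs
      · intro i _
        fin_cases i <;> exact hsub (by simp)
  vertices_subset := by
    rintro y ⟨-, u, v, w, -, ⟨hu, hv, hw⟩, hsub⟩
    have := hsub (Finset.mem_singleton_self y)
    simp only [Finset.mem_insert, Finset.mem_singleton] at this
    have key : ∀ u : OctPoint d, (∀ i, 0 ≤ u.1 i) →
        planePoint u ∈ toPlane '' latticeTriangle d := by
      intro u hu
      obtain ⟨p, rfl⟩ := exists_octLift hu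
      exact ⟨p, p.2, rfl⟩
    rcases this with rfl | rfl | rfl
    exacts [key u hu, key v hv, key w hw]
  area_eq := by
    rintro p q r n1 n2 n3 hpqr
    have key : ∀ y ∈ ({p, q, r} : Finset (ℝ × ℝ)),
        ∃ u : OctPoint d, (∀ i, 0 ≤ u.1 i) ∧ y = planePoint u := by
      obtain ⟨-, u, v, w, -, ⟨hu, hv, hw⟩, hsub⟩ := hpqr
      intro y hy
      have := hsub hy
      simp only [Finset.mem_insert, Finset.mem_singleton] at this
      rcases this with rfl | rfl | rfl
      exacts [⟨u, hu, rfl⟩, ⟨v, hv, rfl⟩, ⟨w, hw, rfl⟩]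
    obtain ⟨u, hu, rfl⟩ := key p (by simp)
    obtain ⟨v, hv, rfl⟩ := key q (by simp)
    obtain ⟨w, hw, rfl⟩ := key r (by simp)
    have h := (triangle_mem_planeFaces hu hv hw (fun h => n1 (h ▸ rfl)) (fun h => n2 (h ▸ rfl))
      (fun h => n3 (h ▸ rfl))).1 hpqr
    have hdet := abs_planeDet hd h hu hv hw
    have hdet' : |((((v.1 0 - u.1 0) * (w.1 1 - u.1 1) - (w.1 0 - u.1 0) * (v.1 1 - u.1 1) : ℤ)) : ℝ)|
        = 1 := by
      rw [← Int.cast_abs, hdet, Int.cast_one]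
    push_cast at hdet'
    rw [triangleArea]
    simp only [planePoint]
    rw [hdet']

end OctTriangulation

/-! ### The double cover of the projective plane -/

instance : InvolutiveNeg (octahedron d) where
  neg x := ⟨-x.1, neg_mem_octahedron x.2⟩
  neg_neg x := Subtype.ext (neg_neg x.1)

@[simp] lemma octahedron_neg_coe (x : octahedron d) : (-x).1 = -x.1 := rfl

lemma octahedron_continuous_neg : Continuous fun x : octahedron d => -x :=
  Continuous.subtype_mk (continuous_subtype_val.neg) _

lemma abs_add_le_of_mem (x : octahedron d) : |x.1 0| + |x.1 1| + |x.1 2| = d := by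
  have := x.2
  simp only [octahedron, Set.mem_ofPred_eq, Fin.sum_univ_three] at this
  exact this

lemma continuous_coord (i : Fin 3) : Continuous fun x : octahedron d => x.1 i :=
  (continuous_apply i).comp continuous_subtype_val

/-- The projection of the octahedral sphere to the diamond. -/
def toDiamond (x : octahedron d) : diamond d :=
  ⟨(x.1 0, x.1 1), by
    have := abs_add_le_of_mem x
    have h := abs_nonneg (x.1 2)
    simp only [diamond, Set.mem_ofPred_eq]
    linarith⟩

lemma toDiamond_continuous : Continuous (toDiamond (d := d)) := by
  exact Continuous.subtype_mk ((continuous_coord 0).prodMk (continuous_coord 1)) _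

/-- The upper hemisphere as the graph of a function on the diamond. -/
def ofDiamond (x : diamond d) : octahedron d :=
  ⟨![x.1.1, x.1.2, d - |x.1.1| - |x.1.2|], by
    have h : |x.1.1| + |x.1.2| ≤ d := x.2
    simp only [octahedron, Set.mem_ofPred_eq, Fin.sum_univ_three, Matrix.cons_val]
    rw [abs_of_nonneg (by linarith : (0 : ℝ) ≤ d - |x.1.1| - |x.1.2|)]
    ring⟩

lemma ofDiamond_continuous : Continuous (ofDiamond (d := d)) := by
  refine Continuous.subtype_mk ?_ _
  refine continuous_pi fun i => ?_
  fin_cases i <;> simp <;> fun_prop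

lemma ofDiamond_toDiamond {x : octahedron d} (h : 0 ≤ x.1 2) : ofDiamond (toDiamond x) = x := by
  have := abs_add_le_of_mem x
  rw [abs_of_nonneg h] at this
  apply Subtype.ext
  funext i
  fin_cases i
  · rfl
  · rfl
  · simp only [ofDiamond, toDiamond, Fin.reduceFinMk, Matrix.cons_val]
    linarith

/-- The double cover of the projective plane by the octahedral sphere: the upper hemisphere is
projected to the diamond, the lower hemisphere after the antipodal map. -/
def coverMap (x : octahedron d) : ProjPlane d :=
  if 0 ≤ x.1 2 then Quotient.mk (antipodal d) (toDiamond x)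
  else Quotient.mk (antipodal d) (toDiamond (-x))

lemma mk_toDiamond_neg {x : octahedron d} (h : x.1 2 = 0) :
    Quotient.mk (antipodal d) (toDiamond x) = Quotient.mk (antipodal d) (toDiamond (-x)) := by
  apply Quotient.sound
  refine Or.inr ⟨?_, ?_⟩
  · have := abs_add_le_of_mem x
    rw [h] at this
    simpa [toDiamond] using this
  · simp [toDiamond]

lemma coverMap_of_nonneg {x : octahedron d} (h : 0 ≤ x.1 2) :
    coverMap x = Quotient.mk (antipodal d) (toDiamond x) := if_pos h

lemma coverMap_of_nonpos {x : octahedron d} (h : x.1 2 ≤ 0) :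
    coverMap x = Quotient.mk (antipodal d) (toDiamond (-x)) := by
  rcases h.lt_or_eq with h | h
  · exact if_neg (not_le.2 h)
  · rw [coverMap_of_nonneg h.ge, mk_toDiamond_neg h]

@[simp] lemma coverMap_neg (x : octahedron d) : coverMap (-x) = coverMap x := by
  rcases le_total 0 (x.1 2) with h | h
  · rw [coverMap_of_nonneg h, coverMap_of_nonpos (by simpa using h), neg_neg]
  · rw [coverMap_of_nonpos h, coverMap_of_nonneg (by simpa using h)]

lemma coverMap_ofDiamond (x : diamond d) :
    coverMap (ofDiamond x) = Quotient.mk (antipodal d) x := by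
  have h : |x.1.1| + |x.1.2| ≤ d := x.2
  rw [coverMap_of_nonneg (by simp only [ofDiamond, Matrix.cons_val]; linarith)]
  rfl

lemma coverMap_continuous : Continuous (coverMap (d := d)) := by
  refine Continuous.if_le ?_ ?_ continuous_const ?_ fun x hx => mk_toDiamond_neg hx.symm
  · exact continuous_quotient_mk'.comp toDiamond_continuous
  · exact continuous_quotient_mk'.comp (toDiamond_continuous.comp octahedron_continuous_neg)
  · exact continuous_coord 2

lemma coverMap_eq_iff {x y : octahedron d} : coverMap x = coverMap y ↔ y = x ∨ y = -x := by
  constructor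
  · have key : ∀ x y : octahedron d, 0 ≤ x.1 2 → 0 ≤ y.1 2 → coverMap x = coverMap y →
        y = x ∨ y = -x := by
      intro x y hx hy h
      rw [coverMap_of_nonneg hx, coverMap_of_nonneg hy] at h
      have hxs := abs_add_le_of_mem x
      rcases Quotient.exact h with h | ⟨h1, h2⟩
      · left
        rw [← ofDiamond_toDiamond hx, ← ofDiamond_toDiamond hy, h]
      · right
        simp only [toDiamond] at h1 h2
        have h20 := congrArg Prod.fst h2
        have h21 := congrArg Prod.snd h2
        simp only [Prod.fst_neg, Prod.snd_neg] at h20 h21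
        have hx2 : x.1 2 = 0 := abs_eq_zero.1 (by linarith)
        have hy2 : y.1 2 = 0 := by
          have hys := abs_add_le_of_mem y
          rw [h20, h21, abs_neg, abs_neg] at hys
          exact abs_eq_zero.1 (by linarith)
        apply Subtype.ext
        funext i
        fin_cases i
        · exact h20
        · exact h21
        · simp [hx2, hy2]
    intro h
    rcases le_total 0 (x.1 2) with hx | hx <;> rcases le_total 0 (y.1 2) with hy | hy
    · exact key x y hx hy h
    · rcases key x (-y) hx (by simpa using hy) (by rw [coverMap_neg, h]) with h | h
      · right; rw [← h, neg_neg]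
      · left; exact neg_injective h
    · rcases key (-x) y (by simpa using hx) hy (by rw [coverMap_neg, h]) with h | h
      · right; exact h
      · left; rw [h, neg_neg]
    · rcases key (-x) (-y) (by simpa using hx) (by simpa using hy)
        (by rw [coverMap_neg, coverMap_neg, h]) with h | h
      · left; exact neg_injective h
      · right; exact neg_injective h
  · rintro (rfl | rfl) <;> simp

lemma coverMap_surjective : Function.Surjective (coverMap (d := d)) := by
  intro y
  obtain ⟨x, rfl⟩ := Quotient.exists_rep y
  exact ⟨_, coverMap_ofDiamond x⟩

lemma coverMap_isQuotientMap : Topology.IsQuotientMap (coverMap (d := d)) := by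
  refine Topology.IsQuotientMap.of_comp ofDiamond_continuous coverMap_continuous ?_
  have : coverMap ∘ ofDiamond = Quotient.mk (antipodal d) := funext coverMap_ofDiamond
  rw [this]
  exact isQuotientMap_quotient_mk'

lemma coverMap_preimage_image (U : Set (octahedron d)) :
    coverMap ⁻¹' (coverMap '' U) = U ∪ (fun x => -x) ⁻¹' U := by
  ext x
  constructor
  · rintro ⟨y, hy, hxy⟩
    rcases coverMap_eq_iff.1 hxy with rfl | rfl
    · exact Or.inl hy
    · exact Or.inr (by simpa using hy)
  · rintro (h | h)
    · exact ⟨x, h, rfl⟩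
    · exact ⟨-x, h, coverMap_neg x⟩

lemma coverMap_isOpenMap : IsOpenMap (coverMap (d := d)) := by
  intro U hU
  rw [← coverMap_isQuotientMap.isOpen_preimage, coverMap_preimage_image]
  exact hU.union (hU.preimage octahedron_continuous_neg)

/-! ### Contracting loops -/

/-- The radial projection to the octahedral sphere. -/
def radial (d : ℕ) (x : Fin 3 → ℝ) : Fin 3 → ℝ := ((d : ℝ) / ∑ i, |x i|) • x

lemma radial_mem {x : Fin 3 → ℝ} (hx : x ≠ 0) : radial d x ∈ octahedron d := by
  have hpos : 0 < ∑ i, |x i| := by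
    obtain ⟨i, hi⟩ := Function.ne_iff.1 hx
    exact Finset.sum_pos' (fun i _ => abs_nonneg _) ⟨i, Finset.mem_univ i, abs_pos.2 hi⟩
  simp only [octahedron, radial, Set.mem_ofPred_eq, Pi.smul_apply, smul_eq_mul, abs_mul]
  rw [← Finset.mul_sum, abs_of_nonneg (by positivity)]
  field_simp

lemma radial_eq_self (hd : 1 ≤ d) (x : octahedron d) : radial d x.1 = x.1 := by
  have h : ∑ i, |x.1 i| = d := x.2
  have : (d : ℝ) ≠ 0 := by exact_mod_cast (by omega : d ≠ 0)
  rw [radial, h, div_self this, one_smul]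

lemma segment_ne_zero (hd : 1 ≤ d) {x p : octahedron d} (h : x ≠ -p) (s : unitInterval) :
    (1 - (s : ℝ)) • x.1 + (s : ℝ) • p.1 ≠ 0 := by
  intro h0
  have hd' : (d : ℝ) ≠ 0 := by exact_mod_cast (by omega : d ≠ 0)
  have e : ∀ i, (1 - (s : ℝ)) * x.1 i = -((s : ℝ) * p.1 i) := by
    intro i
    have := congrFun h0 i
    simp only [Pi.add_apply, Pi.smul_apply, smul_eq_mul, Pi.zero_apply] at this
    linarith
  have e' : (1 - (s : ℝ)) * ∑ i, |x.1 i| = s * ∑ i, |p.1 i| := by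
    rw [Finset.mul_sum, Finset.mul_sum]
    refine Finset.sum_congr rfl fun i _ => ?_
    have := congrArg abs (e i)
    rwa [abs_neg, abs_mul, abs_mul, abs_of_nonneg s.2.1, abs_of_nonneg (by linarith [s.2.2])] at this
  rw [x.2, p.2] at e'
  have hs : (s : ℝ) = 1 / 2 := by
    have := mul_right_cancel₀ hd' e'
    linarith
  apply h
  apply Subtype.ext
  funext i
  have := e i
  rw [hs] at this
  simp only [octahedron_neg_coe, Pi.neg_apply]
  linarith

/-- A loop which stays in the image of an open set that contains no two antipodal points is
contractible: its lift to the sphere avoids the antipode of its starting point, and can be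
contracted radially to this point. -/
lemma loop_contractible (hd : 1 ≤ d) {A : Set (octahedron d)} (hA : IsOpen A)
    (hanti : ∀ x ∈ A, -x ∉ A) {y : ProjPlane d} (γ : Path y y)
    (hγ : Set.range γ ⊆ coverMap '' A) : γ.Homotopic (Path.refl y) := by
  have hinj : Function.Injective fun x : A => coverMap x.1 := by
    intro x x' h
    rcases coverMap_eq_iff.1 h with h | h
    · exact (Subtype.ext h).symm
    · exact absurd (h ▸ x'.2) (hanti _ x.2)
  have hemb : Topology.IsOpenEmbedding fun x : A => coverMap x.1 :=
    .of_continuous_injective_isOpenMap (coverMap_continuous.comp continuous_subtype_val) hinj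
      (coverMap_isOpenMap.comp hA.isOpenMap_subtype_val)
  -- lift the loop by the inverse of the homeomorphism between `A` and its image
  set e := hemb.isEmbedding.toHomeomorph with he
  have hmem : ∀ t, γ t ∈ Set.range fun x : A => coverMap x.1 := by
    intro t
    obtain ⟨x, hx, h⟩ := hγ ⟨t, rfl⟩
    exact ⟨⟨x, hx⟩, h⟩
  set lift : unitInterval → octahedron d := fun t => (e.symm ⟨γ t, hmem t⟩).1 with hlift
  have lift_cont : Continuous lift :=
    continuous_subtype_val.comp (e.symm.continuous.comp (γ.continuous.subtype_mk _))
  have lift_spec : ∀ t, coverMap (lift t) = γ t := by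
    intro t
    exact congrArg Subtype.val (e.apply_symm_apply ⟨γ t, hmem t⟩)
  have lift_one : lift 1 = lift 0 := by
    simp only [hlift]
    congr 3
    exact γ.target.trans γ.source.symm
  have lift_ne : ∀ t, lift t ≠ -lift 0 := by
    intro t h
    exact hanti _ (e.symm ⟨γ 0, hmem 0⟩).2 (h ▸ (e.symm ⟨γ t, hmem t⟩).2)
  set p := lift 0 with hp
  have hz : ∀ st : unitInterval × unitInterval,
      (1 - (st.1 : ℝ)) • (lift st.2).1 + (st.1 : ℝ) • p.1 ≠ 0 :=
    fun st => segment_ne_zero hd (lift_ne st.2) st.1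
  -- the radial projection of the straight contraction to the starting point
  set F : unitInterval × unitInterval → octahedron d := fun st =>
    ⟨radial d ((1 - (st.1 : ℝ)) • (lift st.2).1 + (st.1 : ℝ) • p.1), radial_mem (hz st)⟩ with hF
  have hFc : Continuous F := by
    have hc : Continuous fun st : unitInterval × unitInterval =>
        (1 - (st.1 : ℝ)) • (lift st.2).1 + (st.1 : ℝ) • p.1 := by
      have : Continuous fun st : unitInterval × unitInterval => (lift st.2).1 :=
        continuous_subtype_val.comp (lift_cont.comp continuous_snd)
      fun_prop
    refine Continuous.subtype_mk ?_ _
    unfold radial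
    have hc' : Continuous fun st : unitInterval × unitInterval =>
        ∑ i, |((1 - (st.1 : ℝ)) • (lift st.2).1 + (st.1 : ℝ) • p.1) i| := by
      refine continuous_finsetSum Finset.univ fun i _ => ?_
      exact continuous_abs.comp ((continuous_apply i).comp hc)
    refine Continuous.smul (Continuous.div continuous_const hc' fun st h0 => hz st ?_) hc
    rw [Finset.sum_eq_zero_iff_of_nonneg fun i _ => abs_nonneg _] at h0
    funext i
    exact abs_eq_zero.1 (h0 i (Finset.mem_univ i))
  have F_fix : ∀ s t, lift t = p → F (s, t) = p := by
    intro s t ht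
    apply Subtype.ext
    simp only [hF, ht]
    rw [← add_smul, sub_add_cancel, one_smul, radial_eq_self hd]
  have hp0 : coverMap p = y := (lift_spec 0).trans γ.source
  refine ⟨⟨⟨⟨fun st => coverMap (F st), coverMap_continuous.comp hFc⟩, fun t => ?_, fun t => ?_⟩,
    fun s t ht => ?_⟩⟩
  · refine Eq.trans (congrArg coverMap (Subtype.ext ?_)) (lift_spec t)
    change radial d ((1 - (0 : ℝ)) • (lift t).1 + (0 : ℝ) • p.1) = (lift t).1
    rw [sub_zero, one_smul, zero_smul, add_zero, radial_eq_self hd]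
  · have : F (1, t) = p := by
      apply Subtype.ext
      change radial d ((1 - (1 : ℝ)) • (lift t).1 + (1 : ℝ) • p.1) = p.1
      rw [sub_self, zero_smul, one_smul, zero_add, radial_eq_self hd]
    simp only [this, hp0]
    rfl
  · have ht' : lift t = p := by
      rcases ht with rfl | rfl
      · rfl
      · exact lift_one
    exact (congrArg coverMap ((F_fix s t ht').trans ht'.symm)).trans (lift_spec t)

/-! ### Signs on the octahedral sphere -/

/-- The sign distribution on the lattice points of the octahedral sphere. It restricts to the
extension of `σ` to the diamond on the upper hemisphere. -/
def octSign (σ : SignDistribution d) (u : OctPoint d) : ZMod 2 :=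
  σ ⟨(|u.1 0|, |u.1 1|), abs_nonneg _, abs_nonneg _, by
    have := u.2
    rw [Fin.sum_univ_three] at this
    have h := abs_nonneg (u.1 2)
    simp only
    omega⟩ + ∑ i, if u.1 i < 0 then (u.1 i : ZMod 2) else 0

lemma octSign_neg (σ : SignDistribution d) (u : OctPoint d) :
    octSign σ (-u) = octSign σ u + d := by
  have key : ∀ x : ℤ, (if -x < 0 then ((-x : ℤ) : ZMod 2) else 0)
      = (if x < 0 then (x : ZMod 2) else 0) + ((|x| : ℤ) : ZMod 2) := by
    intro x
    rcases lt_trichotomy x 0 with h | h | h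
    · rw [if_neg (by omega), if_pos h, abs_of_neg h, Int.cast_neg, add_neg_cancel]
    · simp [h]
    · rw [if_pos (by omega), if_neg (by omega), abs_of_pos h, Int.cast_neg, zero_add,
        CharTwo.neg_eq]
  have hd : ((d : ℕ) : ZMod 2) = ∑ i, ((|u.1 i| : ℤ) : ZMod 2) := by
    rw [← Int.cast_sum, u.2, Int.cast_natCast]
  rw [octSign, octSign, hd, add_assoc, ← Finset.sum_add_distrib]
  simp only [neg_val, Pi.neg_apply, abs_neg, key]

/-- The reflection of space which extends a reflection of the plane. -/
def spaceKlein (g : Klein) : Fin 3 → ℤˣ := ![g.1, g.2, 1]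

lemma octSign_reflect (σ : SignDistribution d) (g : Klein) (p : latticeTriangle d) :
    octSign σ (octReflect (spaceKlein g) (octLift p)) = extendSign σ (reflect g p) := by
  have h2 := octLift_nonneg p 2
  rw [octSign, extendSign, Fin.sum_univ_three, ← add_assoc, ← add_assoc]
  have e0 : (octReflect (spaceKlein g) (octLift p)).1 0 = (reflect g p).1.1 := rfl
  have e1 : (octReflect (spaceKlein g) (octLift p)).1 1 = (reflect g p).1.2 := rfl
  have e2 : (octReflect (spaceKlein g) (octLift p)).1 2 = (octLift p).1 2 := by
    simp [spaceKlein]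
  rw [if_neg (c := (octReflect (spaceKlein g) (octLift p)).1 2 < 0) (by rw [e2]; omega), add_zero]
  rfl

/-- A lattice point of the octahedral sphere as a point of the sphere. -/
def vertexPoint (u : OctPoint d) : octahedron d := ⟨toSpace u, toSpace_mem u⟩

lemma vertexPoint_neg (u : OctPoint d) : vertexPoint (-u) = -vertexPoint u :=
  Subtype.ext (toSpace_neg u)

lemma latticePoint_reflect (g : Klein) (p : latticeTriangle d) :
    latticePoint (reflect g p) = coverMap (vertexPoint (octReflect (spaceKlein g) (octLift p))) := by
  have h2 := octLift_nonneg p 2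
  rw [coverMap_of_nonneg]
  · rfl
  · simp only [vertexPoint, toSpace_apply, octReflect_val, spaceKlein, Matrix.cons_val,
      Units.val_one, one_mul]
    exact_mod_cast h2

namespace OctTriangulation

variable {K : OctTriangulation d}

/-! ### Stars of vertices -/

lemma exists_coords {x : Fin 3 → ℝ} (hx : x ∈ octahedron d) :
    ∃ u v w, {u, v, w} ∈ K.tris ∧ 0 ≤ K.hat x u ∧ 0 ≤ K.hat x v ∧ 0 ≤ K.hat x w ∧
      K.hat x u + K.hat x v + K.hat x w = 1 ∧
      x = K.hat x u • toSpace u + K.hat x v • toSpace v + K.hat x w • toSpace w ∧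
      ∀ t, t ∉ ({u, v, w} : Finset (OctPoint d)) → K.hat x t = 0 := by
  obtain ⟨u, v, w, h, a, b, c, ha, hb, hc, hs, hxe⟩ := K.cover x hx
  obtain ⟨h1, h2, h3, h4⟩ := hat_three h ha hb hc hs hxe
  refine ⟨u, v, w, h, ?_⟩
  rw [h1, h2, h3]
  refine ⟨ha, hb, hc, hs, hxe, fun t ht => ?_⟩
  simp only [Finset.mem_insert, Finset.mem_singleton, not_or] at ht
  exact h4 t ht.1 ht.2.1 ht.2.2

lemma hat_neg {x : Fin 3 → ℝ} (hx : x ∈ octahedron d) (t : OctPoint d) :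
    K.hat (-x) (-t) = K.hat x t := by
  obtain ⟨u, v, w, h, ha, hb, hc, hs, hxe, h0⟩ := exists_coords (K := K) hx
  obtain ⟨h1, h2, h3, h4⟩ := hat_three (tri_neg h) ha hb hc hs (x := -x) (by
    rw [toSpace_neg, toSpace_neg, toSpace_neg]
    nth_rewrite 1 [hxe]
    module)
  by_cases t1 : t = u
  · rw [t1, h1]
  by_cases t2 : t = v
  · rw [t2, h2]
  by_cases t3 : t = w
  · rw [t3, h3]
  rw [h0 t (by simp [t1, t2, t3]), h4 _ (neg_injective.ne t1) (neg_injective.ne t2)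
    (neg_injective.ne t3)]

/-- The point `x` belongs to the star of `u` in the barycentric subdivision: no barycentric
coordinate of `x` exceeds the one at `u`. -/
def IsTop (K : OctTriangulation d) (x : octahedron d) (u : OctPoint d) : Prop :=
  ∀ t, K.hat x.1 t ≤ K.hat x.1 u

lemma isTop_neg {x : octahedron d} {u : OctPoint d} : K.IsTop (-x) (-u) ↔ K.IsTop x u := by
  constructor
  · intro h t
    have := h (-t)
    rwa [octahedron_neg_coe, hat_neg x.2, hat_neg x.2] at this
  · intro h t
    rw [octahedron_neg_coe, hat_neg x.2, ← neg_neg t, hat_neg x.2]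
    exact h (-t)

lemma IsTop.pos {x : octahedron d} {u : OctPoint d} (h : K.IsTop x u) : 0 < K.hat x.1 u := by
  obtain ⟨p, q, r, -, -, -, -, hs, -⟩ := exists_coords (K := K) x.2
  have h1 := h p
  have h2 := h q
  have h3 := h r
  linarith

lemma exists_top (x : octahedron d) : ∃ u, K.IsTop x u := by
  obtain ⟨u, v, w, -, -⟩ := exists_coords (K := K) x.2
  have : Nonempty (OctPoint d) := ⟨u⟩
  obtain ⟨t, ht⟩ := Finite.exists_max fun t => K.hat x.1 t
  exact ⟨t, ht⟩

lemma isClosed_top (u : OctPoint d) : IsClosed {x : octahedron d | K.IsTop x u} := by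
  simp only [IsTop, Set.ofPred_forall]
  exact isClosed_iInter fun t => isClosed_le
    ((K.hat_continuous t).comp continuous_subtype_val)
    ((K.hat_continuous u).comp continuous_subtype_val)

/-- All top vertices of a point belong to one triangle. -/
lemma tops_mem (x : octahedron d) : ∃ S ∈ K.tris, ∀ u, K.IsTop x u → u ∈ S := by
  obtain ⟨u, v, w, h, -, -, -, -, -, h0⟩ := exists_coords (K := K) x.2
  refine ⟨_, h, fun t ht => ?_⟩
  by_contra hc
  exact ht.pos.ne' (h0 t hc)

lemma tops_edge {x : octahedron d} {u v : OctPoint d} (hu : K.IsTop x u) (hv : K.IsTop x v)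
    (hne : u ≠ v) : K.Edge u v := by
  obtain ⟨S, hS, h⟩ := tops_mem (K := K) x
  obtain ⟨w, rfl⟩ := tri_of_mem hS (h u hu) (h v hv) hne
  exact ⟨w, hS⟩

lemma tops_tri {x : octahedron d} {u v w : OctPoint d} (hu : K.IsTop x u) (hv : K.IsTop x v)
    (hw : K.IsTop x w) (n1 : u ≠ v) (n2 : u ≠ w) (n3 : v ≠ w) : {u, v, w} ∈ K.tris := by
  obtain ⟨S, hS, h⟩ := tops_mem (K := K) x
  have hsub : ({u, v, w} : Finset (OctPoint d)) ⊆ S := by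
    intro y hy
    simp only [Finset.mem_insert, Finset.mem_singleton] at hy
    rcases hy with rfl | rfl | rfl
    exacts [h _ hu, h _ hv, h _ hw]
  rwa [Finset.eq_of_subset_of_card_le hsub
    (by rw [K.card_eq S hS, Finset.card_eq_three.2 ⟨u, v, w, n1, n2, n3, rfl⟩])]

/-- The points of the segment from the midpoint of `uv` to the barycenter of `uvw` belong to the stars
of `u` and `v`. -/
lemma isTop_comb {u v w : OctPoint d} (h : {u, v, w} ∈ K.tris) {a c : ℝ} (hc : 0 ≤ c)
    (hca : c ≤ a) (hs : a + a + c = 1) {x : octahedron d}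
    (hx : x.1 = a • toSpace u + a • toSpace v + c • toSpace w) :
    K.IsTop x u ∧ K.IsTop x v ∧ (c = a → K.IsTop x w) := by
  obtain ⟨h1, h2, h3, h4⟩ := hat_three h (hc.trans hca) (hc.trans hca) hc hs hx
  have key : ∀ t, K.hat x.1 t ≤ a := by
    intro t
    by_cases t1 : t = u
    · rw [t1, h1]
    by_cases t2 : t = v
    · rw [t2, h2]
    by_cases t3 : t = w
    · rw [t3, h3]; exact hca
    rw [h4 t t1 t2 t3]; exact hc.trans hca
  exact ⟨fun t => h1 ▸ key t, fun t => h2 ▸ key t, fun e t => by rw [h3, e]; exact key t⟩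

/-- Conversely, a point in the stars of `u` and `v` lies on such a segment. -/
lemma tops_comb {x : octahedron d} {u v : OctPoint d} (hu : K.IsTop x u) (hv : K.IsTop x v)
    (hne : u ≠ v) : ∃ w, {u, v, w} ∈ K.tris ∧ ∃ a c : ℝ, 0 ≤ c ∧ c ≤ a ∧ a + a + c = 1 ∧
      x.1 = a • toSpace u + a • toSpace v + c • toSpace w := by
  obtain ⟨p, q, r, h, ha, hb, hc, hs, hxe, h0⟩ := exists_coords (K := K) x.2
  have hmem : ∀ t, K.IsTop x t → t ∈ ({p, q, r} : Finset (OctPoint d)) := by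
    intro t ht
    by_contra hc
    exact ht.pos.ne' (h0 t hc)
  obtain ⟨w, hw⟩ := tri_of_mem h (hmem u hu) (hmem v hv) hne
  obtain ⟨n1, n2, n3⟩ := tri_ne h
  have huv : K.hat x.1 u = K.hat x.1 v := le_antisymm (hv u) (hu v)
  have hw' := h
  rw [hw] at hw'
  have h0w : 0 ≤ K.hat x.1 w ∧ K.hat x.1 u + K.hat x.1 v + K.hat x.1 w = 1 ∧
      x.1 = K.hat x.1 u • toSpace u + K.hat x.1 v • toSpace v + K.hat x.1 w • toSpace w := by
    rcases triple_eq n1 n2 n3 hw with ⟨rfl, rfl, rfl⟩ | ⟨rfl, rfl, rfl⟩ | ⟨rfl, rfl, rfl⟩ |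
      ⟨rfl, rfl, rfl⟩ | ⟨rfl, rfl, rfl⟩ | ⟨rfl, rfl, rfl⟩
    · exact ⟨hc, hs, hxe⟩
    · exact ⟨hb, by linarith, by nth_rewrite 1 [hxe]; abel⟩
    · exact ⟨hc, by linarith, by nth_rewrite 1 [hxe]; abel⟩
    · exact ⟨hb, by linarith, by nth_rewrite 1 [hxe]; abel⟩
    · exact ⟨ha, by linarith, by nth_rewrite 1 [hxe]; abel⟩
    · exact ⟨ha, by linarith, by nth_rewrite 1 [hxe]; abel⟩
  refine ⟨w, hw', K.hat x.1 u, K.hat x.1 w, h0w.1, hu w, ?_, ?_⟩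
  · have := h0w.2.1; rw [← huv] at this; exact this
  · have := h0w.2.2; rw [← huv] at this; exact this

/-! ### The curve on the sphere -/

/-- The two segments of the curve at the edge `uv`: the intersection of the stars of `u` and `v`. -/
def cell (K : OctTriangulation d) (u v : OctPoint d) : Set (octahedron d) :=
  {x | K.IsTop x u ∧ K.IsTop x v}

lemma cell_closed (u v : OctPoint d) : IsClosed (K.cell u v) :=
  (isClosed_top u).inter (isClosed_top v)

lemma cell_preconnected {u v : OctPoint d} (hne : u ≠ v) : IsPreconnected (K.cell u v) := by
  by_cases hex : ∃ x, x ∈ K.cell u v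
  swap
  · rw [Set.eq_empty_of_forall_notMem fun x hx => hex ⟨x, hx⟩]
    exact isPreconnected_empty
  obtain ⟨x, hx⟩ := hex
  obtain ⟨w, hw⟩ := tops_edge hx.1 hx.2 hne
  have mid : (1 / 2 : ℝ) • toSpace u + (1 / 2 : ℝ) • toSpace v + (0 : ℝ) • toSpace w
      ∈ octahedron d := comb_mem_octahedron hw (by norm_num) (by norm_num) le_rfl (by norm_num)
  refine isPreconnected_of_forall ⟨_, mid⟩ fun y hy => ?_
  obtain ⟨w', hw', a, c, hc, hca, hs, hye⟩ := tops_comb hy.1 hy.2 hne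
  have hmem : ∀ t : unitInterval, ((1 - (t : ℝ)) / 2 + t * a) • toSpace u
      + ((1 - (t : ℝ)) / 2 + t * a) • toSpace v + ((t : ℝ) * c) • toSpace w' ∈ octahedron d := by
    intro t
    have h0 := t.2.1
    have h1 := t.2.2
    have ha : 0 ≤ a := hc.trans hca
    have h2 : 0 ≤ (1 - (t : ℝ)) / 2 + t * a := by
      have : 0 ≤ (t : ℝ) * a := mul_nonneg h0 ha
      linarith
    refine comb_mem_octahedron hw' h2 h2 (mul_nonneg h0 hc) ?_
    linear_combination (t : ℝ) * hs
  set φ : unitInterval → octahedron d := fun t => ⟨_, hmem t⟩ with hφ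
  have hcont : Continuous φ := Continuous.subtype_mk (by fun_prop) _
  refine ⟨Set.range φ, ?_, ⟨0, ?_⟩, ⟨1, ?_⟩, isPreconnected_range hcont⟩
  · rintro _ ⟨t, rfl⟩
    have h0 := t.2.1
    have h1 := t.2.2
    obtain ⟨k1, k2, -⟩ := isTop_comb hw' (x := φ t) (mul_nonneg h0 hc) (by nlinarith)
      (by linear_combination (t : ℝ) * hs) rfl
    exact ⟨k1, k2⟩
  · apply Subtype.ext
    change ((1 - (0 : ℝ)) / 2 + 0 * a) • toSpace u
      + ((1 - (0 : ℝ)) / 2 + 0 * a) • toSpace v + ((0 : ℝ) * c) • toSpace w' = _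
    module
  · apply Subtype.ext
    change ((1 - (1 : ℝ)) / 2 + 1 * a) • toSpace u
      + ((1 - (1 : ℝ)) / 2 + 1 * a) • toSpace v + ((1 : ℝ) * c) • toSpace w' = _
    rw [hye]
    module

lemma exists_barycenter {u v w : OctPoint d} (h : {u, v, w} ∈ K.tris) :
    ∃ x, K.IsTop x u ∧ K.IsTop x v ∧ K.IsTop x w := by
  have mem := comb_mem_octahedron h (a := 1 / 3) (b := 1 / 3) (c := 1 / 3) (by norm_num)
    (by norm_num) (by norm_num) (by norm_num)
  obtain ⟨h1, h2, h3⟩ := isTop_comb h (a := 1 / 3) (c := 1 / 3) (by norm_num) (by norm_num)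
    (by norm_num) (x := ⟨_, mem⟩) rfl
  exact ⟨_, h1, h2, h3 rfl⟩

/-- The preimage of the patchworked curve in the octahedral sphere. -/
def curveLift (K : OctTriangulation d) (s : OctPoint d → ZMod 2) : Set (octahedron d) :=
  {x | ∃ u v, s u ≠ s v ∧ x ∈ K.cell u v}

lemma mem_patchworkedCurve (hd : 1 ≤ d) (σ : SignDistribution d) {u v w : OctPoint d}
    (h : {u, v, w} ∈ K.tris) (hz : 0 ≤ u.1 2 ∧ 0 ≤ v.1 2 ∧ 0 ≤ w.1 2)
    (hs : octSign σ u ≠ octSign σ v) {x : octahedron d} {a c : ℝ} (hc : 0 ≤ c) (hca : c ≤ a)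
    (hac : a + a + c = 1) (hx : x.1 = a • toSpace u + a • toSpace v + c • toSpace w) :
    coverMap x ∈ patchworkedCurve (K.planeComplex hd) σ := by
  -- the triangle lies in one octant, and is a copy of a triangle of the positive octant
  have key : ∃ g : Klein, ∃ p q r : latticeTriangle d, u = octReflect (spaceKlein g) (octLift p) ∧
      v = octReflect (spaceKlein g) (octLift q) ∧ w = octReflect (spaceKlein g) (octLift r) := by
    have sgn : ∀ i, ∃ e : ℤˣ, ∀ t ∈ ({u, v, w} : Finset (OctPoint d)), 0 ≤ (e : ℤ) * t.1 i := by
      intro i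
      rcases K.sameOctant _ h i with h | h
      · exact ⟨1, fun t ht => by simpa using h t ht⟩
      · exact ⟨-1, fun t ht => by simpa using h t ht⟩
    obtain ⟨α, hα⟩ := sgn 0
    obtain ⟨β, hβ⟩ := sgn 1
    have lift : ∀ t ∈ ({u, v, w} : Finset (OctPoint d)), 0 ≤ t.1 2 →
        ∃ p, t = octReflect (spaceKlein (α, β)) (octLift p) := by
      intro t ht ht2
      obtain ⟨p, hp⟩ := exists_octLift (u := octReflect (spaceKlein (α, β)) t) (by
        intro i
        fin_cases i
        · simpa [spaceKlein] using hα t ht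
        · simpa [spaceKlein] using hβ t ht
        · simpa [spaceKlein] using ht2)
      exact ⟨p, by rw [← hp, octReflect_octReflect]⟩
    obtain ⟨p, hp⟩ := lift u (by simp) hz.1
    obtain ⟨q, hq⟩ := lift v (by simp) hz.2.1
    obtain ⟨r, hr⟩ := lift w (by simp) hz.2.2
    exact ⟨(α, β), p, q, r, hp, hq, hr⟩
  obtain ⟨g, p, q, r, hu, hv, hw⟩ := key
  have hx2 : 0 ≤ x.1 2 := by
    rw [hx]
    have h0 : (0 : ℝ) ≤ u.1 2 := by exact_mod_cast hz.1
    have h1 : (0 : ℝ) ≤ v.1 2 := by exact_mod_cast hz.2.1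
    have h2 : (0 : ℝ) ≤ w.1 2 := by exact_mod_cast hz.2.2
    have ha := hc.trans hca
    simp only [Pi.add_apply, Pi.smul_apply, smul_eq_mul, toSpace_apply]
    positivity
  rw [coverMap_of_nonneg hx2]
  refine ⟨_, ⟨g, p, q, r, ?_, ?_, ?_⟩, rfl⟩
  · rw [isTriangle_planeComplex]
    have := tri_reflect (spaceKlein g) h
    rwa [hu, hv, hw, octReflect_octReflect, octReflect_octReflect, octReflect_octReflect] at this
  · rwa [← octSign_reflect, ← octSign_reflect, ← hu, ← hv]
  · have e : ∀ (t : OctPoint d) (p : latticeTriangle d), t = octReflect (spaceKlein g) (octLift p) →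
        toPlane (reflect g p) = (toSpace t 0, toSpace t 1) := by
      rintro t p rfl
      rfl
    rw [e u p hu, e v q hv, e w r hw]
    refine ⟨1 - 3 * c, 3 * c, by linarith, by linarith, by ring, ?_⟩
    have x0 := congrFun hx 0
    have x1 := congrFun hx 1
    simp only [Pi.add_apply, Pi.smul_apply, smul_eq_mul] at x0 x1
    have ha : a = (1 - c) / 2 := by linarith
    ext
    · simp only [toDiamond, Prod.fst_add, Prod.smul_fst, smul_eq_mul, x0, ha]; ring
    · simp only [toDiamond, Prod.snd_add, Prod.smul_snd, smul_eq_mul, x1, ha]; ring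

/-- The segments of the curve are the intersections of the stars of the ends of bicolored edges. The
lower hemisphere is reduced to the upper one by the antipodal map. -/
lemma patchworkedCurve_planeComplex (hd : 1 ≤ d) (σ : SignDistribution d) :
    patchworkedCurve (K.planeComplex hd) σ = coverMap '' K.curveLift (octSign σ) := by
  apply Set.Subset.antisymm
  · rintro _ ⟨x, ⟨g, p, q, r, ht, hs, hx⟩, rfl⟩
    rw [isTriangle_planeComplex] at ht
    have ht' := tri_reflect (spaceKlein g) ht
    rw [← octSign_reflect, ← octSign_reflect] at hs
    obtain ⟨t₀, t₁, h0, h1, h01, hx⟩ := hx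
    have mem := comb_mem_octahedron ht' (a := t₀ / 2 + t₁ / 3) (b := t₀ / 2 + t₁ / 3) (c := t₁ / 3)
      (by positivity) (by positivity) (by positivity) (by linarith)
    obtain ⟨k1, k2, -⟩ := isTop_comb ht' (a := t₀ / 2 + t₁ / 3) (c := t₁ / 3) (by positivity)
      (by linarith) (by linarith) (x := ⟨_, mem⟩) rfl
    refine ⟨⟨_, mem⟩, ⟨_, _, hs, k1, k2⟩, ?_⟩
    rw [coverMap_of_nonneg]
    · congr 1
      apply Subtype.ext
      rw [← hx]
      have e : ∀ p : latticeTriangle d, toPlane (reflect g p)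
          = (toSpace (octReflect (spaceKlein g) (octLift p)) 0,
            toSpace (octReflect (spaceKlein g) (octLift p)) 1) := fun p => rfl
      rw [e p, e q, e r]
      ext
      · simp only [toDiamond, Prod.fst_add, Prod.smul_fst, smul_eq_mul, Pi.add_apply, Pi.smul_apply]
        ring
      · simp only [toDiamond, Prod.snd_add, Prod.smul_snd, smul_eq_mul, Pi.add_apply, Pi.smul_apply]
        ring
    · have nn : ∀ p : latticeTriangle d, 0 ≤ toSpace (octReflect (spaceKlein g) (octLift p)) 2 := by
        intro p
        simp only [toSpace_apply, octReflect_val, spaceKlein, Matrix.cons_val, Units.val_one,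
          one_mul]
        exact_mod_cast octLift_nonneg p 2
      have := nn p
      have := nn q
      have := nn r
      simp only [Pi.add_apply, Pi.smul_apply, smul_eq_mul]
      positivity
  · rintro _ ⟨x, ⟨u, v, hs, hu, hv⟩, rfl⟩
    obtain ⟨w, h, a, c, hc, hca, hac, hx⟩ := tops_comb hu hv fun h => hs (h ▸ rfl)
    rcases K.sameOctant _ h 2 with h2 | h2
    · exact mem_patchworkedCurve hd σ h ⟨h2 u (by simp), h2 v (by simp), h2 w (by simp)⟩ hs hc hca
        hac hx
    · rw [← coverMap_neg]
      refine mem_patchworkedCurve hd σ (tri_neg h) ?_ ?_ hc hca hac ?_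
      · have h3 := h2 u (by simp)
        have h4 := h2 v (by simp)
        have h5 := h2 w (by simp)
        simp only [neg_val, Pi.neg_apply]
        omega
      · rw [octSign_neg, octSign_neg]
        exact fun h => hs (add_right_cancel h)
      · rw [octahedron_neg_coe, hx, toSpace_neg, toSpace_neg, toSpace_neg]
        module

end OctTriangulation

/-! ### The components of the curve -/

/-- Elementary moves between pairs of vertices: reversal, the antipodal map, and the passage between
the two bicolored edges of a triangle in `T`. -/
inductive CurveLink (T : Set (Finset (OctPoint d))) (s : OctPoint d → ZMod 2) :
    OctPoint d × OctPoint d → OctPoint d × OctPoint d → Prop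
  | swap (u v) : CurveLink T s (u, v) (v, u)
  | neg (u v) : CurveLink T s (u, v) (-u, -v)
  | tri {u v w} (h : {u, v, w} ∈ T) (h1 : s u ≠ s v) (h2 : s w ≠ s v) : CurveLink T s (u, v) (w, v)

/-- The equivalence relation on pairs of vertices generated by the elementary moves. On bicolored
edges, its classes are the components of the curve. -/
def CurveRel (T : Set (Finset (OctPoint d))) (s : OctPoint d → ZMod 2) :
    OctPoint d × OctPoint d → OctPoint d × OctPoint d → Prop :=
  Relation.EqvGen (CurveLink T s)

namespace CurveRel

variable {T T' : Set (Finset (OctPoint d))} {s : OctPoint d → ZMod 2}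
  {e f g : OctPoint d × OctPoint d}

lemma refl (e : OctPoint d × OctPoint d) : CurveRel T s e e := Relation.EqvGen.refl e

lemma symm (h : CurveRel T s e f) : CurveRel T s f e := Relation.EqvGen.symm _ _ h

lemma trans (h : CurveRel T s e f) (h' : CurveRel T s f g) : CurveRel T s e g :=
  Relation.EqvGen.trans _ _ _ h h'

lemma of_link (h : CurveLink T s e f) : CurveRel T s e f := Relation.EqvGen.rel _ _ h

lemma swap (u v : OctPoint d) : CurveRel T s (u, v) (v, u) := of_link (.swap u v)

lemma neg (u v : OctPoint d) : CurveRel T s (u, v) (-u, -v) := of_link (.neg u v)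

/-- To show that a relation contains `CurveRel`, it suffices to consider the moves. -/
lemma of_forall_link {r : OctPoint d × OctPoint d → OctPoint d × OctPoint d → Prop}
    (hr : Equivalence r) (hl : ∀ e f, CurveLink T s e f → r e f) (h : CurveRel T s e f) : r e f := by
  induction h with
  | rel x y h => exact hl x y h
  | refl x => exact hr.refl x
  | symm x y _ ih => exact hr.symm ih
  | trans x y z _ _ ih1 ih2 => exact hr.trans ih1 ih2

lemma mono (hT : T ⊆ T') (h : CurveRel T s e f) : CurveRel T' s e f := by
  refine of_forall_link ⟨refl, symm, trans⟩ ?_ h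
  rintro _ _ (⟨u, v⟩ | ⟨u, v⟩ | ⟨h, h1, h2⟩)
  exacts [swap u v, neg u v, of_link (.tri (hT h) h1 h2)]

end CurveRel

lemma zmod_two_eq_of_ne {x y z : ZMod 2} (h1 : x ≠ z) (h2 : y ≠ z) : x = y := by
  revert x y z; decide

namespace OctTriangulation

variable {K : OctTriangulation d} {s : OctPoint d → ZMod 2}

/-- The pair `e` is a bicolored edge. -/
def Bicolored (K : OctTriangulation d) (s : OctPoint d → ZMod 2) (e : OctPoint d × OctPoint d) :
    Prop := K.Edge e.1 e.2 ∧ s e.1 ≠ s e.2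

/-- The signs of antipodal points differ by a constant. -/
def SignAlternates (d : ℕ) (s : OctPoint d → ZMod 2) : Prop := ∀ u, s (-u) = s u + d

lemma _root_.TCurve.octSign_alternates (σ : SignDistribution d) : SignAlternates d (octSign σ) :=
  octSign_neg σ

lemma SignAlternates.ne_neg (hs : SignAlternates d s) {u v : OctPoint d} :
    s (-u) ≠ s (-v) ↔ s u ≠ s v := by
  rw [hs, hs, ne_eq, add_left_inj]

lemma Edge.neg_iff {u v : OctPoint d} : K.Edge (-u) (-v) ↔ K.Edge u v := by
  refine ⟨fun h => ?_, Edge.neg⟩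
  have := h.neg
  rwa [neg_neg, neg_neg] at this

lemma Bicolored.swap {u v : OctPoint d} (h : K.Bicolored s (u, v)) : K.Bicolored s (v, u) :=
  ⟨Edge.symm h.1, Ne.symm h.2⟩

lemma bicolored_link (hs : SignAlternates d s) {T : Set (Finset (OctPoint d))} (hT : T ⊆ K.tris)
    {e f : OctPoint d × OctPoint d} (h : CurveLink T s e f) :
    K.Bicolored s e ↔ K.Bicolored s f := by
  rcases h with ⟨u, v⟩ | ⟨u, v⟩ | ⟨h, h1, h2⟩
  · exact ⟨Bicolored.swap, Bicolored.swap⟩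
  · exact and_congr Edge.neg_iff.symm hs.ne_neg.symm
  · refine ⟨fun _ => ⟨⟨_, tri_rotate (tri_rotate (tri_swap (hT h)))⟩, h2⟩, fun _ => ⟨⟨_, hT h⟩, h1⟩⟩

lemma neg_mem_cell {u v : OctPoint d} {x : octahedron d} :
    -x ∈ K.cell (-u) (-v) ↔ x ∈ K.cell u v := and_congr isTop_neg isTop_neg

lemma cell_swap (u v : OctPoint d) : K.cell u v = K.cell v u := Set.ext fun _ => and_comm

/-- Two bicolored edges whose cells intersect are equal up to reversal, or belong to one triangle. -/
lemma rel_of_cell_inter {u v u' v' : OctPoint d} (h1 : s u ≠ s v) (h2 : s u' ≠ s v')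
    {x : octahedron d} (hx : x ∈ K.cell u v) (hx' : x ∈ K.cell u' v') :
    CurveRel K.tris s (u, v) (u', v') := by
  have key : ∀ u v u' v', s u ≠ s v → s u = s u' → s v = s v' → x ∈ K.cell u v → x ∈ K.cell u' v' →
      CurveRel K.tris s (u, v) (u', v') := by
    clear h1 h2 hx hx' u v u' v'
    intro u v u' v' h hu hv hx hx'
    have step : ∀ u u' v, s u ≠ s v → s u = s u' → K.IsTop x u → K.IsTop x u' → K.IsTop x v →
        CurveRel K.tris s (u, v) (u', v) := by
      intro u u' v h hu t1 t2 t3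
      by_cases huu : u = u'
      · rw [huu]; exact .refl _
      · refine .of_link (.tri (tops_tri t1 t3 t2 (fun h' => h (h' ▸ rfl)) huu ?_) h (hu ▸ h))
        rintro rfl
        exact h hu
    have h' : s v' ≠ s u' := fun e => h (by rw [hu, hv, e])
    exact (step u u' v h hu hx.1 hx'.1 hx.2).trans ((CurveRel.swap _ _).trans
      ((step v v' u' (by rw [hv]; exact h') hv hx.2 hx'.2 hx'.1).trans (.swap _ _)))
  by_cases hu : s u = s u'
  · exact key u v u' v' h1 hu (zmod_two_eq_of_ne h1.symm (hu ▸ h2.symm)) hx hx'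
  · refine (key u v v' u' h1 (zmod_two_eq_of_ne hu h2.symm) ?_ hx
      (by rwa [cell_swap] at hx')).trans (.swap _ _)
    exact (zmod_two_eq_of_ne (Ne.symm hu) h1.symm).symm

lemma rel_of_cell_inter_neg {u v u' v' : OctPoint d} (hs : SignAlternates d s)
    (h1 : s u ≠ s v) (h2 : s u' ≠ s v') {x x' : octahedron d} (hx : x ∈ K.cell u v)
    (hx' : x' ∈ K.cell u' v') (h : coverMap x = coverMap x') :
    CurveRel K.tris s (u, v) (u', v') := by
  rcases coverMap_eq_iff.1 h with rfl | rfl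
  · exact rel_of_cell_inter h1 h2 hx hx'
  · refine (rel_of_cell_inter h1 (hs.ne_neg.2 h2) hx ?_).trans (CurveRel.neg u' v').symm
    rwa [← neg_mem_cell, neg_neg, neg_neg]

/-- The union of the cells of all bicolored edges equivalent to `e`. -/
def classSet (K : OctTriangulation d) (s : OctPoint d → ZMod 2) (e : OctPoint d × OctPoint d) :
    Set (ProjPlane d) :=
  {y | ∃ f, CurveRel K.tris s e f ∧ s f.1 ≠ s f.2 ∧ y ∈ coverMap '' K.cell f.1 f.2}

lemma isClosed_coverMap_image {A : Set (octahedron d)} (hA : IsClosed A) :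
    IsClosed (coverMap '' A) := by
  rw [← coverMap_isQuotientMap.isClosed_preimage, coverMap_preimage_image]
  exact hA.union (hA.preimage octahedron_continuous_neg)

lemma isClosed_cells (P : OctPoint d × OctPoint d → Prop) :
    IsClosed {y | ∃ f, P f ∧ y ∈ coverMap '' K.cell f.1 f.2} := by
  have : {y | ∃ f, P f ∧ y ∈ coverMap '' K.cell f.1 f.2}
      = ⋃ f : {f // P f}, coverMap '' K.cell f.1.1 f.1.2 := by
    ext y
    simp
  rw [this]
  exact isClosed_iUnion_of_finite fun f => isClosed_coverMap_image (cell_closed _ _)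

lemma classSet_closed (e : OctPoint d × OctPoint d) : IsClosed (K.classSet s e) := by
  have := isClosed_cells (K := K) fun f => CurveRel K.tris s e f ∧ s f.1 ≠ s f.2
  simpa only [classSet, and_assoc] using this

/-- The component of the curve which contains the cell of `e`. -/
def edgeComponent (K : OctTriangulation d) (s : OctPoint d → ZMod 2) (e : OctPoint d × OctPoint d) :
    Set (ProjPlane d) :=
  {y | ∃ x ∈ K.cell e.1 e.2, y ∈ connectedComponentIn (coverMap '' K.curveLift s) (coverMap x)}

lemma edgeComponent_eq {e : OctPoint d × OctPoint d} (h : s e.1 ≠ s e.2) {x : octahedron d}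
    (hx : x ∈ K.cell e.1 e.2) : K.edgeComponent s e
      = connectedComponentIn (coverMap '' K.curveLift s) (coverMap x) := by
  have hsub : coverMap '' K.cell e.1 e.2 ⊆ coverMap '' K.curveLift s :=
    Set.image_mono fun y hy => ⟨_, _, h, hy⟩
  have hpre : IsPreconnected (coverMap '' K.cell e.1 e.2) :=
    (cell_preconnected fun h' => h (congrArg s h')).image _ coverMap_continuous.continuousOn
  ext y
  constructor
  · rintro ⟨x', hx', hy⟩
    have := hpre.subset_connectedComponentIn ⟨x, hx, rfl⟩ hsub ⟨x', hx', rfl⟩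
    rwa [connectedComponentIn_eq this]
  · intro hy
    exact ⟨x, hx, hy⟩

lemma cell_nonempty {u v : OctPoint d} (h : K.Edge u v) : (K.cell u v).Nonempty := by
  obtain ⟨w, hw⟩ := h
  obtain ⟨x, h1, h2, -⟩ := exists_barycenter hw
  exact ⟨x, h1, h2⟩

lemma edgeComponent_eq_of_rel (hs : SignAlternates d s) {e f : OctPoint d × OctPoint d}
    (h : CurveRel K.tris s e f) :
    (K.Bicolored s e ↔ K.Bicolored s f) ∧
      (K.Bicolored s e → K.edgeComponent s e = K.edgeComponent s f) := by
  refine CurveRel.of_forall_link (r := fun e f => (K.Bicolored s e ↔ K.Bicolored s f) ∧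
      (K.Bicolored s e → K.edgeComponent s e = K.edgeComponent s f)) ⟨?_, ?_, ?_⟩ ?_ h
  · exact fun e => ⟨Iff.rfl, fun _ => rfl⟩
  · rintro e f ⟨h1, h2⟩
    exact ⟨h1.symm, fun hf => (h2 (h1.2 hf)).symm⟩
  · rintro e f g ⟨h1, h2⟩ ⟨h3, h4⟩
    exact ⟨h1.trans h3, fun he => (h2 he).trans (h4 (h1.1 he))⟩
  · intro e f hl
    refine ⟨bicolored_link hs subset_rfl hl, fun he => ?_⟩
    rcases hl with ⟨u, v⟩ | ⟨u, v⟩ | ⟨h, h1, h2⟩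
    · obtain ⟨x, hx⟩ := cell_nonempty he.1
      rw [edgeComponent_eq he.2 hx, edgeComponent_eq (e := (v, u)) (Ne.symm he.2)
        (by rwa [cell_swap] at hx)]
    · obtain ⟨x, hx⟩ := cell_nonempty he.1
      rw [edgeComponent_eq he.2 hx, edgeComponent_eq (e := (-u, -v)) (hs.ne_neg.2 he.2)
        (neg_mem_cell.2 hx), coverMap_neg]
    · obtain ⟨x, t1, t2, t3⟩ := exists_barycenter h
      rw [edgeComponent_eq (e := (_, _)) h1 ⟨t1, t2⟩, edgeComponent_eq (e := (_, _)) h2 ⟨t3, t2⟩]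

/-- The components of the curve are the unions of the cells of the classes of bicolored edges. -/
lemma component_eq_classSet (hs : SignAlternates d s) {e : OctPoint d × OctPoint d}
    (he : K.Bicolored s e) : K.edgeComponent s e = K.classSet s e := by
  apply Set.Subset.antisymm
  · obtain ⟨x, hx⟩ := cell_nonempty he.1
    rw [edgeComponent_eq he.2 hx]
    set C := coverMap '' K.curveLift s with hC
    have hxC : coverMap x ∈ C := ⟨x, ⟨_, _, he.2, hx⟩, rfl⟩
    set D := {y | ∃ f, (¬ CurveRel K.tris s e f ∧ s f.1 ≠ s f.2) ∧ y ∈ coverMap '' K.cell f.1 f.2}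
      with hD
    have hcov : connectedComponentIn C (coverMap x) ⊆ K.classSet s e ∪ D := by
      intro y hy
      obtain ⟨z, ⟨u, v, huv, hz⟩, rfl⟩ := connectedComponentIn_subset _ _ hy
      by_cases hr : CurveRel K.tris s e (u, v)
      · exact Or.inl ⟨(u, v), hr, huv, z, hz, rfl⟩
      · exact Or.inr ⟨(u, v), ⟨hr, huv⟩, z, hz, rfl⟩
    have hdisj : ∀ y ∈ K.classSet s e, y ∉ D := by
      rintro y ⟨f, hf, hf', z, hz, rfl⟩ ⟨f', ⟨hg, hg'⟩, z', hz', hzz⟩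
      exact hg (hf.trans (rel_of_cell_inter_neg hs hf' hg' hz hz' hzz.symm))
    intro y hy
    by_contra hny
    have := isPreconnected_closed_iff.1 isPreconnected_connectedComponentIn _ _ (classSet_closed e)
      (isClosed_cells _) hcov ⟨_, mem_connectedComponentIn hxC, e, .refl e, he.2, x, hx, rfl⟩
      ⟨y, hy, (hcov hy).resolve_left hny⟩
    obtain ⟨z, -, hz1, hz2⟩ := this
    exact hdisj z hz1 hz2
  · rintro y ⟨f, hf, hf', z, hz, rfl⟩
    rw [(edgeComponent_eq_of_rel hs hf).2 he]
    refine ⟨z, hz, mem_connectedComponentIn ⟨z, ⟨_, _, hf', hz⟩, rfl⟩⟩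

lemma edgeComponent_eq_iff (hs : SignAlternates d s) {e f : OctPoint d × OctPoint d}
    (he : K.Bicolored s e) (hf : K.Bicolored s f) :
    K.edgeComponent s e = K.edgeComponent s f ↔ CurveRel K.tris s e f := by
  constructor
  · intro h
    rw [component_eq_classSet hs he] at h
    obtain ⟨x, hx⟩ := cell_nonempty hf.1
    have : coverMap x ∈ K.edgeComponent s f :=
      ⟨x, hx, mem_connectedComponentIn ⟨x, ⟨_, _, hf.2, hx⟩, rfl⟩⟩
    rw [← h] at this
    obtain ⟨g, hg, hg', z, hz, hzx⟩ := this
    exact hg.trans (rel_of_cell_inter_neg hs hg' hf.2 hz hx hzx)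
  · intro h
    exact (edgeComponent_eq_of_rel hs h).2 he

end OctTriangulation

/-- The connected components of a set. -/
def componentsOf {X : Type*} [TopologicalSpace X] (C : Set X) : Set (Set X) :=
  {O | ∃ x ∈ C, O = connectedComponentIn C x}

lemma ncard_componentsOf_eq {X : Type*} [TopologicalSpace X] {C C' : Set X}
    (h : AmbientIsotopic C C') : (componentsOf C).ncard = (componentsOf C').ncard := by
  obtain ⟨H, -, hhom, rfl⟩ := h
  obtain ⟨φ, hφ⟩ := isHomeomorph_iff_exists_homeomorph.1 (hhom 1)
  have hφ' : (fun x => H (1, x)) = φ := hφ.symm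
  rw [hφ', ← Set.ncard_image_of_injective (componentsOf C) φ.injective.image_injective]
  congr 1
  ext O
  constructor
  · rintro ⟨_, ⟨x, hx, rfl⟩, rfl⟩
    exact ⟨φ x, ⟨x, hx, rfl⟩, φ.image_connectedComponentIn hx⟩
  · rintro ⟨_, ⟨x, hx, rfl⟩, rfl⟩
    exact ⟨_, ⟨x, hx, rfl⟩, φ.image_connectedComponentIn hx⟩

namespace OctTriangulation

variable {K K' : OctTriangulation d} {s : OctPoint d → ZMod 2}

lemma componentsOf_eq_range :
    componentsOf (coverMap '' K.curveLift s) = {O | ∃ e, K.Bicolored s e ∧ O = K.edgeComponent s e} := by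
  ext O
  constructor
  · rintro ⟨_, ⟨x, ⟨u, v, huv, hx⟩, rfl⟩, rfl⟩
    exact ⟨(u, v), ⟨tops_edge hx.1 hx.2 fun h => huv (congrArg s h), huv⟩,
      (edgeComponent_eq (e := (u, v)) huv hx).symm⟩
  · rintro ⟨e, he, rfl⟩
    obtain ⟨x, hx⟩ := cell_nonempty he.1
    exact ⟨_, ⟨x, ⟨_, _, he.2, hx⟩, rfl⟩, edgeComponent_eq he.2 hx⟩

lemma finite_componentsOf : (componentsOf (coverMap '' K.curveLift s)).Finite := by
  rw [componentsOf_eq_range]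
  refine (Set.finite_range fun e => K.edgeComponent s e).subset ?_
  rintro _ ⟨e, -, rfl⟩
  exact ⟨e, rfl⟩

/-- If the edges in `B` represent all components of both curves, and if the equivalence relation of
the second curve is strictly coarser on `B`, then the second curve has fewer components. -/
lemma ncard_components_lt (hs : SignAlternates d s) {B : Set (OctPoint d × OctPoint d)}
    (hB : ∀ e ∈ B, K.Bicolored s e) (hB' : ∀ e ∈ B, K'.Bicolored s e)
    (hK' : ∀ e, K'.Bicolored s e → ∃ f ∈ B, CurveRel K'.tris s e f)
    (himp : ∀ e ∈ B, ∀ f ∈ B, CurveRel K.tris s e f → CurveRel K'.tris s e f)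
    (hne : ∃ e ∈ B, ∃ f ∈ B, CurveRel K'.tris s e f ∧ ¬ CurveRel K.tris s e f) :
    (componentsOf (coverMap '' K'.curveLift s)).ncard
      < (componentsOf (coverMap '' K.curveLift s)).ncard := by
  classical
  obtain ⟨e₀, he₀, f₀, hf₀, hr, hnr⟩ := hne
  have : Nonempty (OctPoint d × OctPoint d) := ⟨e₀⟩
  -- choose a representative edge for each component of the second curve
  have hrep : ∀ O ∈ componentsOf (coverMap '' K'.curveLift s), ∃ e ∈ B, O = K'.edgeComponent s e := by
    intro O hO
    rw [componentsOf_eq_range] at hO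
    obtain ⟨e, he, rfl⟩ := hO
    obtain ⟨f, hf, hef⟩ := hK' e he
    exact ⟨f, hf, (edgeComponent_eq_iff hs he (hB' f hf)).2 hef⟩
  choose! rep hrepB hrepO using hrep
  set O₀ := K'.edgeComponent s e₀ with hO₀
  have hO₀mem : O₀ ∈ componentsOf (coverMap '' K'.curveLift s) := by
    rw [componentsOf_eq_range]; exact ⟨e₀, hB' _ he₀, rfl⟩
  have hrel : CurveRel K'.tris s e₀ (rep O₀) :=
    (edgeComponent_eq_iff hs (hB' _ he₀) (hB' _ (hrepB _ hO₀mem))).1 (hrepO _ hO₀mem)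
  -- one of `e₀`, `f₀` is missed by the representative of their common component
  obtain ⟨m, hm, hmr, hmn⟩ : ∃ m ∈ B, CurveRel K'.tris s m (rep O₀) ∧
      ¬ CurveRel K.tris s m (rep O₀) := by
    by_cases hc : CurveRel K.tris s e₀ (rep O₀)
    · exact ⟨f₀, hf₀, hr.symm.trans hrel, fun hf => hnr (hc.trans hf.symm)⟩
    · exact ⟨e₀, he₀, hrel, hc⟩
  have hinj : Set.InjOn (fun O => K.edgeComponent s (rep O))
      (componentsOf (coverMap '' K'.curveLift s)) := by
    intro O hO O' hO' h
    have := (edgeComponent_eq_iff hs (hB _ (hrepB O hO)) (hB _ (hrepB O' hO'))).1 h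
    rw [hrepO O hO, hrepO O' hO']
    exact (edgeComponent_eq_iff hs (hB' _ (hrepB O hO)) (hB' _ (hrepB O' hO'))).2
      (himp _ (hrepB O hO) _ (hrepB O' hO') this)
  rw [← hinj.ncard_image]
  refine Set.ncard_lt_ncard ⟨?_, fun hsub => ?_⟩ finite_componentsOf
  · rintro _ ⟨O, hO, rfl⟩
    rw [componentsOf_eq_range]
    exact ⟨_, hB _ (hrepB O hO), rfl⟩
  · have : K.edgeComponent s m ∈ componentsOf (coverMap '' K.curveLift s) := by
      rw [componentsOf_eq_range]; exact ⟨m, hB _ hm, rfl⟩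
    obtain ⟨O, hO, hOm⟩ := hsub this
    have h1 := (edgeComponent_eq_iff hs (hB _ (hrepB O hO)) (hB _ hm)).1 hOm
    have h2 := (himp _ (hrepB O hO) _ hm h1).trans hmr
    have h3 : O = O₀ := by
      rw [hrepO O hO, hrepO O₀ hO₀mem]
      exact (edgeComponent_eq_iff hs (hB' _ (hrepB O hO)) (hB' _ (hrepB _ hO₀mem))).2 h2
    rw [h3] at h1
    exact hmn h1.symm

end OctTriangulation

namespace OctTriangulation

variable {K : OctTriangulation d} {s : OctPoint d → ZMod 2}

/-! ### Walking along the curve -/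

/-- The bicolored edges, directed from sign `1` to sign `0`. They stand for the points where the
curve on the sphere crosses an edge, with the sign `1` on the same side in walking direction. -/
abbrev OutEdge (K : OctTriangulation d) (s : OctPoint d → ZMod 2) : Type :=
  {e : OctPoint d × OctPoint d // K.Edge e.1 e.2 ∧ s e.1 = 1 ∧ s e.2 = 0}

instance : Finite (OutEdge K s) := Subtype.finite

lemma OutEdge.bicolored (e : OutEdge K s) : K.Bicolored s e.1 :=
  ⟨e.2.1, by rw [e.2.2.1, e.2.2.2]; decide⟩

lemma zmod_two_cases (x : ZMod 2) : x = 0 ∨ x = 1 := by revert x; decide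

lemma exists_left (hd : 1 ≤ d) {u v : OctPoint d} (h : K.Edge u v) :
    ∃ w, {u, v, w} ∈ K.tris ∧ 0 < orient u v w := by
  obtain ⟨w, hw⟩ := h
  rcases lt_or_gt_of_ne (orient_ne_zero hd hw) with h | h
  · obtain ⟨w', hw', ho⟩ := apex_exists hd hw
    exact ⟨w', hw', by nlinarith⟩
  · exact ⟨w, hw, h⟩

lemma left_unique (hd : 1 ≤ d) {u v w w' : OctPoint d} (h : {u, v, w} ∈ K.tris)
    (ho : 0 < orient u v w) (h' : {u, v, w'} ∈ K.tris) (ho' : 0 < orient u v w') : w = w' :=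
  apex_unique hd h h' (mul_pos ho ho')

/-- The next crossing of the curve with an edge, on the left triangle of `e`. -/
def next (hd : 1 ≤ d) (e : OutEdge K s) : OutEdge K s :=
  if h : s (exists_left hd e.2.1).choose = 1 then
    ⟨((exists_left hd e.2.1).choose, e.1.2),
      ⟨_, tri_swap (tri_rotate (exists_left hd e.2.1).choose_spec.1)⟩,
      h, e.2.2.2⟩
  else
    ⟨(e.1.1, (exists_left hd e.2.1).choose),
      ⟨_, tri_swap' (exists_left hd e.2.1).choose_spec.1⟩,
      e.2.2.1, (zmod_two_cases _).resolve_right h⟩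

lemma next_of_one (hd : 1 ≤ d) (e : OutEdge K s) {w : OctPoint d} (h : {e.1.1, e.1.2, w} ∈ K.tris)
    (ho : 0 < orient e.1.1 e.1.2 w) (hw : s w = 1) : (next hd e).1 = (w, e.1.2) := by
  have hspec := (exists_left hd e.2.1).choose_spec
  have := left_unique hd hspec.1 hspec.2 h ho
  rw [next, dif_pos (by rw [this, hw])]
  simp only [this]

lemma next_of_zero (hd : 1 ≤ d) (e : OutEdge K s) {w : OctPoint d} (h : {e.1.1, e.1.2, w} ∈ K.tris)
    (ho : 0 < orient e.1.1 e.1.2 w) (hw : s w = 0) : (next hd e).1 = (e.1.1, w) := by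
  have hspec := (exists_left hd e.2.1).choose_spec
  have := left_unique hd hspec.1 hspec.2 h ho
  rw [next, dif_neg (by rw [this, hw]; decide)]
  simp only [this]

lemma next_cases (hd : 1 ≤ d) (e : OutEdge K s) : ∃ w, {e.1.1, e.1.2, w} ∈ K.tris ∧
    0 < orient e.1.1 e.1.2 w ∧ ((s w = 1 ∧ (next hd e).1 = (w, e.1.2)) ∨
      (s w = 0 ∧ (next hd e).1 = (e.1.1, w))) := by
  obtain ⟨w, hw, ho⟩ := exists_left hd e.2.1
  refine ⟨w, hw, ho, ?_⟩
  rcases zmod_two_cases (s w) with h | h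
  · exact Or.inr ⟨h, next_of_zero hd e hw ho h⟩
  · exact Or.inl ⟨h, next_of_one hd e hw ho h⟩

lemma next_injective (hd : 1 ≤ d) : Function.Injective (next (K := K) (s := s) hd) := by
  rintro ⟨⟨u, v⟩, he⟩ ⟨⟨u', v'⟩, he'⟩ h
  have h := congrArg Subtype.val h
  obtain ⟨w, hw, ho, hn⟩ := next_cases hd ⟨(u, v), he⟩
  obtain ⟨w', hw', ho', hn'⟩ := next_cases hd ⟨(u', v'), he'⟩
  have s1 : s u = 1 := he.2.1
  have s2 : s v = 0 := he.2.2
  have s1' : s u' = 1 := he'.2.1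
  have s2' : s v' = 0 := he'.2.2
  simp only at hw ho hw' ho' hn hn'
  apply Subtype.ext
  rcases hn with ⟨-, hn⟩ | ⟨-, hn⟩ <;> rcases hn' with ⟨-, hn'⟩ | ⟨-, hn'⟩ <;>
    rw [hn, hn', Prod.mk.injEq] at h
  · obtain ⟨rfl, rfl⟩ := h
    have := left_unique hd (tri_rotate hw) (by rw [orient_rotate]; exact ho) (tri_rotate hw')
      (by rw [orient_rotate]; exact ho')
    exact Prod.ext this rfl
  · obtain ⟨rfl, rfl⟩ := h
    have := left_unique hd (tri_rotate hw) (by rw [orient_rotate]; exact ho)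
      (tri_rotate (tri_rotate hw')) (by rw [orient_rotate, orient_rotate]; exact ho')
    rw [this, s2'] at s1
    exact absurd s1 (by decide)
  · obtain ⟨rfl, rfl⟩ := h
    have := left_unique hd (tri_rotate hw') (by rw [orient_rotate]; exact ho')
      (tri_rotate (tri_rotate hw)) (by rw [orient_rotate, orient_rotate]; exact ho)
    rw [this, s2] at s1'
    exact absurd s1' (by decide)
  · obtain ⟨rfl, rfl⟩ := h
    have := left_unique hd (tri_rotate (tri_rotate hw)) (by rw [orient_rotate, orient_rotate]; exact ho)
      (tri_rotate (tri_rotate hw')) (by rw [orient_rotate, orient_rotate]; exact ho')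
    exact Prod.ext rfl this

/-- Walking along the curve is a permutation of the crossings. -/
def walk (hd : 1 ≤ d) (K : OctTriangulation d) (s : OctPoint d → ZMod 2) :
    Equiv.Perm (OutEdge K s) :=
  Equiv.ofBijective (next hd) (Finite.injective_iff_bijective.1 (next_injective hd))

/-- A property of crossings as a property of undirected edges. -/
def onPairs (P : OutEdge K s → Prop) (p : OctPoint d × OctPoint d) : Prop :=
  ∃ e, P e ∧ (e.1 = p ∨ e.1 = p.swap)

lemma onPairs_swap {P : OutEdge K s → Prop} {u v : OctPoint d} :
    onPairs P (u, v) ↔ onPairs P (v, u) :=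
  ⟨fun ⟨e, he, h⟩ => ⟨e, he, h.symm⟩, fun ⟨e, he, h⟩ => ⟨e, he, h.symm⟩⟩

lemma onPairs_iff {P : OutEdge K s → Prop} (e : OutEdge K s) : onPairs P e.1 ↔ P e := by
  constructor
  · rintro ⟨e', he', h | h⟩
    · rwa [← Subtype.ext h]
    · have h1 := e'.2.2.1
      rw [h, Prod.fst_swap, e.2.2.2] at h1
      exact absurd h1 (by decide)
  · intro h
    exact ⟨e, h, Or.inl rfl⟩

lemma onPairs_ne {P : OutEdge K s → Prop} {u v : OctPoint d} (h : onPairs P (u, v)) :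
    s u ≠ s v := by
  obtain ⟨e, -, h | h⟩ := h
  · have h1 := e.bicolored.2
    rwa [h] at h1
  · have h1 := e.bicolored.2
    rw [h] at h1
    exact h1.symm

/-- A property of crossings which is preserved by walking through the triangles of `T` agrees on the
two bicolored edges of each triangle of `T`. -/
lemma onPairs_tri (hd : 1 ≤ d) {T : Set (Finset (OctPoint d))} (hT : T ⊆ K.tris)
    {P : OutEdge K s → Prop}
    (hP : ∀ (e : OutEdge K s) (w), {e.1.1, e.1.2, w} ∈ T → 0 < orient e.1.1 e.1.2 w →
      (P e ↔ P (next hd e))) {u v w : OctPoint d} (h : {u, v, w} ∈ T) (h1 : s u ≠ s v)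
    (h2 : s w ≠ s v) : onPairs P (u, v) ↔ onPairs P (w, v) := by
  have key : ∀ u v w : OctPoint d, {u, v, w} ∈ T → s u ≠ s v → s w ≠ s v →
      (s v = 0 ↔ 0 < orient u v w) → (onPairs P (u, v) ↔ onPairs P (w, v)) := by
    clear h h1 h2 u v w
    intro u v w h h1 h2 ho
    rcases zmod_two_cases (s v) with hv | hv
    · have ho := ho.1 hv
      have hu : s u = 1 := (zmod_two_cases _).resolve_left (hv ▸ h1)
      have hw : s w = 1 := (zmod_two_cases _).resolve_left (hv ▸ h2)
      set e : OutEdge K s := ⟨(u, v), ⟨_, hT h⟩, hu, hv⟩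
      have hn := next_of_one hd e (hT h) ho hw
      change onPairs P e.1 ↔ onPairs P (w, e.1.2)
      rw [← hn, onPairs_iff, onPairs_iff]
      exact hP e w h ho
    · have hu : s u = 0 := (zmod_two_cases _).resolve_right (hv ▸ h1)
      have hw : s w = 0 := (zmod_two_cases _).resolve_right (hv ▸ h2)
      have ho : 0 < orient v u w := by
        rw [orient_swap]
        have h0 := orient_ne_zero hd (hT h)
        have h1 : ¬ 0 < orient u v w := fun h' => by
          have := ho.2 h'
          rw [hv] at this
          exact absurd this (by decide)
        omega
      have h' : {v, u, w} ∈ T := by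
        have e : ({v, u, w} : Finset (OctPoint d)) = {u, v, w} := by ext; simp; tauto
        rwa [e]
      set e : OutEdge K s := ⟨(v, u), ⟨_, hT h'⟩, hv, hu⟩
      have hn := next_of_zero hd e (hT h') ho hw
      rw [onPairs_swap, onPairs_swap (u := w)]
      change onPairs P e.1 ↔ onPairs P (e.1.1, w)
      rw [← hn, onPairs_iff, onPairs_iff]
      exact hP e w h' ho
  by_cases hc : s v = 0 ↔ 0 < orient u v w
  · exact key u v w h h1 h2 hc
  · have h' : {w, v, u} ∈ T := by
      have e : ({w, v, u} : Finset (OctPoint d)) = {u, v, w} := by ext; simp; tauto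
      rwa [e]
    refine (key w v u h' h2 h1 ?_).symm
    have e : orient w v u = -orient u v w := by unfold orient; ring
    have h0 := orient_ne_zero hd (hT h)
    rw [e]
    by_cases hv : s v = 0
    · simp only [hv, true_iff] at hc ⊢; omega
    · simp only [hv, false_iff] at hc ⊢; omega

/-- A property of crossings which is preserved by walking through the triangles of `T`, up to
antipodes, is preserved by the moves through these triangles. -/
lemma onPairs_rel (hd : 1 ≤ d) (hs : SignAlternates d s) {T : Set (Finset (OctPoint d))}
    (hT : T ⊆ K.tris)
    (hneg : ∀ u v w : OctPoint d, {u, v, w} ∈ T → {-u, -v, -w} ∈ T) {P : OutEdge K s → Prop}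
    (hP : ∀ (e : OutEdge K s) (w), {e.1.1, e.1.2, w} ∈ T → 0 < orient e.1.1 e.1.2 w →
      (P e ↔ P (next hd e))) {e f : OctPoint d × OctPoint d} (h : CurveRel T s e f) :
    (onPairs P e ∨ onPairs P (-e.1, -e.2)) ↔ (onPairs P f ∨ onPairs P (-f.1, -f.2)) := by
  refine CurveRel.of_forall_link (r := fun e f =>
    (onPairs P e ∨ onPairs P (-e.1, -e.2)) ↔ (onPairs P f ∨ onPairs P (-f.1, -f.2)))
    ⟨fun _ => Iff.rfl, Iff.symm, Iff.trans⟩ ?_ h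
  rintro _ _ (⟨u, v⟩ | ⟨u, v⟩ | ⟨h, h1, h2⟩)
  · exact or_congr onPairs_swap onPairs_swap
  · simp only [neg_neg]; exact or_comm
  · exact or_congr (onPairs_tri hd hT hP h h1 h2)
      (onPairs_tri hd hT hP (hneg _ _ _ h) (hs.ne_neg.2 h1) (hs.ne_neg.2 h2))

/-- Walking through a triangle of `T` is a move. -/
lemma rel_next (hd : 1 ≤ d) {T : Set (Finset (OctPoint d))} (e : OutEdge K s)
    (hT : ∀ w, {e.1.1, e.1.2, w} ∈ K.tris → 0 < orient e.1.1 e.1.2 w → {e.1.1, e.1.2, w} ∈ T) :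
    CurveRel T s e.1 (next hd e).1 := by
  obtain ⟨w, hw, ho, hn⟩ := next_cases hd e
  have s1 := e.2.2.1
  have s2 := e.2.2.2
  have h := hT w hw ho
  rcases hn with ⟨hs, hn⟩ | ⟨hs, hn⟩
  · rw [hn]
    exact .of_link (.tri h (by rw [s1, s2]; decide) (by rw [hs, s2]; decide))
  · rw [hn]
    refine (CurveRel.swap _ _).trans (.trans ?_ (CurveRel.swap _ _))
    have e' : ({e.1.2, e.1.1, w} : Finset (OctPoint d)) = {e.1.1, e.1.2, w} := by
      ext; simp; tauto
    exact .of_link (.tri (e' ▸ h) (by rw [s1, s2]; decide) (by rw [hs, s1]; decide))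

/-! ### Antipodal crossings in even degree -/

lemma SignAlternates.neg_eq (hs : SignAlternates d s) (heven : Even d) (u : OctPoint d) :
    s (-u) = s u := by
  rw [hs, (ZMod.natCast_eq_zero_iff_even).2 heven, add_zero]

/-- The antipodal crossing; in even degree, it is passed in the opposite direction. -/
def antipode (hs : SignAlternates d s) (heven : Even d) (e : OutEdge K s) : OutEdge K s :=
  ⟨(-e.1.1, -e.1.2), e.2.1.neg, by rw [hs.neg_eq heven]; exact e.2.2.1,
    by rw [hs.neg_eq heven]; exact e.2.2.2⟩

lemma next_antipode_next (hd : 1 ≤ d) (hs : SignAlternates d s) (heven : Even d)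
    (e : OutEdge K s) : next hd (antipode hs heven (next hd e)) = antipode hs heven e := by
  obtain ⟨w, hw, ho, hn⟩ := next_cases hd e
  apply Subtype.ext
  set f := antipode hs heven (next hd e) with hf
  have hfv : f.1 = (-(next hd e).1.1, -(next hd e).1.2) := rfl
  rcases hn with ⟨hsw, hn⟩ | ⟨hsw, hn⟩
  · rw [hn] at hfv
    rw [next_of_one hd f (w := -e.1.1) ?_ ?_ (by rw [hs.neg_eq heven]; exact e.2.2.1), hfv]
    · rfl
    · rw [hfv]
      exact tri_neg (tri_swap (tri_rotate hw))
    · rw [hfv]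
      simp only
      rw [orient_neg]
      have : orient w e.1.2 e.1.1 = -orient e.1.1 e.1.2 w := by unfold orient; ring
      omega
  · rw [hn] at hfv
    rw [next_of_zero hd f (w := -e.1.2) ?_ ?_ (by rw [hs.neg_eq heven]; exact e.2.2.2), hfv]
    · rfl
    · rw [hfv]
      exact tri_neg (tri_swap' hw)
    · rw [hfv]
      simp only
      rw [orient_neg]
      have : orient e.1.1 w e.1.2 = -orient e.1.1 e.1.2 w := by unfold orient; ring
      omega

/-- In even degree, a walk along the curve does not lead to the antipode of its starting point:
otherwise, by symmetry, the middle of the walk would be its own antipode. -/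
lemma not_sameCycle_antipode (hd : 1 ≤ d) (hs : SignAlternates d s) (heven : Even d)
    (e : OutEdge K s) : ¬ (walk hd K s).SameCycle e (antipode hs heven e) := by
  set π := walk hd K s with hπ
  set ι := antipode (K := K) hs heven with hι
  have h1 : ∀ e, π (ι (π e)) = ι e := next_antipode_next hd hs heven
  -- the antipodal map reverses the walk
  have hn : ∀ (n : ℕ) e, ι ((π ^ n) e) = (π ^ n)⁻¹ (ι e) := by
    intro n
    induction n with
    | zero => intro e; rfl
    | succ n ih =>
      intro e
      have h2 : ι ((π ^ (n + 1)) e) = π⁻¹ (ι ((π ^ n) e)) := by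
        rw [Equiv.Perm.eq_inv_iff_eq, pow_succ', Equiv.Perm.mul_apply, h1]
      rw [h2, ih, pow_succ, mul_inv_rev, Equiv.Perm.mul_apply]
  rintro hsc
  obtain ⟨m, hm⟩ := hsc.exists_nat_pow_eq
  rcases Nat.even_or_odd' m with ⟨k, rfl | rfl⟩
  -- for a walk of even length, the crossing in the middle is its own antipode
  · have h3 : ι ((π ^ k) e) = (π ^ k) e := by
      rw [hn, ← hm, Equiv.Perm.inv_eq_iff_eq, ← Equiv.Perm.mul_apply, ← pow_add, two_mul]
    have := congrArg (fun f => f.1.1) h3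
    exact neg_ne_self hd _ this
  -- for a walk of odd length, two consecutive crossings are antipodal; but they share a vertex
  · have h3 : ι ((π ^ k) e) = π ((π ^ k) e) := by
      rw [hn, ← hm, Equiv.Perm.inv_eq_iff_eq, ← Equiv.Perm.mul_apply, ← Equiv.Perm.mul_apply,
        ← pow_succ, ← pow_add]
      congr 2
      ring
    set f := (π ^ k) e
    obtain ⟨w, -, -, hc⟩ := next_cases hd f
    have h4 : (next hd f).1 = (-f.1.1, -f.1.2) := (congrArg Subtype.val h3).symm
    rcases hc with ⟨-, hc⟩ | ⟨-, hc⟩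
    · rw [hc] at h4
      exact neg_ne_self hd _ (congrArg Prod.snd h4).symm
    · rw [hc] at h4
      exact neg_ne_self hd _ (congrArg Prod.fst h4).symm

/-! ### Monochromatic paths -/

/-- The points `u` and `v` are joined by a path of edges with ends of equal sign. -/
def MonoPath (K : OctTriangulation d) (s : OctPoint d → ZMod 2) : OctPoint d → OctPoint d → Prop :=
  Relation.ReflTransGen fun u v => K.Edge u v ∧ s u = s v

end OctTriangulation

namespace OctTriangulation

variable {K K' : OctTriangulation d} {s : OctPoint d → ZMod 2} {A B C E : OctPoint d}

/-! ### The curve outside of a parallelogram -/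

/-- The triangles that belong neither to the parallelogram with diagonal `AC` nor to its
antipode. -/
def outer (K : OctTriangulation d) (A C : OctPoint d) : Set (Finset (OctPoint d)) :=
  {S | S ∈ K.tris ∧ ¬ (A ∈ S ∧ C ∈ S) ∧ ¬ (-A ∈ S ∧ -C ∈ S)}

lemma outer_subset : K.outer A C ⊆ K.tris := fun _ h => h.1

lemma outer_neg {u v w : OctPoint d} (h : {u, v, w} ∈ K.outer A C) :
    {-u, -v, -w} ∈ K.outer A C := by
  have key : ∀ x : OctPoint d, x ∈ ({-u, -v, -w} : Finset (OctPoint d)) ↔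
      -x ∈ ({u, v, w} : Finset (OctPoint d)) := by
    intro x
    simp only [Finset.mem_insert, Finset.mem_singleton, neg_eq_iff_eq_neg]
  obtain ⟨h1, h2, h3⟩ := h
  refine ⟨tri_neg h1, ?_, ?_⟩
  · rwa [key, key]
  · rwa [key, key, neg_neg, neg_neg]

lemma outer_comm : K.outer A C = K.outer C A := by
  ext S
  simp only [outer, Set.mem_ofPred_eq, and_comm (a := A ∈ S), and_comm (a := -A ∈ S)]

/-- `ABCE` is a parallelogram formed by the two triangles at the edge `AC`; the ends of the edge
have one sign and the other two corners have the other sign. -/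
structure IsBadQuad (K : OctTriangulation d) (s : OctPoint d → ZMod 2) (A B C E : OctPoint d) :
    Prop where
  tri_b : {A, C, B} ∈ K.tris
  tri_e : {A, C, E} ∈ K.tris
  apex : ∀ w, {A, C, w} ∈ K.tris → w = B ∨ w = E
  sign_c : s C = s A
  sign_e : s E = s B
  sign_ne : s A ≠ s B

lemma IsQuad.isBadQuad (hd : 1 ≤ d) {a b c e : OctPoint d} (h : K.IsQuad a b c e)
    {g : Fin 3 → ℤˣ} (h1 : s (octReflect g c) = s (octReflect g a))
    (h2 : s (octReflect g e) = s (octReflect g b)) (h3 : s (octReflect g a) ≠ s (octReflect g b)) :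
    K.IsBadQuad s (octReflect g a) (octReflect g b) (octReflect g c) (octReflect g e) :=
  ⟨tri_reflect g (tri_swap' h.tri_abc), tri_reflect g h.tri_ace,
    fun _ => h.tri_at_diagonal hd, h1, h2, h3⟩

/-- The two bicolored edges of a triangle of the parallelogram or of its antipode. -/
lemma IsBadQuad.link_cases (h : K.IsBadQuad s A B C E) (hs : SignAlternates d s)
    {u v w : OctPoint d} (ht : {u, v, w} ∈ K.tris) (hn : {u, v, w} ∉ K.outer A C)
    (h1 : s u ≠ s v) (h2 : s w ≠ s v) :
    ((v = B ∨ v = E) ∧ ((u = A ∧ w = C) ∨ (u = C ∧ w = A))) ∨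
    ((-v = B ∨ -v = E) ∧ ((-u = A ∧ -w = C) ∨ (-u = C ∧ -w = A))) := by
  have key : ∀ u v w : OctPoint d, {u, v, w} ∈ K.tris →
      (A ∈ ({u, v, w} : Finset (OctPoint d)) ∧ C ∈ ({u, v, w} : Finset (OctPoint d))) →
      s u ≠ s v → s w ≠ s v →
      (v = B ∨ v = E) ∧ ((u = A ∧ w = C) ∨ (u = C ∧ w = A)) := by
    intro u v w ht hm h1 h2
    have nAC : A ≠ C := (tri_ne h.tri_b).1
    obtain ⟨x, hx⟩ := tri_of_mem ht hm.1 hm.2 nAC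
    obtain ⟨n1, n2, n3⟩ := tri_ne ht
    have hx' := h.apex x (hx ▸ ht)
    have hsx : s x = s B := by
      rcases hx' with rfl | rfl
      · rfl
      · exact h.sign_e
    have hc := h.sign_c
    have hne := h.sign_ne
    rcases triple_eq n1 n2 n3 hx with ⟨rfl, rfl, rfl⟩ | ⟨rfl, rfl, rfl⟩ | ⟨rfl, rfl, rfl⟩ |
      ⟨rfl, rfl, rfl⟩ | ⟨rfl, rfl, rfl⟩ | ⟨rfl, rfl, rfl⟩
    · exact absurd hc.symm h1
    · exact ⟨hx', Or.inl ⟨rfl, rfl⟩⟩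
    · exact absurd hc h1
    · exact ⟨hx', Or.inr ⟨rfl, rfl⟩⟩
    · exact absurd hc h2
    · exact absurd hc.symm h2
  by_cases hm : A ∈ ({u, v, w} : Finset (OctPoint d)) ∧ C ∈ ({u, v, w} : Finset (OctPoint d))
  · exact Or.inl (key u v w ht hm h1 h2)
  · refine Or.inr (key (-u) (-v) (-w) (tri_neg ht) ?_ (hs.ne_neg.2 h1) (hs.ne_neg.2 h2))
    by_contra hcon
    refine hn ⟨ht, hm, fun hm' => hcon ?_⟩
    simpa only [Finset.mem_insert, Finset.mem_singleton, neg_eq_iff_eq_neg, eq_comm (a := A),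
      eq_comm (a := C)] using hm'

/-- A class of the curve outside of the parallelogram, which is saturated with respect to the two
segments inside, is a class of the whole curve. -/
lemma IsBadQuad.rel_iff (h : K.IsBadQuad s A B C E) (hs : SignAlternates d s)
    {x : OctPoint d × OctPoint d}
    (hB : CurveRel (K.outer A C) s x (A, B) ↔ CurveRel (K.outer A C) s x (C, B))
    (hE : CurveRel (K.outer A C) s x (A, E) ↔ CurveRel (K.outer A C) s x (C, E))
    {p q : OctPoint d × OctPoint d} (hpq : CurveRel K.tris s p q) :
    CurveRel (K.outer A C) s x p ↔ CurveRel (K.outer A C) s x q := by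
  refine CurveRel.of_forall_link (r := fun p q => CurveRel (K.outer A C) s x p ↔
    CurveRel (K.outer A C) s x q) ⟨fun _ => Iff.rfl, Iff.symm, Iff.trans⟩ ?_ hpq
  have neg_iff : ∀ u v : OctPoint d, CurveRel (K.outer A C) s x (u, v) ↔
      CurveRel (K.outer A C) s x (-u, -v) :=
    fun u v => ⟨fun h => h.trans (.neg _ _), fun h => h.trans (CurveRel.neg u v).symm⟩
  rintro _ _ (⟨u, v⟩ | ⟨u, v⟩ | @⟨u, v, w, ht, h1, h2⟩)
  · exact ⟨fun h => h.trans (.swap _ _), fun h => h.trans (.swap _ _)⟩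
  · exact neg_iff u v
  · by_cases ho : {u, v, w} ∈ K.outer A C
    · have := CurveRel.of_link (CurveLink.tri ho h1 h2)
      exact ⟨fun h => h.trans this, fun h => h.trans this.symm⟩
    · rcases h.link_cases hs ht ho h1 h2 with ⟨rfl | rfl, ⟨rfl, rfl⟩ | ⟨rfl, rfl⟩⟩ |
        ⟨hv, ⟨hu, hw⟩ | ⟨hu, hw⟩⟩
      · exact hB
      · exact hB.symm
      · exact hE
      · exact hE.symm
      · rw [neg_iff u v, neg_iff w v, hu, hw]
        rcases hv with hv | hv <;> rw [hv]
        · exact hB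
        · exact hE
      · rw [neg_iff u v, neg_iff w v, hu, hw]
        rcases hv with hv | hv <;> rw [hv]
        · exact hB.symm
        · exact hE.symm

/-! ### The strand of the curve that leaves a parallelogram -/

/-- The parallelogram with corners `A`, `B`, `C`, `E` is disjoint from its antipode, as far as the
corners matter for the walk along the curve. -/
structure IsSeparated (A B C E : OctPoint d) : Prop where
  aa : -A ≠ A
  ac : -A ≠ C
  ae : -A ≠ E
  bc : -B ≠ C
  cc : -C ≠ C
  ce : -C ≠ E

/-- The crossings where a walk enters the parallelogram or its antipode, and the crossings where it
leaves again. -/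
lemma IsBadQuad.entry_cases (hd : 1 ≤ d) (h : K.IsBadQuad s A B C E) (hs : SignAlternates d s)
    (hA : s A = 1) (hB : s B = 0) (hoB : orient A C B < 0) (hoE : 0 < orient A C E)
    (e : OutEdge K s) {w : OctPoint d} (hw : {e.1.1, e.1.2, w} ∈ K.tris)
    (ho : 0 < orient e.1.1 e.1.2 w) (hn : {e.1.1, e.1.2, w} ∉ K.outer A C) :
    (e.1 = (A, B) ∧ (next hd e).1 = (C, B)) ∨ (e.1 = (C, E) ∧ (next hd e).1 = (A, E)) ∨
    (Even d ∧ ((e.1 = (-C, -B) ∧ (next hd e).1 = (-A, -B)) ∨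
      (e.1 = (-A, -E) ∧ (next hd e).1 = (-C, -E)))) ∨
    (¬ Even d ∧ ((e.1 = (-B, -A) ∧ (next hd e).1 = (-B, -C)) ∨
      (e.1 = (-E, -C) ∧ (next hd e).1 = (-E, -A)))) := by
  obtain ⟨⟨u, v⟩, huv, hu, hv⟩ := e
  simp only at hw ho hn hu hv huv
  have hC : s C = 1 := h.sign_c.trans hA
  have hE : s E = 0 := h.sign_e.trans hB
  have r1 : ∀ x y z : OctPoint d, orient (-x) (-y) (-z) = -orient x y z := orient_neg
  have r2 : ∀ x y z : OctPoint d, orient x z y = -orient x y z := by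
    intro x y z; unfold orient; ring
  have odd_sign : ¬ Even d → ∀ x, s (-x) = s x + 1 := by
    intro hodd x
    rw [hs, (ZMod.natCast_eq_one_iff_odd).2 (Nat.not_even_iff_odd.1 hodd)]
  rcases zmod_two_cases (s w) with hsw | hsw
  · -- the bicolored edges meet in `u`
    have hnext := next_of_zero hd ⟨(u, v), huv, hu, hv⟩ hw ho hsw
    rw [hnext]
    have e3 : ({v, u, w} : Finset (OctPoint d)) = {u, v, w} := by ext; simp; tauto
    rcases h.link_cases hs (u := v) (v := u) (w := w) (tri_swap hw) (e3 ▸ hn)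
      (by rw [hu, hv]; decide) (by rw [hu, hsw]; decide) with
      ⟨rfl | rfl, -⟩ | ⟨hu', hvw⟩
    · rw [hB] at hu; exact absurd hu (by decide)
    · rw [hE] at hu; exact absurd hu (by decide)
    · have hodd : ¬ Even d := by
        intro hev
        have := hs.neg_eq hev u
        rcases hu' with hu' | hu' <;> rw [hu', hu] at this
        · rw [hB] at this; exact absurd this (by decide)
        · rw [hE] at this; exact absurd this (by decide)
      have eu : u = - -u := (neg_neg u).symm
      have ev : v = - -v := (neg_neg v).symm
      have ew : w = - -w := (neg_neg w).symm
      refine Or.inr (Or.inr (Or.inr ⟨hodd, ?_⟩))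
      rw [eu, ev, ew, r1] at ho
      rcases hu' with hu' | hu' <;> rcases hvw with ⟨hv', hw'⟩ | ⟨hv', hw'⟩ <;>
        rw [hu', hv', hw'] at ho
      · left
        change (u, v) = _ ∧ (u, w) = _
        rw [← hu', ← hv', ← hw', neg_neg, neg_neg, neg_neg]
        exact ⟨rfl, rfl⟩
      · have : orient B C A = -orient A C B := by unfold orient; ring
        omega
      · have : orient E A C = orient A C E := by unfold orient; ring
        omega
      · right
        change (u, v) = _ ∧ (u, w) = _
        rw [← hu', ← hv', ← hw', neg_neg, neg_neg, neg_neg]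
        exact ⟨rfl, rfl⟩
  · have hnext := next_of_one hd ⟨(u, v), huv, hu, hv⟩ hw ho hsw
    rw [hnext]
    rcases h.link_cases hs hw hn (by rw [hu, hv]; decide) (by rw [hv, hsw]; decide) with
      ⟨rfl | rfl, ⟨rfl, rfl⟩ | ⟨rfl, rfl⟩⟩ | ⟨hv', huw⟩
    · exact Or.inl ⟨rfl, rfl⟩
    · have : orient u v w = orient w u v := by unfold orient; ring
      omega
    · have : orient u v w = - orient u w v := r2 _ _ _
      omega
    · exact Or.inr (Or.inl ⟨rfl, rfl⟩)
    · have hev : Even d := by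
        by_contra hodd
        have := odd_sign hodd v
        rcases hv' with hv' | hv' <;> rw [hv', hv] at this
        · rw [hB] at this; exact absurd this (by decide)
        · rw [hE] at this; exact absurd this (by decide)
      have eu : u = - -u := (neg_neg u).symm
      have ev : v = - -v := (neg_neg v).symm
      have ew : w = - -w := (neg_neg w).symm
      refine Or.inr (Or.inr (Or.inl ⟨hev, ?_⟩))
      rw [eu, ev, ew, r1] at ho
      rcases hv' with hv' | hv' <;> rcases huw with ⟨hu', hw'⟩ | ⟨hu', hw'⟩ <;>
        rw [hu', hv', hw'] at ho
      · have : orient A B C = - orient A C B := r2 _ _ _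
        omega
      · left
        change (u, v) = _ ∧ (w, v) = _
        rw [← hu', ← hv', ← hw', neg_neg, neg_neg, neg_neg]
        exact ⟨rfl, rfl⟩
      · right
        change (u, v) = _ ∧ (w, v) = _
        rw [← hu', ← hv', ← hw', neg_neg, neg_neg, neg_neg]
        exact ⟨rfl, rfl⟩
      · have : orient C E A = orient A C E := by unfold orient; ring
        omega

end OctTriangulation

namespace OctTriangulation

variable {K K' : OctTriangulation d} {s : OctPoint d → ZMod 2} {A B C E : OctPoint d}

/-- The points `u` and `v` are joined by a path along one side of the curve: it consists of edges of
triangles of `T` whose third vertex has the other sign. -/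
def SidePath (T : Set (Finset (OctPoint d))) (s : OctPoint d → ZMod 2) :
    OctPoint d → OctPoint d → Prop :=
  Relation.ReflTransGen fun u v => ∃ w, {u, v, w} ∈ T ∧ s u = s v ∧ s w ≠ s u

lemma sidePath_next (hd : 1 ≤ d) {T : Set (Finset (OctPoint d))} (e : OutEdge K s)
    (hT : ∀ w, {e.1.1, e.1.2, w} ∈ K.tris → 0 < orient e.1.1 e.1.2 w → {e.1.1, e.1.2, w} ∈ T) :
    SidePath T s e.1.1 (next hd e).1.1 ∧ SidePath T s e.1.2 (next hd e).1.2 := by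
  obtain ⟨w, hw, ho, hn⟩ := next_cases hd e
  have s1 := e.2.2.1
  have s2 := e.2.2.2
  have h := hT w hw ho
  rcases hn with ⟨hs, hn⟩ | ⟨hs, hn⟩
  · rw [hn]
    refine ⟨.single ⟨e.1.2, ?_, by rw [hs, s1], by rw [s1, s2]; decide⟩, .refl⟩
    have e' : ({e.1.1, w, e.1.2} : Finset (OctPoint d)) = {e.1.1, e.1.2, w} := by
      ext; simp; tauto
    rwa [e']
  · rw [hn]
    refine ⟨.refl, .single ⟨e.1.1, ?_, by rw [hs, s2], by rw [s1, s2]; decide⟩⟩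
    have e' : ({e.1.2, w, e.1.1} : Finset (OctPoint d)) = {e.1.1, e.1.2, w} := by
      ext; simp; tauto
    rwa [e']

/-- The strand of the curve that leaves the parallelogram at the side `CB` ends when it first meets
the parallelogram or its antipode. Up to the antipodal map, it either ends at `AB` or at `CE`, and
then meets no other side, or the degree is even and it ends at the antipode of `AE`; then it is
accompanied on both sides by monochromatic paths. -/
lemma IsBadQuad.strand (hd : 1 ≤ d) (h : K.IsBadQuad s A B C E) (hs : SignAlternates d s)
    (hA : s A = 1) (hB : s B = 0) (hoB : orient A C B < 0) (hoE : 0 < orient A C E)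
    (hsep : IsSeparated A B C E) :
    (CurveRel (K.outer A C) s (C, B) (A, B) ∧ ¬ CurveRel (K.outer A C) s (C, B) (C, E) ∧
      ¬ CurveRel (K.outer A C) s (C, B) (A, E)) ∨
    (CurveRel (K.outer A C) s (C, B) (C, E) ∧ ¬ CurveRel (K.outer A C) s (C, B) (A, B) ∧
      ¬ CurveRel (K.outer A C) s (C, B) (A, E)) ∨
    (Even d ∧ SidePath (K.outer A C) s C (-A) ∧ SidePath (K.outer A C) s B (-E)) := by
  have hC : s C = 1 := h.sign_c.trans hA
  have hE : s E = 0 := h.sign_e.trans hB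
  have nAC : A ≠ C := (tri_ne h.tri_b).1
  set T := K.outer A C with hT
  set π := walk hd K s with hπ
  -- the directed sides of the parallelogram
  set x0 : OutEdge K s := ⟨(C, B), ⟨A, tri_rotate h.tri_b⟩, hC, hB⟩ with hx0
  set ab : OutEdge K s := ⟨(A, B), ⟨C, tri_swap' h.tri_b⟩, hA, hB⟩ with hab
  set ce : OutEdge K s := ⟨(C, E), ⟨A, tri_rotate h.tri_e⟩, hC, hE⟩ with hce
  set ae : OutEdge K s := ⟨(A, E), ⟨C, tri_swap' h.tri_e⟩, hA, hE⟩ with hae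
  -- the crossings after which the walk enters the parallelogram or its antipode
  set Entry : OutEdge K s → Prop := fun e =>
    ∃ w, {e.1.1, e.1.2, w} ∈ K.tris ∧ 0 < orient e.1.1 e.1.2 w ∧ {e.1.1, e.1.2, w} ∉ T with hEntry
  have mkEntry : ∀ (e : OutEdge K s) (w), {e.1.1, e.1.2, w} ∈ K.tris →
      0 < orient e.1.1 e.1.2 w →
      ((A ∈ ({e.1.1, e.1.2, w} : Finset (OctPoint d)) ∧
        C ∈ ({e.1.1, e.1.2, w} : Finset (OctPoint d))) ∨
      (-A ∈ ({e.1.1, e.1.2, w} : Finset (OctPoint d)) ∧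
        -C ∈ ({e.1.1, e.1.2, w} : Finset (OctPoint d)))) → Entry e := by
    intro e w h1 h2 h3
    refine ⟨w, h1, h2, fun h4 => ?_⟩
    rcases h3 with h3 | h3
    · exact h4.2.1 h3
    · exact h4.2.2 h3
  have oABC : 0 < orient A B C := by
    have : orient A B C = -orient A C B := by unfold orient; ring
    omega
  have oCEA : 0 < orient C E A := by
    have : orient C E A = orient A C E := by unfold orient; ring
    omega
  have entry_ab : Entry ab := mkEntry ab C (tri_swap' h.tri_b) oABC (Or.inl ⟨by simp [ab], by simp⟩)
  have entry_ce : Entry ce := mkEntry ce A (tri_rotate h.tri_e) oCEA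
    (Or.inl ⟨by simp, by simp [ce]⟩)
  have next_ab : next hd ab = x0 := Subtype.ext (next_of_one hd ab (tri_swap' h.tri_b) oABC hC)
  have next_ce : next hd ce = ae := Subtype.ext (next_of_one hd ce (tri_rotate h.tri_e) oCEA hA)
  -- the walk that starts at `CB` returns there through the parallelogram, after the crossing `AB`
  have hex : ∃ n : ℕ, Entry ((π ^ n) x0) := by
    refine ⟨orderOf π - 1, ?_⟩
    have : (π ^ (orderOf π - 1)) x0 = ab := by
      apply π.injective
      rw [← Equiv.Perm.mul_apply, ← pow_succ', Nat.sub_add_cancel (orderOf_pos π),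
        pow_orderOf_eq_one]
      exact next_ab.symm
    rw [this]
    exact entry_ab
  classical
  obtain ⟨n, hn, hmin⟩ : ∃ n, Entry ((π ^ n) x0) ∧ ∀ m < n, ¬ Entry ((π ^ m) x0) :=
    ⟨Nat.find hex, Nat.find_spec hex, fun m hm => Nat.find_min hex hm⟩
  set z := (π ^ n) x0 with hz
  -- the crossings of the strand; they are invariant under walking outside of the parallelogram
  set P : OutEdge K s → Prop := fun e => ∃ i ≤ n, e = (π ^ i) x0 with hPdef
  have pow_next : ∀ i, (π ^ (i + 1)) x0 = next hd ((π ^ i) x0) := by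
    intro i
    rw [pow_succ', Equiv.Perm.mul_apply]
    rfl
  have hP : ∀ (e : OutEdge K s) (w), {e.1.1, e.1.2, w} ∈ T → 0 < orient e.1.1 e.1.2 w →
      (P e ↔ P (next hd e)) := by
    intro e w hw ho
    have hne : ¬ Entry e := by
      rintro ⟨w', h1, h2, h3⟩
      rw [left_unique hd h1 h2 hw.1 ho] at h3
      exact h3 hw
    constructor
    · rintro ⟨i, hi, rfl⟩
      refine ⟨i + 1, ?_, (pow_next i).symm⟩
      by_contra hc
      have : i = n := by omega
      rw [this] at hne
      exact hne hn
    · rintro ⟨i, hi, hie⟩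
      rcases i with _ | i
      · have : e = ab := next_injective hd (hie.trans next_ab.symm)
        rw [this] at hne
        exact absurd entry_ab hne
      · rw [pow_next] at hie
        exact ⟨i, by omega, next_injective hd hie⟩
  -- the strand has just one entry, its end, and just one exit, its start
  have hEnt : ∀ e, P e → Entry e → e = z := by
    rintro e ⟨i, hi, rfl⟩ he
    by_contra hc
    have : i ≠ n := by rintro rfl; exact hc rfl
    exact hmin i (by omega) he
  have hExit : ∀ e, Entry e → P (next hd e) → next hd e = x0 := by
    rintro e he ⟨i, hi, hie⟩
    rcases i with _ | i
    · exact hie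
    · rw [pow_next] at hie
      rw [next_injective hd hie] at he
      exact absurd he (hmin i (by omega))
  have step : ∀ i, i < n → ∀ w, {((π ^ i) x0).1.1, ((π ^ i) x0).1.2, w} ∈ K.tris →
      0 < orient ((π ^ i) x0).1.1 ((π ^ i) x0).1.2 w →
      {((π ^ i) x0).1.1, ((π ^ i) x0).1.2, w} ∈ T := by
    intro i hi w h1 h2
    by_contra h3
    exact hmin i hi ⟨w, h1, h2, h3⟩
  have reach : ∀ i, i ≤ n → CurveRel T s (C, B) ((π ^ i) x0).1 ∧
      SidePath T s C ((π ^ i) x0).1.1 ∧ SidePath T s B ((π ^ i) x0).1.2 := by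
    intro i
    induction i with
    | zero => intro _; exact ⟨.refl _, .refl, .refl⟩
    | succ i ih =>
      intro hi
      obtain ⟨h1, h2, h3⟩ := ih (by omega)
      rw [pow_next]
      have h4 := step i (by omega)
      obtain ⟨h5, h6⟩ := sidePath_next hd _ h4
      exact ⟨h1.trans (rel_next hd _ h4), h2.trans h5, h3.trans h6⟩
  have class_sub : ∀ u v, CurveRel T s (C, B) (u, v) → onPairs P (u, v) ∨ onPairs P (-u, -v) :=
    fun u v huv => (onPairs_rel hd hs outer_subset (fun _ _ _ => outer_neg) hP huv).1
      (Or.inl ((onPairs_iff x0).2 ⟨0, by omega, rfl⟩))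
  have x0_ne : ∀ e : OutEdge K s, e.1.1 ≠ C → e ≠ x0 := by
    rintro e h1 rfl; exact h1 rfl
  have odd_sign : ¬ Even d → ∀ x, s (-x) = s x + 1 := by
    intro hodd x
    rw [hs, (ZMod.natCast_eq_one_iff_odd).2 (Nat.not_even_iff_odd.1 hodd)]
  -- the sides of the parallelogram and of its antipode which the strand meets
  have hAE : onPairs P (A, E) ∨ onPairs P (-A, -E) → Even d ∧ z.1 = (-A, -E) := by
    rintro (hp | hp)
    · have := (onPairs_iff ae).1 hp
      rw [← next_ce] at this
      have := hExit ce entry_ce this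
      rw [next_ce] at this
      exact absurd this (x0_ne ae nAC)
    · by_cases hev : Even d
      · have h1 := (onPairs_iff (antipode hs hev ae)).1 hp
        refine ⟨hev, ?_⟩
        rw [← hEnt _ h1 (mkEntry _ (-C) (tri_neg (tri_swap' h.tri_e)) ?_ (Or.inr ?_))]
        · rfl
        · change 0 < orient (-A) (-E) (-C)
          rw [orient_neg]
          have : orient A E C = -orient A C E := by unfold orient; ring
          omega
        · exact ⟨by simp [antipode, ae], by simp⟩
      · have sC : s (-C) = 0 := by rw [odd_sign hev, hC]; decide
        have sA : s (-A) = 0 := by rw [odd_sign hev, hA]; decide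
        have sE : s (-E) = 1 := by rw [odd_sign hev, hE]; decide
        have t : {-E, -C, -A} ∈ K.tris := tri_neg (tri_swap (tri_rotate h.tri_e))
        set ec : OutEdge K s := ⟨(-E, -C), ⟨-A, t⟩, sE, sC⟩ with hec
        set ea : OutEdge K s := ⟨(-E, -A), ⟨-C, tri_swap' t⟩, sE, sA⟩ with hea
        have o : 0 < orient (-E) (-C) (-A) := by
          rw [orient_neg]
          have : orient E C A = -orient A C E := by unfold orient; ring
          omega
        have h1 : next hd ec = ea := Subtype.ext (next_of_zero hd ec t o sA)
        have h2 := (onPairs_iff ea).1 (onPairs_swap.1 hp)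
        rw [← h1] at h2
        have h3 := hExit ec (mkEntry ec (-A) t o (Or.inr ⟨by simp, by simp [ec]⟩)) h2
        rw [h1] at h3
        exact absurd h3 (x0_ne ea fun h4 => hsep.ce (by rw [← h4, neg_neg]))
  have hAB : onPairs P (A, B) ∨ onPairs P (-A, -B) → z.1 = (A, B) ∨ z.1 = (-B, -A) := by
    rintro (hp | hp)
    · left
      rw [← hEnt _ ((onPairs_iff ab).1 hp) entry_ab]
    · by_cases hev : Even d
      · have t : {-C, -B, -A} ∈ K.tris := tri_neg (tri_rotate h.tri_b)
        have o : 0 < orient (-C) (-B) (-A) := by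
          rw [orient_neg]
          have : orient C B A = orient A C B := by unfold orient; ring
          omega
        have h1 : next hd (antipode hs hev x0) = antipode hs hev ab :=
          Subtype.ext (next_of_one hd (antipode hs hev x0) t o (by rw [hs.neg_eq hev, hA]))
        have h2 := (onPairs_iff (antipode hs hev ab)).1 hp
        rw [← h1] at h2
        have h3 := hExit (antipode hs hev x0) (mkEntry _ (-A) t o
          (Or.inr ⟨by simp, by simp [antipode, x0]⟩)) h2
        rw [h1] at h3
        exact absurd h3 (x0_ne _ hsep.ac)
      · right
        have sA : s (-A) = 0 := by rw [odd_sign hev, hA]; decide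
        have sB : s (-B) = 1 := by rw [odd_sign hev, hB]; decide
        have t : {-B, -A, -C} ∈ K.tris := tri_neg (tri_rotate (tri_rotate h.tri_b))
        set ba : OutEdge K s := ⟨(-B, -A), ⟨-C, t⟩, sB, sA⟩ with hba
        have o : 0 < orient (-B) (-A) (-C) := by
          rw [orient_neg]
          have : orient B A C = orient A C B := by unfold orient; ring
          omega
        rw [← hEnt _ ((onPairs_iff ba).1 (onPairs_swap.1 hp))
          (mkEntry ba (-C) t o (Or.inr ⟨by simp [ba], by simp⟩))]
  have hCE : onPairs P (C, E) ∨ onPairs P (-C, -E) → z.1 = (C, E) ∨ z.1 = (-E, -C) := by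
    rintro (hp | hp)
    · left
      rw [← hEnt _ ((onPairs_iff ce).1 hp) entry_ce]
    · by_cases hev : Even d
      · have t : {-A, -E, -C} ∈ K.tris := tri_neg (tri_swap' h.tri_e)
        have o : 0 < orient (-A) (-E) (-C) := by
          rw [orient_neg]
          have : orient A E C = -orient A C E := by unfold orient; ring
          omega
        have h1 : next hd (antipode hs hev ae) = antipode hs hev ce :=
          Subtype.ext (next_of_one hd (antipode hs hev ae) t o (by rw [hs.neg_eq hev, hC]))
        have h2 := (onPairs_iff (antipode hs hev ce)).1 hp
        rw [← h1] at h2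
        have h3 := hExit (antipode hs hev ae) (mkEntry _ (-C) t o
          (Or.inr ⟨by simp [antipode, ae], by simp⟩)) h2
        rw [h1] at h3
        exact absurd h3 (x0_ne _ hsep.cc)
      · right
        have sC : s (-C) = 0 := by rw [odd_sign hev, hC]; decide
        have sE : s (-E) = 1 := by rw [odd_sign hev, hE]; decide
        have t : {-E, -C, -A} ∈ K.tris := tri_neg (tri_swap (tri_rotate h.tri_e))
        set ec : OutEdge K s := ⟨(-E, -C), ⟨-A, t⟩, sE, sC⟩ with hec
        have o : 0 < orient (-E) (-C) (-A) := by
          rw [orient_neg]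
          have : orient E C A = -orient A C E := by unfold orient; ring
          omega
        rw [← hEnt _ ((onPairs_iff ec).1 (onPairs_swap.1 hp))
          (mkEntry ec (-A) t o (Or.inr ⟨by simp, by simp [ec]⟩))]
  -- the possible ends of the strand
  obtain ⟨rz, c1, c2⟩ := reach n le_rfl
  rw [← hz] at rz c1 c2
  obtain ⟨w, hw, ho, hnw⟩ := hn
  rcases h.entry_cases hd hs hA hB hoB hoE z hw ho hnw with ⟨hz1, -⟩ | ⟨hz1, -⟩ |
    ⟨hev, ⟨hz1, -⟩ | ⟨hz1, -⟩⟩ | ⟨hodd, ⟨hz1, -⟩ | ⟨hz1, -⟩⟩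
  · refine Or.inl ⟨hz1 ▸ rz, fun hr => ?_, fun hr => ?_⟩
    · rcases hCE (class_sub _ _ hr) with h1 | h1 <;> rw [hz1, Prod.mk.injEq] at h1
      · exact nAC h1.1
      · exact hsep.ae (by rw [h1.1, neg_neg])
    · have h1 := (hAE (class_sub _ _ hr)).2
      rw [hz1, Prod.mk.injEq] at h1
      exact hsep.aa h1.1.symm
  · refine Or.inr (Or.inl ⟨hz1 ▸ rz, fun hr => ?_, fun hr => ?_⟩)
    · rcases hAB (class_sub _ _ hr) with h1 | h1 <;> rw [hz1, Prod.mk.injEq] at h1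
      · exact nAC h1.1.symm
      · exact hsep.bc h1.1.symm
    · have h1 := (hAE (class_sub _ _ hr)).2
      rw [hz1, Prod.mk.injEq] at h1
      exact hsep.ac h1.1.symm
  -- in even degree, the strand cannot end at the antipode of its start
  · exfalso
    have h1 : z = antipode hs hev x0 := Subtype.ext hz1
    exact not_sameCycle_antipode hd hs hev x0 ⟨n, by rw [← h1, zpow_natCast]⟩
  · refine Or.inr (Or.inr ⟨hev, ?_, ?_⟩)
    · rw [hz1] at c1; exact c1
    · rw [hz1] at c2; exact c2
  · refine Or.inl ⟨(rz.trans (hz1 ▸ CurveRel.swap _ _)).trans (CurveRel.neg A B).symm,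
      fun hr => ?_, fun hr => hodd (hAE (class_sub _ _ hr)).1⟩
    rcases hCE (class_sub _ _ hr) with h1 | h1 <;> rw [hz1, Prod.mk.injEq] at h1
    · exact hsep.bc h1.1
    · exact nAC (neg_injective h1.2)
  · refine Or.inr (Or.inl ⟨(rz.trans (hz1 ▸ CurveRel.swap _ _)).trans (CurveRel.neg C E).symm,
      fun hr => ?_, fun hr => hodd (hAE (class_sub _ _ hr)).1⟩)
    rcases hAB (class_sub _ _ hr) with h1 | h1 <;> rw [hz1, Prod.mk.injEq] at h1
    · exact hsep.ae (by rw [← h1.1, neg_neg])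
    · exact nAC (neg_injective h1.2).symm

end OctTriangulation

namespace OctTriangulation

variable {K K' : OctTriangulation d} {s : OctPoint d → ZMod 2} {a b c e : OctPoint d}

/-! ### The effect of a flip on the curve -/

/-- The signs at the copy of the parallelogram `abce` under `g` have even sum and do not alternate:
both diagonals are bicolored, or all four signs are equal. Then the flip does not change the
connections between the sides of this copy. -/
def GoodCopy (s : OctPoint d → ZMod 2) (a b c e : OctPoint d) (g : Fin 3 → ℤˣ) : Prop :=
  (s (octReflect g a) ≠ s (octReflect g c) ∧ s (octReflect g b) ≠ s (octReflect g e)) ∨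
  (s (octReflect g c) = s (octReflect g a) ∧ s (octReflect g e) = s (octReflect g b) ∧
    s (octReflect g a) = s (octReflect g b))

lemma GoodCopy.rotate {g : Fin 3 → ℤˣ} (h : GoodCopy s a b c e g) : GoodCopy s b c e a g := by
  rcases h with ⟨h1, h2⟩ | ⟨h1, h2, h3⟩
  · exact Or.inl ⟨h2, h1.symm⟩
  · exact Or.inr ⟨h2, h1.symm, by rw [h1, h3]⟩

/-- A bicolored side of the copy of the parallelogram under `g`. -/
def BicoloredSide (s : OctPoint d → ZMod 2) (a b c e : OctPoint d) (g : Fin 3 → ℤˣ)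
    (p : OctPoint d × OctPoint d) : Prop :=
  ∃ x y, (x = octReflect g a ∨ x = octReflect g c) ∧ (y = octReflect g b ∨ y = octReflect g e) ∧
    s x ≠ s y ∧ (p = (x, y) ∨ p = (y, x))

lemma IsFlip.tri_new_outer (hd : 1 ≤ d) (h : IsFlip K K' a b c e) {g g' : Fin 3 → ℤˣ}
    (h1 : g' ≠ g) (h2 : g' ≠ -g) :
    {octReflect g' a, octReflect g' b, octReflect g' e} ∈ K'.outer (octReflect g b) (octReflect g e) ∧
    {octReflect g' c, octReflect g' b, octReflect g' e} ∈
      K'.outer (octReflect g b) (octReflect g e) := by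
  obtain ⟨nab, nac, nae, nbc, nbe, nce⟩ := h.quad.ne_all hd
  have key : ∀ k : Fin 3 → ℤˣ, ∀ x : OctPoint d, (∀ i, 0 ≤ x.1 i) → x ≠ b → x ≠ e →
      octReflect k b ∈ ({octReflect g' x, octReflect g' b, octReflect g' e} : Finset (OctPoint d)) →
      octReflect k e ∈ ({octReflect g' x, octReflect g' b, octReflect g' e} : Finset (OctPoint d)) →
      g' = k := by
    intro k x hx hxb hxe m1 m2
    simp only [Finset.mem_insert, Finset.mem_singleton] at m1 m2
    have e1 : octReflect k b = octReflect g' b := by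
      rcases m1 with m | m | m
      · exact absurd (eq_of_octReflect_eq h.quad.nonneg_b hx m).symm hxb
      · exact m
      · exact absurd (eq_of_octReflect_eq h.quad.nonneg_b h.quad.nonneg_e m) nbe
    have e2 : octReflect k e = octReflect g' e := by
      rcases m2 with m | m | m
      · exact absurd (eq_of_octReflect_eq h.quad.nonneg_e hx m).symm hxe
      · exact absurd (eq_of_octReflect_eq h.quad.nonneg_e h.quad.nonneg_b m).symm nbe
      · exact m
    exact (h.quad'.reflect_inj hd e1 e2).symm
  refine ⟨⟨(h.tri_new g').1, ?_, ?_⟩, (h.tri_new g').2, ?_, ?_⟩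
  · exact fun hm => h1 (key g a h.quad.nonneg_a nab nae hm.1 hm.2)
  · rw [← octReflect_neg, ← octReflect_neg]
    exact fun hm => h2 (key (-g) a h.quad.nonneg_a nab nae hm.1 hm.2)
  · exact fun hm => h1 (key g c h.quad.nonneg_c nbc.symm nce hm.1 hm.2)
  · rw [← octReflect_neg, ← octReflect_neg]
    exact fun hm => h2 (key (-g) c h.quad.nonneg_c nbc.symm nce hm.1 hm.2)

/-- In a copy with good signs, all bicolored sides belong to one segment of the curve. -/
lemma IsFlip.sides_rel (hd : 1 ≤ d) (h : IsFlip K K' a b c e) {g g' : Fin 3 → ℤˣ}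
    (h1 : g' ≠ g) (h2 : g' ≠ -g) (hg : GoodCopy s a b c e g') {p q : OctPoint d × OctPoint d}
    (hp : BicoloredSide s a b c e g' p) (hq : BicoloredSide s a b c e g' q) :
    CurveRel (K'.outer (octReflect g b) (octReflect g e)) s p q := by
  obtain ⟨t1, t2⟩ := h.tri_new_outer hd h1 h2
  rcases hg with ⟨hac, hbe⟩ | ⟨hac, hbe, hab⟩
  · -- every bicolored side is linked to the new diagonal
    have key : ∀ p, BicoloredSide s a b c e g' p →
        CurveRel (K'.outer (octReflect g b) (octReflect g e)) s p
          (octReflect g' b, octReflect g' e) := by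
      rintro p ⟨x, y, hx, hy, hxy, hp⟩
      have ht : {x, octReflect g' b, octReflect g' e} ∈
          K'.outer (octReflect g b) (octReflect g e) := by
        rcases hx with rfl | rfl
        exacts [t1, t2]
      have hxy' : CurveRel (K'.outer (octReflect g b) (octReflect g e)) s (x, y)
          (octReflect g' b, octReflect g' e) := by
        rcases hy with rfl | rfl
        · refine .trans (.of_link (.tri (w := octReflect g' e) ?_ hxy hbe.symm)) (.swap _ _)
          exact ht
        · refine .of_link (.tri (w := octReflect g' b) ?_ hxy hbe)
          have e' : ({x, octReflect g' e, octReflect g' b} : Finset (OctPoint d))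
            = {x, octReflect g' b, octReflect g' e} := by ext; simp; tauto
          rwa [e']
      rcases hp with rfl | rfl
      · exact hxy'
      · exact (CurveRel.swap _ _).trans hxy'
    exact (key p hp).trans (key q hq).symm
  · exfalso
    obtain ⟨x, y, hx, hy, hxy, -⟩ := hp
    apply hxy
    rcases hx with rfl | rfl <;> rcases hy with rfl | rfl
    · exact hab
    · rw [hbe, hab]
    · rw [hac, hab]
    · rw [hac, hbe, hab]

/-- Equivalent edges of the first curve, other than copies of the diagonal, are equivalent edges of
the second curve, provided that this is true for the two segments in the parallelogram `g`. -/
lemma IsFlip.rel_transfer (hd : 1 ≤ d) (h : IsFlip K K' a b c e) (hs : SignAlternates d s)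
    {g : Fin 3 → ℤˣ} (hgood : ∀ g', g' ≠ g → g' ≠ -g → GoodCopy s a b c e g')
    {U U' : Set (Finset (OctPoint d))} (hU : U ⊆ K.tris)
    (hU' : K'.outer (octReflect g b) (octReflect g e) ⊆ U')
    (hbad : U ⊆ K.outer (octReflect g a) (octReflect g c) ∨
      (K.IsBadQuad s (octReflect g a) (octReflect g b) (octReflect g c) (octReflect g e) ∧
        CurveRel U' s (octReflect g a, octReflect g b) (octReflect g c, octReflect g b) ∧
        CurveRel U' s (octReflect g a, octReflect g e) (octReflect g c, octReflect g e)))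
    {p q : OctPoint d × OctPoint d} (hp : ¬ IsDiag a c p.1 p.2) (hq : ¬ IsDiag a c q.1 q.2)
    (hpq : CurveRel U s p q) : CurveRel U' s p q := by
  classical
  obtain ⟨nab, nac, nae, nbc, nbe, nce⟩ := h.quad.ne_all hd
  -- replace a copy of the diagonal by a side of the same copy of the parallelogram
  set side : (Fin 3 → ℤˣ) → OctPoint d × OctPoint d := fun g' =>
    (octReflect g' b, if s (octReflect g' b) ≠ s (octReflect g' a) then octReflect g' a
      else octReflect g' c) with hside
  set φ : OctPoint d × OctPoint d → OctPoint d × OctPoint d := fun p =>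
    if hD : IsDiag a c p.1 p.2 then side hD.choose else p with hφ
  have φ_of_not : ∀ p, ¬ IsDiag a c p.1 p.2 → φ p = p := fun p hp => dif_neg hp
  have φ_diag : ∀ (g' : Fin 3 → ℤˣ) (u v : OctPoint d), (u = octReflect g' a ∧ v = octReflect g' c) ∨
      (u = octReflect g' c ∧ v = octReflect g' a) → φ (u, v) = side g' := by
    intro g' u v huv
    have hD : IsDiag a c u v := ⟨g', huv⟩
    have hc := hD.choose_spec
    have hg : hD.choose = g' := by
      rcases huv with ⟨rfl, rfl⟩ | ⟨rfl, rfl⟩ <;> rcases hc with ⟨h1, h2⟩ | ⟨h1, h2⟩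
      · exact (h.quad.reflect_inj hd h1 h2).symm
      · exact absurd (eq_of_octReflect_eq h.quad.nonneg_a h.quad.nonneg_c h1) nac
      · exact absurd (eq_of_octReflect_eq h.quad.nonneg_c h.quad.nonneg_a h1).symm nac
      · exact (h.quad.reflect_inj hd h2 h1).symm
    simp only [hφ]
    rw [dif_pos hD, hg]
  have side_neg : ∀ g', CurveRel U' s (side g') (side (-g')) := by
    intro g'
    have : side (-g') = (-(side g').1, -(side g').2) := by
      simp only [hside, octReflect_neg, hs.ne_neg]
      split_ifs <;> rfl
    rw [this]
    exact .neg _ _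
  -- in a good copy, the bicolored edges are replaced by bicolored sides
  have φ_side : ∀ (g' : Fin 3 → ℤˣ) (x y z : OctPoint d), g' ≠ g → g' ≠ -g →
      (z = octReflect g' b ∨ z = octReflect g' e) →
      (x = octReflect g' a ∨ x = octReflect g' c ∨ x = z) →
      (y = octReflect g' a ∨ y = octReflect g' c ∨ y = z) → s x ≠ s y →
      BicoloredSide s a b c e g' (φ (x, y)) := by
    intro g' x y z h1 h2 hz hx hy hxy
    obtain ⟨s1, s2, s3, s4⟩ := h.quad.side_not_diag hd g'
    have hsides : ∀ x z, (x = octReflect g' a ∨ x = octReflect g' c) →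
        (z = octReflect g' b ∨ z = octReflect g' e) → ¬ IsDiag a c x z := by
      rintro x z (rfl | rfl) (rfl | rfl)
      exacts [s1, s3, s2, s4]
    have hdiag : s (octReflect g' a) ≠ s (octReflect g' c) → BicoloredSide s a b c e g' (side g') := by
      intro hne
      simp only [hside]
      split_ifs with hc
      · exact ⟨_, _, Or.inl rfl, Or.inl rfl, hc.symm, Or.inr rfl⟩
      · push Not at hc
        exact ⟨_, _, Or.inr rfl, Or.inl rfl, by rw [hc]; exact hne.symm, Or.inr rfl⟩
    have ends : ∀ x z, (x = octReflect g' a ∨ x = octReflect g' c) →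
        (z = octReflect g' b ∨ z = octReflect g' e) → s x ≠ s z →
        BicoloredSide s a b c e g' (φ (x, z)) ∧ BicoloredSide s a b c e g' (φ (z, x)) := by
      intro x z hx hz hxz
      rw [φ_of_not _ (hsides x z hx hz), φ_of_not _ fun hd => hsides x z hx hz hd.symm]
      exact ⟨⟨x, z, hx, hz, hxz, Or.inl rfl⟩, ⟨x, z, hx, hz, hxz, Or.inr rfl⟩⟩
    rcases hx with rfl | rfl | rfl <;> rcases hy with rfl | rfl | rfl
    · exact absurd rfl hxy
    · rw [φ_diag g' _ _ (Or.inl ⟨rfl, rfl⟩)]; exact hdiag hxy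
    · exact (ends _ _ (Or.inl rfl) hz hxy).1
    · rw [φ_diag g' _ _ (Or.inr ⟨rfl, rfl⟩)]; exact hdiag hxy.symm
    · exact absurd rfl hxy
    · exact (ends _ _ (Or.inr rfl) hz hxy).1
    · exact (ends _ _ (Or.inl rfl) hz hxy.symm).2
    · exact (ends _ _ (Or.inr rfl) hz hxy.symm).2
    · exact absurd rfl hxy
  -- the moves through the triangles outside of the parallelogram `g`
  have outer_link : ∀ u v w : OctPoint d, {u, v, w} ∈ K.outer (octReflect g a) (octReflect g c) →
      s u ≠ s v → s w ≠ s v → CurveRel U' s (φ (u, v)) (φ (w, v)) := by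
    intro u v w ht h1 h2
    obtain ⟨n1, n2, n3⟩ := tri_ne ht.1
    rcases h.tri_cases hd ht.1 with ⟨ht', hno⟩ | ⟨g', hS⟩
    · have nd : ∀ x ∈ ({u, v, w} : Finset (OctPoint d)), ∀ y ∈ ({u, v, w} : Finset (OctPoint d)),
          φ (x, y) = (x, y) := by
        intro x hx y hy
        refine φ_of_not _ ?_
        rintro ⟨g', ⟨h1, h2⟩ | ⟨h1, h2⟩⟩
        · exact hno g' ⟨by rw [← h1]; exact hx, by rw [← h2]; exact hy⟩
        · exact hno g' ⟨by rw [← h2]; exact hy, by rw [← h1]; exact hx⟩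
      rw [nd u (by simp) v (by simp), nd w (by simp) v (by simp)]
      refine .of_link (.tri (hU' ⟨ht', h.quad.no_cross hd ht.1 g, ?_⟩) h1 h2)
      rw [← octReflect_neg, ← octReflect_neg]
      exact h.quad.no_cross hd ht.1 (-g)
    · obtain ⟨z, hz, hS⟩ : ∃ z, (z = octReflect g' b ∨ z = octReflect g' e) ∧
          ({u, v, w} : Finset (OctPoint d)) = {octReflect g' a, octReflect g' c, z} := by
        rcases hS with hS | hS
        exacts [⟨_, Or.inl rfl, hS⟩, ⟨_, Or.inr rfl, hS⟩]
      have g1 : g' ≠ g := by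
        rintro rfl
        exact ht.2.1 (by rw [hS]; exact ⟨by simp, by simp⟩)
      have g2 : g' ≠ -g := by
        rintro rfl
        refine ht.2.2 ?_
        rw [hS, octReflect_neg, octReflect_neg]; exact ⟨by simp, by simp⟩
      have hm : ∀ x ∈ ({u, v, w} : Finset (OctPoint d)),
          x = octReflect g' a ∨ x = octReflect g' c ∨ x = z := by
        intro x hx
        rw [hS] at hx
        simpa only [Finset.mem_insert, Finset.mem_singleton] using hx
      exact (h.sides_rel hd g1 g2 (hgood g' g1 g2)
        (φ_side g' u v z g1 g2 hz (hm u (by simp)) (hm v (by simp)) h1)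
        (φ_side g' w v z g1 g2 hz (hm w (by simp)) (hm v (by simp)) h2)).mono hU'
  -- the replacement maps each elementary move to equivalent pairs
  have main : CurveRel U' s (φ p) (φ q) := by
    refine CurveRel.of_forall_link (r := fun p q => CurveRel U' s (φ p) (φ q))
      ⟨fun _ => .refl _, .symm, .trans⟩ ?_ hpq
    rintro _ _ (⟨u, v⟩ | ⟨u, v⟩ | @⟨u, v, w, ht, h1, h2⟩)
    · by_cases hD : IsDiag a c u v
      · obtain ⟨g', hg'⟩ := hD
        rw [φ_diag g' u v hg', φ_diag g' v u (by tauto)]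
        exact .refl _
      · rw [φ_of_not _ hD, φ_of_not _ fun hD' => hD hD'.symm]
        exact .swap _ _
    · by_cases hD : IsDiag a c u v
      · obtain ⟨g', hg'⟩ := hD
        rw [φ_diag g' u v hg', φ_diag (-g') (-u) (-v) ?_]
        · exact side_neg g'
        · rw [octReflect_neg, octReflect_neg, neg_inj, neg_inj, neg_inj, neg_inj]
          exact hg'
      · rw [φ_of_not _ hD, φ_of_not (-u, -v)]
        · exact .neg _ _
        · rintro ⟨g', hg'⟩
          refine hD ⟨-g', ?_⟩
          rwa [octReflect_neg, octReflect_neg, ← neg_eq_iff_eq_neg, ← neg_eq_iff_eq_neg,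
            ← neg_eq_iff_eq_neg, ← neg_eq_iff_eq_neg]
    · by_cases ho : {u, v, w} ∈ K.outer (octReflect g a) (octReflect g c)
      · exact outer_link u v w ho h1 h2
      · rcases hbad with hbad | ⟨hQ, hb, he⟩
        · exact absurd (hbad ht) ho
        · have sides : ∀ u v w, (v = octReflect g b ∨ v = octReflect g e) →
              ((u = octReflect g a ∧ w = octReflect g c) ∨
                (u = octReflect g c ∧ w = octReflect g a)) →
              (¬ IsDiag a c u v ∧ ¬ IsDiag a c w v) ∧ CurveRel U' s (u, v) (w, v) := by
            obtain ⟨s1, s2, s3, s4⟩ := h.quad.side_not_diag hd g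
            rintro u v w (rfl | rfl) (⟨rfl, rfl⟩ | ⟨rfl, rfl⟩)
            exacts [⟨⟨s1, s2⟩, hb⟩, ⟨⟨s2, s1⟩, hb.symm⟩, ⟨⟨s3, s4⟩, he⟩, ⟨⟨s4, s3⟩, he.symm⟩]
          have diag_neg : ∀ u v, IsDiag a c u v → IsDiag a c (-u) (-v) := by
            rintro u v ⟨g', hg'⟩
            refine ⟨-g', ?_⟩
            rwa [octReflect_neg, octReflect_neg, neg_inj, neg_inj, neg_inj, neg_inj]
          rcases hQ.link_cases hs (hU ht) ho h1 h2 with ⟨hv, huw⟩ | ⟨hv, huw⟩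
          · obtain ⟨⟨d1, d2⟩, hr⟩ := sides u v w hv huw
            rw [φ_of_not _ d1, φ_of_not _ d2]
            exact hr
          · obtain ⟨⟨d1, d2⟩, hr⟩ := sides (-u) (-v) (-w) hv huw
            rw [φ_of_not (u, v) fun h => d1 (diag_neg _ _ h),
              φ_of_not (w, v) fun h => d2 (diag_neg _ _ h)]
            exact ((CurveRel.neg u v).trans hr).trans (CurveRel.neg w v).symm
  rwa [φ_of_not _ hp, φ_of_not _ hq] at main

/-- Paths along the curve outside of the parallelogram do not use copies of the diagonals. -/
lemma IsFlip.sidePath (hd : 1 ≤ d) (h : IsFlip K K' a b c e)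
    {g : Fin 3 → ℤˣ} (hgood : ∀ g', g' ≠ g → g' ≠ -g → GoodCopy s a b c e g') {u v : OctPoint d}
    (hp : SidePath (K.outer (octReflect g a) (octReflect g c)) s u v) :
    K.MonoPath s u v ∧ K'.MonoPath s u v := by
  refine ⟨Relation.ReflTransGen.mono ?_ _ _ hp, Relation.ReflTransGen.mono ?_ _ _ hp⟩
  · rintro x y ⟨w, hw, hs, -⟩
    exact ⟨⟨w, hw.1⟩, hs⟩
  · rintro x y ⟨w, hw, hs, hsw⟩
    refine ⟨h.edge hd ⟨w, hw.1⟩ ?_, hs⟩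
    rintro ⟨g', hg'⟩
    have hac : ({x, y, w} : Finset (OctPoint d)) = {octReflect g' a, octReflect g' c, w} := by
      rcases hg' with ⟨rfl, rfl⟩ | ⟨rfl, rfl⟩
      · rfl
      · ext; simp; tauto
    have g1 : g' ≠ g := by
      rintro rfl
      exact hw.2.1 (by rw [hac]; exact ⟨by simp, by simp⟩)
    have g2 : g' ≠ -g := by
      rintro rfl
      refine hw.2.2 ?_
      rw [hac, octReflect_neg, octReflect_neg]; exact ⟨by simp, by simp⟩
    have hsac : s (octReflect g' c) = s (octReflect g' a) := by
      rcases hg' with ⟨rfl, rfl⟩ | ⟨rfl, rfl⟩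
      exacts [hs.symm, hs]
    have hsx : s x = s (octReflect g' a) := by
      rcases hg' with ⟨rfl, rfl⟩ | ⟨rfl, rfl⟩
      exacts [rfl, hsac]
    rcases hgood g' g1 g2 with ⟨h1, -⟩ | ⟨-, h2, h3⟩
    · exact h1 hsac.symm
    · apply hsw
      rw [hsx]
      have hw' := hw.1
      rw [hac] at hw'
      rcases h.quad.tri_at_diagonal hd hw' with rfl | rfl
      · exact h3.symm
      · rw [h2, h3]

lemma IsQuad.separated (hd : 1 ≤ d) (h : K.IsQuad a b c e) (g : Fin 3 → ℤˣ) :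
    IsSeparated (octReflect g a) (octReflect g b) (octReflect g c) (octReflect g e) := by
  have key : ∀ x y : OctPoint d, (∀ i, 0 ≤ x.1 i) → (∀ i, 0 ≤ y.1 i) →
      -octReflect g x ≠ octReflect g y := by
    intro x y hx hy he
    rw [← octReflect_neg] at he
    obtain rfl := eq_of_octReflect_eq hx hy he
    rw [octReflect_neg] at he
    exact neg_ne_self hd _ he
  exact ⟨key _ _ h.nonneg_a h.nonneg_a, key _ _ h.nonneg_a h.nonneg_c,
    key _ _ h.nonneg_a h.nonneg_e, key _ _ h.nonneg_b h.nonneg_c, key _ _ h.nonneg_c h.nonneg_c,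
    key _ _ h.nonneg_c h.nonneg_e⟩

/-- Every component of the curve meets an edge which is no copy of the flipped diagonal. -/
lemma IsFlip.exists_rel_not_diag (hd : 1 ≤ d) (h : IsFlip K K' a b c e)
    {p : OctPoint d × OctPoint d} (hp : K.Bicolored s p) :
    ∃ q, (K.Bicolored s q ∧ K'.Bicolored s q) ∧ CurveRel K.tris s p q := by
  by_cases hD : IsDiag a c p.1 p.2
  swap
  · exact ⟨p, ⟨hp, ⟨h.edge hd hp.1 hD, hp.2⟩⟩, .refl p⟩
  obtain ⟨g', hg'⟩ := hD
  obtain ⟨s1, s2, s3, s4⟩ := h.quad.side_not_diag hd g'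
  have hne : s (octReflect g' a) ≠ s (octReflect g' c) := by
    have := hp.2
    rcases hg' with ⟨h1, h2⟩ | ⟨h1, h2⟩ <;> rw [h1, h2] at this
    exacts [this, this.symm]
  have ht := tri_reflect g' h.quad.tri_abc
  have hpr : CurveRel K.tris s p (octReflect g' a, octReflect g' c) := by
    obtain ⟨p1, p2⟩ := p
    rcases hg' with ⟨rfl, rfl⟩ | ⟨rfl, rfl⟩
    exacts [.refl _, .swap _ _]
  by_cases hb : s (octReflect g' b) = s (octReflect g' c)
  · have hab : s (octReflect g' a) ≠ s (octReflect g' b) := by rw [hb]; exact hne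
    have he : K.Edge (octReflect g' a) (octReflect g' b) := ⟨_, ht⟩
    refine ⟨(octReflect g' a, octReflect g' b), ⟨⟨he, hab⟩, ⟨h.edge hd he s1, hab⟩⟩, hpr.trans ?_⟩
    exact (CurveRel.swap _ _).trans ((CurveRel.of_link (.tri (tri_rotate (tri_rotate ht)) hne.symm
      hab.symm)).trans (.swap _ _))
  · have he : K.Edge (octReflect g' c) (octReflect g' b) := 
      ⟨octReflect g' a, tri_rotate (tri_rotate (tri_swap ht))⟩
    refine ⟨(octReflect g' c, octReflect g' b), ⟨⟨he, Ne.symm hb⟩, ⟨h.edge hd he s2, Ne.symm hb⟩⟩, hpr.trans ?_⟩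
    exact (CurveRel.of_link (.tri (tri_swap' ht) hne hb)).trans (.swap _ _)

end OctTriangulation

namespace OctTriangulation

variable {K K' : OctTriangulation d} {s : OctPoint d → ZMod 2} {a b c e : OctPoint d}

lemma IsFlip.not_isDiag (hd : 1 ≤ d) (h : IsFlip K K' a b c e) {u v : OctPoint d}
    (huv : K'.Edge u v) : ¬ IsDiag a c u v := by
  rintro ⟨g, hg⟩
  obtain ⟨w, hw⟩ := huv
  have hno := h.quad'.no_cross hd hw g
  rcases hg with ⟨rfl, rfl⟩ | ⟨rfl, rfl⟩
  · exact hno ⟨by simp, by simp⟩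
  · exact hno ⟨by simp, by simp⟩

/-- If a flip changes the curve in one pair of antipodal parallelograms only, then it changes the
number of components of the curve, or the degree is even and there are monochromatic paths between
antipodal points, of one sign before and of the other sign after the flip. -/
lemma IsFlip.components_or_monoPath (hd : 1 ≤ d) (h : IsFlip K K' a b c e)
    (hs : SignAlternates d s) {g : Fin 3 → ℤˣ}
    (hgood : ∀ g', g' ≠ g → g' ≠ -g → GoodCopy s a b c e g')
    (hA : s (octReflect g a) = 1) (hC : s (octReflect g c) = 1) (hB : s (octReflect g b) = 0)
    (hE : s (octReflect g e) = 0) (ho : 0 < orient (octReflect g a) (octReflect g c) (octReflect g e)) :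
    (componentsOf (coverMap '' K.curveLift s)).ncard
      ≠ (componentsOf (coverMap '' K'.curveLift s)).ncard ∨
    (Even d ∧ K.MonoPath s (octReflect g a) (-octReflect g a) ∧
      K'.MonoPath s (octReflect g b) (-octReflect g b)) := by
  have h' := h.symm hd
  have hgood' : ∀ g', g' ≠ g → g' ≠ -g → GoodCopy s b c e a g' :=
    fun g' h1 h2 => (hgood g' h1 h2).rotate
  have hQ := h.quad.isBadQuad hd (s := s) (g := g) (by rw [hA, hC]) (by rw [hB, hE])
    (by rw [hA, hB]; decide)
  have hQ' := h.quad'.isBadQuad hd (s := s) (g := g) (by rw [hB, hE]) (by rw [hA, hC])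
    (by rw [hB, hC]; decide)
  have ho' : orient (octReflect g a) (octReflect g c) (octReflect g b) < 0 := by
    have : orient (octReflect g a) (octReflect g c) (octReflect g e)
        = -orient (octReflect g a) (octReflect g c) (octReflect g b) := by
      rw [orient_octReflect, orient_octReflect, h.quad.orient_e]; ring
    omega
  have hsep := h.quad.separated hd g
  obtain ⟨n1, n2, n3, n4⟩ := h.quad.side_not_diag hd g
  obtain ⟨m1, m2, m3, m4⟩ := h'.quad.side_not_diag hd g
  have tABC := tri_reflect g h.quad.tri_abc
  have tACE := tri_reflect g h.quad.tri_ace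
  obtain ⟨tABE, tCBE⟩ := h.tri_new g
  set A := octReflect g a with hAdef
  set B := octReflect g b with hBdef
  set C := octReflect g c with hCdef
  set E := octReflect g e with hEdef
  have sAB : s A ≠ s B := by rw [hA, hB]; decide
  have sCB : s C ≠ s B := by rw [hC, hB]; decide
  have sAE : s A ≠ s E := by rw [hA, hE]; decide
  have sCE : s C ≠ s E := by rw [hC, hE]; decide
  have bAB : K.Bicolored s (A, B) ∧ K'.Bicolored s (A, B) :=
    ⟨⟨⟨_, tABC⟩, sAB⟩, ⟨⟨_, tABE⟩, sAB⟩⟩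
  have bCB : K.Bicolored s (C, B) ∧ K'.Bicolored s (C, B) :=
    ⟨⟨⟨_, tri_rotate (tri_rotate (tri_swap tABC))⟩, sCB⟩, ⟨⟨_, tCBE⟩, sCB⟩⟩
  have bAE : K.Bicolored s (A, E) ∧ K'.Bicolored s (A, E) :=
    ⟨⟨⟨_, tri_swap' tACE⟩, sAE⟩, ⟨⟨_, tri_swap' tABE⟩, sAE⟩⟩
  have to' : ∀ {p q : OctPoint d × OctPoint d}, ¬ IsDiag a c p.1 p.2 → ¬ IsDiag a c q.1 q.2 →
      CurveRel (K.outer A C) s p q → CurveRel (K'.outer B E) s p q :=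
    fun hp hq => h.rel_transfer hd hs hgood outer_subset subset_rfl (Or.inl subset_rfl) hp hq
  have from' : ∀ {p q : OctPoint d × OctPoint d}, ¬ IsDiag b e p.1 p.2 → ¬ IsDiag b e q.1 q.2 →
      CurveRel (K'.outer B E) s p q → CurveRel (K.outer A C) s p q :=
    fun hp hq => h'.rel_transfer hd hs hgood' outer_subset (outer_comm ▸ subset_rfl)
      (Or.inl subset_rfl) hp hq
  -- the segments in the parallelogram, before and after the flip
  have kABCB : CurveRel K.tris s (A, B) (C, B) := .of_link (.tri tABC sAB sCB)
  have kAECE : CurveRel K.tris s (A, E) (C, E) := .of_link (.tri (tri_swap' tACE) sAE sCE)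
  have kABAE : CurveRel K'.tris s (A, B) (A, E) :=
    (CurveRel.swap _ _).trans ((CurveRel.of_link (.tri (tri_swap tABE) sAB.symm sAE.symm)).trans
      (.swap _ _))
  have kCBCE : CurveRel K'.tris s (C, B) (C, E) :=
    (CurveRel.swap _ _).trans ((CurveRel.of_link (.tri (tri_swap tCBE) sCB.symm sCE.symm)).trans
      (.swap _ _))
  rcases hQ.strand hd hs hA hB ho' ho hsep with ⟨r1, r2, r3⟩ | ⟨r1, r2, r3⟩ | ⟨hev, r1, r2⟩
  -- the strand from `CB` to `AB` is closed to a component by the old segment `AB`-`CB`; the new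
  -- segments merge it with the strand at `E`
  · left
    refine (ncard_components_lt hs (B := {q | K.Bicolored s q ∧ K'.Bicolored s q})
      (fun q hq => hq.1) (fun q hq => hq.2) (fun p hp => ?_) (fun p hp q hq hpq => ?_)
      ⟨_, bAB, _, bAE, kABAE, fun hr => ?_⟩).ne'
    · obtain ⟨q, ⟨h1, h2⟩, h3⟩ := h'.exists_rel_not_diag hd hp
      exact ⟨q, ⟨h2, h1⟩, h3⟩
    · have k1 : CurveRel K'.tris s (A, B) (C, B) := ((to' n2 n1 r1).mono outer_subset).symm
      exact h.rel_transfer hd hs hgood subset_rfl outer_subset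
        (Or.inr ⟨hQ, k1, (kABAE.symm.trans k1).trans kCBCE⟩) (h.not_isDiag hd hp.2.1)
        (h.not_isDiag hd hq.2.1) hpq
    · exact r3 ((hQ.rel_iff hs (x := (C, B)) ⟨fun _ => .refl _, fun _ => r1⟩
        ⟨fun h => absurd h r3, fun h => absurd h r2⟩ hr).1 r1)
  -- the strand from `CB` to `CE` is closed to a component by the new segment `CB`-`CE`; the old
  -- segments merge it with the strand at `A`
  · left
    refine (ncard_components_lt hs (B := {q | K.Bicolored s q ∧ K'.Bicolored s q})
      (fun q hq => hq.2) (fun q hq => hq.1) (fun p hp => ?_) (fun p hp q hq hpq => ?_)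
      ⟨_, bAB, _, bCB, kABCB, fun hr => ?_⟩).ne
    · exact h.exists_rel_not_diag hd hp
    · have k1 : CurveRel K.tris s (C, B) (C, E) := r1.mono outer_subset
      refine h'.rel_transfer hd hs hgood' subset_rfl outer_subset
        (Or.inr ⟨hQ', ?_, ?_⟩) (h'.not_isDiag hd hp.1.1) (h'.not_isDiag hd hq.1.1) hpq
      · exact (CurveRel.swap _ _).trans (k1.trans (.swap _ _))
      · exact (CurveRel.swap _ _).trans (((kABCB.trans k1).trans kAECE.symm).trans (.swap _ _))
    · have k1 : CurveRel (K'.outer B E) s (C, B) (C, E) := to' n2 n4 r1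
      have k2 : ¬ CurveRel (K'.outer B E) s (C, B) (A, B) := fun hc =>
        r2 (from' (fun h => m1 h.symm) (fun h => m3 h.symm) hc)
      have k3 : ¬ CurveRel (K'.outer B E) s (C, B) (A, E) := fun hc =>
        r3 (from' (fun h => m1 h.symm) (fun h => m4 h.symm) hc)
      refine k2 ((hQ'.rel_iff hs (x := (C, B)) ⟨fun _ => ?_, fun _ => .swap _ _⟩
        ⟨fun hc => absurd (hc.trans (.swap _ _)) k2, fun hc => absurd (hc.trans (.swap _ _)) k3⟩
        hr).2 (.refl _))
      exact k1.trans (.swap _ _)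
  -- the strand leads to the antipode, and is accompanied by monochromatic paths
  · right
    refine ⟨hev, ?_, ?_⟩
    · exact Relation.ReflTransGen.head ⟨⟨_, tri_swap' tABC⟩, by rw [hA, hC]⟩
        (h.sidePath hd hgood r1).1
    · refine Relation.ReflTransGen.tail (h.sidePath hd hgood r2).2 ⟨Edge.neg ?_, ?_⟩
      · exact ⟨_, tri_swap (tri_rotate tABE)⟩
      · rw [hs.neg_eq hev, hs.neg_eq hev, hB, hE]

end OctTriangulation

namespace OctTriangulation

variable {K : OctTriangulation d} {s : OctPoint d → ZMod 2}

/-! ### Separating a vertex from a non-contractible monochromatic loop -/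

/-- A cochain which vanishes on monochromatic pairs is a cocycle if it agrees on the two bicolored
edges of each triangle. -/
lemma cocycle_of_bicolored {ω : OctPoint d → OctPoint d → ZMod 2} (hsymm : ∀ u v, ω u v = ω v u)
    (hmono : ∀ u v, s u = s v → ω u v = 0)
    (hlink : ∀ u v w, {u, v, w} ∈ K.tris → s u ≠ s v → s w ≠ s v → ω u v = ω w v)
    (u v w : OctPoint d) (h : {u, v, w} ∈ K.tris) : ω u v + ω v w + ω u w = 0 := by
  by_cases huv : s u = s v
  · by_cases hvw : s v = s w
    · rw [hmono u v huv, hmono v w hvw, hmono u w (huv.trans hvw)]; rfl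
    · rw [hmono u v huv, zero_add, hlink v w u (tri_rotate h) hvw (huv ▸ hvw), zmod_add_self]
  · by_cases hvw : s v = s w
    · rw [hmono v w hvw, add_zero, hsymm u v, hsymm u w,
        hlink v u w (tri_swap h) (Ne.symm huv) (hvw ▸ Ne.symm huv), zmod_add_self]
    · have huw : s u = s w := zmod_two_eq_of_ne huv (Ne.symm hvw)
      rw [hmono u w huw, add_zero, hsymm v w, hlink u v w h huv (Ne.symm hvw), zmod_add_self]

lemma MonoPath.eq_of {f : OctPoint d → ZMod 2} (hf : ∀ u v, K.Edge u v → s u = s v → f u = f v)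
    {u v : OctPoint d} (h : K.MonoPath s u v) : f u = f v := by
  induction h with
  | refl => rfl
  | tail _ h ih => rw [ih, hf _ _ h.1 h.2]

/-- If `u` and `u₀` have different signs, then some component of the curve separates them: the
potentials of all components add up to the sign distribution. -/
lemma exists_separating_class (hex : K.CocyclesExact) (hcon : K.EdgeConnected) {u u₀ : OctPoint d}
    (hne : s u ≠ s u₀) :
    ∃ (e₀ : OutEdge K s) (f : OctPoint d → ZMod 2),
      (∀ x y, K.Edge x y → s x ≠ s y → CurveRel K.tris s e₀.1 (x, y) → f x + f y = 1) ∧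
      (∀ x y, K.Edge x y → ¬ (s x ≠ s y ∧ CurveRel K.tris s e₀.1 (x, y)) → f x + f y = 0) ∧
      f u ≠ f u₀ := by
  classical
  set S : Setoid (OctPoint d × OctPoint d) := Relation.EqvGen.setoid (CurveLink K.tris s) with hS
  have rel_iff : ∀ p q, (Quotient.mk S p = Quotient.mk S q) ↔ CurveRel K.tris s p q :=
    fun p q => Quotient.eq
  have : Fintype (Quotient S) := Fintype.ofFinite _
  -- the crossings with the components are cocycles
  set ω : Quotient S → OctPoint d → OctPoint d → ZMod 2 := fun c x y =>
    if s x ≠ s y ∧ Quotient.mk S (x, y) = c then 1 else 0 with hω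
  have hpot : ∀ c, ∃ f : OctPoint d → ZMod 2, ∀ x y, K.Edge x y → ω c x y = f x + f y := by
    intro c
    have hsymm : ∀ x y, ω c x y = ω c y x := by
      intro x y
      have : Quotient.mk S (x, y) = Quotient.mk S (y, x) := (rel_iff _ _).2 (.swap _ _)
      simp only [hω, this, ne_comm]
    refine hex (ω c) hsymm (cocycle_of_bicolored (s := s) hsymm ?_ ?_)
    · intro x y hxy
      exact if_neg fun h => h.1 hxy
    · intro x y z ht h1 h2
      have : Quotient.mk S (x, y) = Quotient.mk S (z, y) :=
        (rel_iff _ _).2 (.of_link (.tri ht h1 h2))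
      simp only [hω, this, h1, h2, ne_eq, not_false_eq_true]
  choose f hf using hpot
  have hsum : ∀ x y, K.Edge x y → s x + ∑ c, f c x = s y + ∑ c, f c y := by
    intro x y hxy
    have h1 : ∑ c, (f c x + f c y) = s x + s y := by
      rw [Finset.sum_congr rfl fun c _ => (hf c x y hxy).symm]
      by_cases hsxy : s x = s y
      · rw [Finset.sum_eq_zero fun c _ => if_neg fun h => h.1 hsxy, hsxy, zmod_add_self]
      · have h2 : ∀ c, ω c x y = if Quotient.mk S (x, y) = c then 1 else 0 := by
          intro c
          simp only [hω, hsxy, ne_eq, not_false_eq_true, true_and]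
        rw [Finset.sum_congr rfl fun c _ => h2 c, Finset.sum_ite_eq, if_pos (Finset.mem_univ _)]
        revert hsxy
        generalize s x = α
        generalize s y = β
        revert α β
        decide
    rw [Finset.sum_add_distrib] at h1
    rw [← zmod_add_eq_zero]
    linear_combination h1 + zmod_add_self (s x) + zmod_add_self (s y)
  obtain ⟨c, hc⟩ : ∃ c, f c u ≠ f c u₀ := by
    by_contra! hcon'
    have h1 := hcon _ hsum u u₀
    simp only [hcon'] at h1
    exact hne (add_right_cancel h1)
  obtain ⟨x, y, hxy, hne', hcl⟩ : ∃ x y, K.Edge x y ∧ s x ≠ s y ∧ Quotient.mk S (x, y) = c := by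
    by_contra! hno
    refine hc (hcon (f c) (fun x y hxy => ?_) u u₀)
    rw [← zmod_add_eq_zero, ← hf c x y hxy]
    exact if_neg fun h => hno x y hxy h.1 h.2
  obtain ⟨e₀, he₀⟩ : ∃ e₀ : OutEdge K s, Quotient.mk S e₀.1 = c := by
    rcases zmod_two_cases (s x) with h0 | h0
    · have h1 : s y = 1 := (zmod_two_cases _).resolve_left (h0 ▸ hne'.symm)
      exact ⟨⟨(y, x), hxy.symm, h1, h0⟩, ((rel_iff _ _).2 (.swap _ _)).trans hcl⟩
    · have h1 : s y = 0 := (zmod_two_cases _).resolve_right (h0 ▸ hne'.symm)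
      exact ⟨⟨(x, y), hxy, h0, h1⟩, hcl⟩
  refine ⟨e₀, f c, fun x y hxy h1 h2 => ?_, fun x y hxy h => ?_, hc⟩
  · rw [← hf c x y hxy]
    exact if_pos ⟨h1, ((rel_iff _ _).2 h2).symm.trans he₀⟩
  · rw [← hf c x y hxy]
    exact if_neg fun h' => h ⟨h'.1, (rel_iff _ _).1 (he₀.trans h'.2.symm)⟩

/-- In even degree, a monochromatic path between the antipodal points `±u₀` is separated from each
vertex `u` of the other sign by a component of the curve whose preimage in the sphere consists of
two antipodal walks. One of them has a potential `g`; it takes different values at `±u`. -/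
lemma exists_separating_walk (hd : 1 ≤ d) (heven : Even d) (hs : SignAlternates d s)
    (hex : K.CocyclesExact) (hcon : K.EdgeConnected) {u u₀ : OctPoint d} (hne : s u ≠ s u₀)
    (hm : K.MonoPath s u₀ (-u₀)) :
    ∃ (e₀ : OutEdge K s) (g : OctPoint d → ZMod 2),
      (∀ x y, K.Edge x y → ¬ (s x ≠ s y ∧ CurveRel K.tris s e₀.1 (x, y)) → g x = g y) ∧
      g u₀ = g (-u₀) ∧ g u ≠ g (-u) := by
  classical
  obtain ⟨e₀, f, hf1, hf0, hfu⟩ := exists_separating_class hex hcon hne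
  set Z : OutEdge K s → Prop := fun e => (walk hd K s).SameCycle e₀ e with hZ
  have hP : ∀ (e : OutEdge K s) (w), {e.1.1, e.1.2, w} ∈ K.tris → 0 < orient e.1.1 e.1.2 w →
      (Z e ↔ Z (next hd e)) := fun e _ _ _ => Equiv.Perm.sameCycle_apply_right.symm
  have hrel : ∀ e, Z e → CurveRel K.tris s e₀.1 e.1 := by
    intro e he
    obtain ⟨n, rfl⟩ := he.exists_nat_pow_eq
    induction n with
    | zero => exact .refl _
    | succ n ih =>
      have hn : Z ((walk hd K s ^ n) e₀) := ⟨n, by rw [zpow_natCast]⟩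
      have h1 := rel_next hd (T := K.tris) ((walk hd K s ^ n) e₀) fun _ h _ => h
      rw [pow_succ', Equiv.Perm.mul_apply]
      exact (ih hn).trans h1
  -- the preimage of the component consists of the walk and its antipode, which are disjoint
  have hpairs : ∀ x y, CurveRel K.tris s e₀.1 (x, y) ↔ (onPairs Z (x, y) ∨ onPairs Z (-x, -y)) := by
    intro x y
    constructor
    · intro h
      exact (onPairs_rel hd hs subset_rfl (fun _ _ _ => tri_neg) hP h).1
        (Or.inl ((onPairs_iff e₀).2 (Equiv.Perm.SameCycle.refl _ _)))
    · have key : ∀ x y, onPairs Z (x, y) → CurveRel K.tris s e₀.1 (x, y) := by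
        rintro x y ⟨e, he, h | h⟩
        · rw [← h]; exact hrel e he
        · have := hrel e he
          rw [h] at this
          exact this.trans (.swap _ _)
      rintro (h | h)
      · exact key x y h
      · exact (key _ _ h).trans (CurveRel.neg x y).symm
  have hexcl : ∀ x y, onPairs Z (x, y) → ¬ onPairs Z (-x, -y) := by
    have key : ∀ e e', Z e → Z e' → e'.1.1 = -e.1.1 → e'.1.2 = -e.1.2 → False := by
      intro e e' he he' h1 h2
      have : e' = antipode hs heven e := Subtype.ext (Prod.ext h1 h2)
      rw [this] at he'
      exact not_sameCycle_antipode hd hs heven e (he.symm.trans he')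
    have sgn : ∀ e : OutEdge K s, s e.1.1 ≠ s (-e.1.2) := by
      intro e
      rw [hs.neg_eq heven, e.2.2.1, e.2.2.2]
      decide
    have sgn' : ∀ e e' : OutEdge K s, e'.1.1 ≠ -e.1.2 := by
      intro e e' h
      have h1 := sgn e
      rw [← h, e.2.2.1, e'.2.2.1] at h1
      exact h1 rfl
    rintro x y ⟨e, he, h | h⟩ ⟨e', he', h' | h'⟩
    · exact key e e' he he' (by rw [h, h']) (by rw [h, h'])
    · exact sgn' e e' (by rw [h, h']; rfl)
    · exact sgn' e e' (by rw [h, h']; rfl)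
    · exact key e e' he he' (by rw [h, h']; rfl) (by rw [h, h']; rfl)
  set ω : OctPoint d → OctPoint d → ZMod 2 := fun x y => if onPairs Z (x, y) then 1 else 0 with hω
  have hsymm : ∀ x y, ω x y = ω y x := by
    intro x y
    simp only [hω, onPairs_swap (u := x)]
  obtain ⟨g, hg⟩ := hex ω hsymm (cocycle_of_bicolored (s := s) hsymm
    (fun x y hxy => if_neg fun h => onPairs_ne h hxy)
    (fun x y z ht h1 h2 => by simp only [hω, onPairs_tri hd subset_rfl hP ht h1 h2]))
  have hgm : ∀ x y, K.Edge x y → s x = s y → g x = g y := by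
    intro x y hxy hs'
    rw [← zmod_add_eq_zero, ← hg x y hxy]
    exact if_neg fun h => onPairs_ne h hs'
  have hg0 : g u₀ = g (-u₀) := hm.eq_of hgm
  refine ⟨e₀, g, fun x y hxy hn => ?_, hg0, ?_⟩
  · by_cases hsxy : s x = s y
    · exact hgm x y hxy hsxy
    · rw [← zmod_add_eq_zero, ← hg x y hxy]
      exact if_neg fun h => hn ⟨hsxy, (hpairs x y).2 (Or.inl h)⟩
  · -- the sum of the potentials of the two antipodal walks is the potential of the component
    have hconst : ∀ x y, K.Edge x y → f x + (g x + g (-x)) = f y + (g y + g (-y)) := by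
      intro x y hxy
      have h1 := hg x y hxy
      have h2 := hg (-x) (-y) hxy.neg
      have h3 : f x + f y = ω x y + ω (-x) (-y) := by
        by_cases hc : s x ≠ s y ∧ CurveRel K.tris s e₀.1 (x, y)
        · rw [hf1 x y hxy hc.1 hc.2]
          rcases (hpairs x y).1 hc.2 with h | h
          · simp only [hω, if_pos h, if_neg (hexcl _ _ h), add_zero]
          · have h' : ¬ onPairs Z (x, y) := fun h' => hexcl _ _ h' h
            simp only [hω, if_pos h, if_neg h', zero_add]
        · rw [hf0 x y hxy hc]
          have h4 : ¬ onPairs Z (x, y) := fun h => hc ⟨onPairs_ne h, (hpairs _ _).2 (Or.inl h)⟩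
          have h5 : ¬ onPairs Z (-x, -y) := fun h =>
            hc ⟨hs.ne_neg.1 (onPairs_ne h), (hpairs _ _).2 (Or.inr h)⟩
          simp only [hω, if_neg h4, if_neg h5, add_zero]
      rw [← zmod_add_eq_zero]
      rw [h1, h2] at h3
      linear_combination h3 + zmod_add_self (g x + g (-x)) + zmod_add_self (g y + g (-y))
    have h1 := hcon _ hconst u u₀
    rw [← hg0, zmod_add_self, add_zero] at h1
    intro h2
    rw [← h2, zmod_add_self, add_zero] at h1
    exact hfu h1

/-! ### The root region -/

lemma EdgeConnected.exists_tri (hd : 1 ≤ d) (hcon : K.EdgeConnected) (u : OctPoint d) :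
    ∃ v w, {u, v, w} ∈ K.tris := by
  classical
  by_contra! hno
  have h1 := hcon (fun x => if x = u then 1 else 0) (fun x y hxy => ?_) u (-u)
  · simp only [if_true, if_neg (neg_ne_self hd u)] at h1
    exact absurd h1 (by decide)
  · have hx : x ≠ u := by
      rintro rfl
      obtain ⟨w, hw⟩ := hxy
      exact hno y w hw
    have hy : y ≠ u := by
      rintro rfl
      obtain ⟨w, hw⟩ := hxy.symm
      exact hno x w hw
    simp only [if_neg hx, if_neg hy]

lemma isTop_vertexPoint (hd : 1 ≤ d) (hcon : K.EdgeConnected) {u p : OctPoint d}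
    (h : K.IsTop (vertexPoint u) p) : p = u := by
  obtain ⟨v, w, ht⟩ := hcon.exists_tri hd u
  obtain ⟨-, h2, h3, h4⟩ := hat_three ht (a := 1) (b := 0) (c := 0) (by norm_num) le_rfl le_rfl
    (by norm_num) (x := (vertexPoint u).1) (by simp [vertexPoint])
  by_contra hp
  have hpos := h.pos
  by_cases p2 : p = v
  · rw [p2, h2] at hpos; exact lt_irrefl _ hpos
  by_cases p3 : p = w
  · rw [p3, h3] at hpos; exact lt_irrefl _ hpos
  rw [h4 p hp p2 p3] at hpos
  exact lt_irrefl _ hpos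

lemma vertexPoint_injective : Function.Injective (vertexPoint (d := d)) :=
  fun _ _ h => toSpace_injective (congrArg Subtype.val h)

/-- In even degree, if antipodal points are joined by a monochromatic path, then the root region has
the sign of this path: each vertex of the other sign lies inside of an oval. -/
lemma sign_eq_of_inRootRegion (hd : 1 ≤ d) (heven : Even d) (σ : SignDistribution d)
    (hex : K.CocyclesExact) (hcon : K.EdgeConnected) {u u₀ : OctPoint d}
    (hm : K.MonoPath (octSign σ) u₀ (-u₀)) {v : Vertex d} (hu : v.1 = coverMap (vertexPoint u))
    (hv : InRootRegion (K.planeComplex hd) σ v) : octSign σ u = octSign σ u₀ := by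
  by_contra hne
  have hs := octSign_alternates σ
  set s := octSign σ with hsdef
  obtain ⟨e₀, g, hg, hg0, hgu⟩ := exists_separating_walk hd heven hs hex hcon hne hm
  set O := K.classSet s e₀.1 with hO
  have hOc : IsClosed O := classSet_closed _
  have hgneg : ∀ x y, K.Edge x y → ¬ (s x ≠ s y ∧ CurveRel K.tris s e₀.1 (x, y)) →
      g (-x) = g (-y) := by
    intro x y hxy hn
    refine hg _ _ hxy.neg fun h => hn ⟨hs.ne_neg.1 h.1, h.2.trans (CurveRel.neg x y).symm⟩
  -- off the oval, the potential is constant on the top vertices of a point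
  have tops_eq : ∀ x : octahedron d, coverMap x ∉ O → ∀ p p', K.IsTop x p → K.IsTop x p' →
      g p = g p' ∧ g (-p) = g (-p') := by
    intro x hx p p' hp hp'
    by_cases hpp : p = p'
    · rw [hpp]; exact ⟨rfl, rfl⟩
    have hedge := tops_edge hp hp' hpp
    have hn : ¬ (s p ≠ s p' ∧ CurveRel K.tris s e₀.1 (p, p')) :=
      fun h => hx ⟨(p, p'), h.2, h.1, x, ⟨hp, hp'⟩, rfl⟩
    exact ⟨hg _ _ hedge hn, hgneg _ _ hedge hn⟩
  have part_open : ∀ Q : OctPoint d → Prop,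
      IsOpen {x : octahedron d | coverMap x ∉ O ∧ ∀ p, K.IsTop x p → Q p} := by
    intro Q
    have : {x : octahedron d | coverMap x ∉ O ∧ ∀ p, K.IsTop x p → Q p}
        = (coverMap ⁻¹' O)ᶜ ∩ ⋂ p : {p // ¬ Q p}, {x : octahedron d | K.IsTop x p.1}ᶜ := by
      ext x
      simp only [Set.mem_ofPred_eq, Set.mem_inter_iff, Set.mem_compl_iff, Set.mem_preimage,
        Set.mem_iInter]
      exact ⟨fun h => ⟨h.1, fun p hp => p.2 (h.2 p.1 hp)⟩,
        fun h => ⟨h.1, fun p hp => by_contra fun hQ => h.2 ⟨p, hQ⟩ hp⟩⟩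
    rw [this]
    exact (hOc.preimage coverMap_continuous).isOpen_compl.inter
      (isOpen_iInter_of_finite fun p => (isClosed_top p.1).isOpen_compl)
  -- the images of `A` and `B` are the two sides of the oval; the preimage of the first one consists
  -- of the two disjoint sets `A` and `-A`
  set A : Set (octahedron d) :=
    {x | coverMap x ∉ O ∧ ∀ p, K.IsTop x p → g p ≠ g (-p) ∧ g p = 1} with hA
  set B : Set (octahedron d) := {x | coverMap x ∉ O ∧ ∀ p, K.IsTop x p → g p = g (-p)} with hB
  have hAopen : IsOpen A := part_open _
  have hBopen : IsOpen B := part_open _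
  have hanti : ∀ x ∈ A, -x ∉ A := by
    intro x hx hx'
    obtain ⟨p, hp⟩ := exists_top (K := K) x
    have h1 := hx.2 p hp
    have h2 := hx'.2 (-p) (isTop_neg.2 hp)
    exact h1.1 (h1.2.trans h2.2.symm)
  have hcover : Oᶜ ⊆ coverMap '' A ∪ coverMap '' B := by
    intro y hy
    obtain ⟨x, rfl⟩ := coverMap_surjective y
    obtain ⟨p, hp⟩ := exists_top (K := K) x
    by_cases h : g p = g (-p)
    · right
      refine ⟨x, ⟨hy, fun p' hp' => ?_⟩, rfl⟩
      obtain ⟨h1, h2⟩ := tops_eq x hy p p' hp hp'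
      rw [← h1, ← h2, h]
    · left
      by_cases h1 : g p = 1
      · refine ⟨x, ⟨hy, fun p' hp' => ?_⟩, rfl⟩
        obtain ⟨h2, h3⟩ := tops_eq x hy p p' hp hp'
        rw [← h2, ← h3]
        exact ⟨h, h1⟩
      · have h0 : g p = 0 := (zmod_two_cases _).resolve_right h1
        have h1' : g (-p) = 1 := (zmod_two_cases _).resolve_left fun h' => h (h0.trans h'.symm)
        refine ⟨-x, ⟨by rwa [coverMap_neg], fun p' hp' => ?_⟩, coverMap_neg x⟩
        have hp'' : K.IsTop x (-p') := by rwa [← isTop_neg, neg_neg]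
        obtain ⟨h2, h3⟩ := tops_eq x hy p (-p') hp hp''
        rw [neg_neg] at h3
        rw [← h2, ← h3]
        exact ⟨fun h' => h h'.symm, h1'⟩
  have hdisj : Disjoint (coverMap '' A) (coverMap '' B) := by
    rw [Set.disjoint_left]
    rintro _ ⟨x, hx, rfl⟩ ⟨x', hx', hxx⟩
    obtain ⟨p, hp⟩ := exists_top (K := K) x
    have h1 := (hx.2 p hp).1
    rcases coverMap_eq_iff.1 hxx with h | h
    · rw [h] at hp; exact h1 (hx'.2 p hp)
    · rw [h] at hp
      have := hx'.2 (-p) (by rwa [← isTop_neg, neg_neg])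
      rw [neg_neg] at this
      exact h1 this.symm
  have hAsub : coverMap '' A ⊆ Oᶜ := by
    rintro _ ⟨x, hx, rfl⟩; exact hx.1
  have vertex_off : ∀ w : OctPoint d, coverMap (vertexPoint w) ∉ O := by
    rintro w ⟨f, -, hf, x, hx, hxw⟩
    rcases coverMap_eq_iff.1 hxw with h | h
    · rw [← h] at hx
      exact hf (by rw [isTop_vertexPoint hd hcon hx.1, isTop_vertexPoint hd hcon hx.2])
    · have hx' : x = vertexPoint (-w) := by rw [vertexPoint_neg, h, neg_neg]
      rw [hx'] at hx
      exact hf (by rw [isTop_vertexPoint hd hcon hx.1, isTop_vertexPoint hd hcon hx.2])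
  have vertex_in : ∀ w : OctPoint d, g w ≠ g (-w) → coverMap (vertexPoint w) ∈ coverMap '' A := by
    intro w hw
    rcases hcover (vertex_off w) with h | ⟨x, hx, hxw⟩
    · exact h
    · exfalso
      obtain ⟨p, hp⟩ := exists_top (K := K) (vertexPoint w)
      obtain rfl := isTop_vertexPoint hd hcon hp
      rcases coverMap_eq_iff.1 hxw with h | h
      · exact hw (hx.2 _ (h ▸ hp))
      · have h1 : x = -vertexPoint p := by rw [h, neg_neg]
        have := hx.2 (-p) (by rw [h1]; exact isTop_neg.2 hp)
        rw [neg_neg] at this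
        exact hw this.symm
  have hOval : IsOval (patchworkedCurve (K.planeComplex hd) σ) O := by
    rw [patchworkedCurve_planeComplex]
    constructor
    · obtain ⟨x, hx⟩ := cell_nonempty e₀.2.1
      refine ⟨coverMap x, ⟨x, ⟨_, _, e₀.bicolored.2, hx⟩, rfl⟩, ?_⟩
      rw [hO, ← component_eq_classSet hs e₀.bicolored, edgeComponent_eq e₀.bicolored.2 hx]
    · intro hpre
      have hu0 : coverMap (vertexPoint u₀) ∈ coverMap '' B := by
        refine ⟨_, ⟨vertex_off u₀, fun p hp => ?_⟩, rfl⟩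
        rw [isTop_vertexPoint hd hcon hp]
        exact hg0
      obtain ⟨y, -, hy1, hy2⟩ := hpre _ _ (coverMap_isOpenMap A hAopen)
        (coverMap_isOpenMap B hBopen) hcover ⟨_, vertex_off u, vertex_in u hgu⟩
        ⟨_, vertex_off u₀, hu0⟩
      exact Set.disjoint_left.1 hdisj hy1 hy2
  obtain ⟨R, hR, hvR⟩ := hv
  refine hR O hOval fun v' hv' => ?_
  -- the potential is constant along the region of `v`
  have hreach : (monochromaticGraph (K.planeComplex hd) σ).Reachable v v' :=
    SimpleGraph.ConnectedComponent.exact (hvR.trans hv'.symm)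
  have inside : ∃ w, v'.1 = coverMap (vertexPoint w) ∧ g w ≠ g (-w) := by
    have adj : ∀ v₁ v₂ : Vertex d, (monochromaticGraph (K.planeComplex hd) σ).Adj v₁ v₂ →
        (∃ w, v₁.1 = coverMap (vertexPoint w) ∧ g w ≠ g (-w)) →
        ∃ w, v₂.1 = coverMap (vertexPoint w) ∧ g w ≠ g (-w) := by
      have key : ∀ v₁ v₂ : Vertex d, (∃ x y, K.Edge x y ∧ s x = s y ∧
          v₁.1 = coverMap (vertexPoint x) ∧ v₂.1 = coverMap (vertexPoint y)) →
          (∃ w, v₁.1 = coverMap (vertexPoint w) ∧ g w ≠ g (-w)) →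
          ∃ w, v₂.1 = coverMap (vertexPoint w) ∧ g w ≠ g (-w) := by
        rintro v₁ v₂ ⟨x, y, hxy, hsxy, hx, hy⟩ ⟨w, hw, hgw⟩
        refine ⟨y, hy, ?_⟩
        rw [← hg x y hxy fun h => h.1 hsxy, ← hgneg x y hxy fun h => h.1 hsxy]
        rcases coverMap_eq_iff.1 (hw.symm.trans hx) with h | h
        · rwa [vertexPoint_injective h]
        · rw [← vertexPoint_neg] at h
          rw [vertexPoint_injective h, neg_neg]
          exact hgw.symm
      have edge : ∀ v₁ v₂ : Vertex d, (∃ (g : Klein) (p q : latticeTriangle d),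
          IsEdge (K.planeComplex hd) p q ∧ extendSign σ (reflect g p) = extendSign σ (reflect g q) ∧
          v₁.1 = latticePoint (reflect g p) ∧ v₂.1 = latticePoint (reflect g q)) →
          ∃ x y, K.Edge x y ∧ s x = s y ∧
          v₁.1 = coverMap (vertexPoint x) ∧ v₂.1 = coverMap (vertexPoint y) := by
        rintro v₁ v₂ ⟨k, p, q, hpq, hsg, h1, h2⟩
        rw [isEdge_planeComplex] at hpq
        rw [← octSign_reflect, ← octSign_reflect] at hsg
        rw [latticePoint_reflect] at h1 h2
        exact ⟨_, _, hpq.reflect (spaceKlein k), hsg, h1, h2⟩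
      rintro v₁ v₂ ⟨-, h | h⟩
      · exact key v₁ v₂ (edge v₁ v₂ h)
      · obtain ⟨x, y, h1, h2, h3, h4⟩ := edge v₂ v₁ h
        exact key v₁ v₂ ⟨y, x, h1.symm, h2.symm, h4, h3⟩
    rw [SimpleGraph.reachable_iff_reflTransGen] at hreach
    clear hv'
    induction hreach with
    | refl => exact ⟨u, hu, hgu⟩
    | tail _ h ih => exact adj _ _ h ih
  obtain ⟨w, hw, hgw⟩ := inside
  rw [hw]
  refine ⟨vertex_off w, fun y γ hγ => ?_⟩
  refine loop_contractible hd hAopen hanti γ (hγ.trans ?_)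
  refine isPreconnected_connectedComponentIn.subset_left_of_subset_union
    (coverMap_isOpenMap A hAopen) (coverMap_isOpenMap B hBopen) hdisj
    ((connectedComponentIn_subset _ _).trans hcover) ?_
  exact ⟨_, mem_connectedComponentIn (vertex_off w), vertex_in w hgw⟩

end OctTriangulation

/-! ### The signs of the copies of a parallelogram -/

/-- The class in `𝔽₂` of the exponent `k` of a unit `(-1)ᵏ`. -/
def unitParity (e : ℤˣ) : ZMod 2 := if e = 1 then 0 else 1

lemma unitParity_neg (e : ℤˣ) : unitParity (-e) = unitParity e + 1 := by
  revert e; decide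

lemma unitParity_injective : Function.Injective unitParity := by
  intro e e'
  revert e e'; decide

lemma exists_unitParity (x : ZMod 2) : ∃ e, unitParity e = x := by
  revert x; decide

lemma ite_units_mul_neg (e : ℤˣ) {z : ℤ} (hz : 0 ≤ z) :
    (if (e : ℤ) * z < 0 then (((e : ℤ) * z : ℤ) : ZMod 2) else 0) = unitParity e * z := by
  rcases Int.units_eq_one_or e with rfl | rfl
  · rw [if_neg (by simpa using hz), unitParity, if_pos rfl, zero_mul]
  · rw [show unitParity (-1) = 1 from rfl, one_mul]
    rcases hz.eq_or_lt with rfl | hz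
    · simp
    · rw [if_pos (by simpa using hz)]
      simp [CharTwo.neg_eq]

lemma octSign_octReflect (σ : SignDistribution d) (g : Fin 3 → ℤˣ) {u : OctPoint d}
    (hu : ∀ i, 0 ≤ u.1 i) :
    octSign σ (octReflect g u) = octSign σ u + ∑ i, unitParity (g i) * (u.1 i : ZMod 2) := by
  have habs : ∀ i, |(octReflect g u).1 i| = |u.1 i| := by
    intro i
    rcases Int.units_eq_one_or (g i) with h | h <;> simp [h]
  have h0 : (∑ i, if u.1 i < 0 then (u.1 i : ZMod 2) else 0) = 0 :=
    Finset.sum_eq_zero fun i _ => if_neg (hu i).not_gt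
  have h1 : ∀ i, (if (octReflect g u).1 i < 0 then ((octReflect g u).1 i : ZMod 2) else 0)
      = unitParity (g i) * u.1 i := fun i => ite_units_mul_neg _ (hu i)
  simp only [octSign, habs, h0, add_zero, h1]

lemma octSign_octLift (σ : SignDistribution d) (p : latticeTriangle d) :
    octSign σ (octLift p) = σ p := by
  have h := octLift_nonneg p
  rw [octSign, Finset.sum_eq_zero fun i _ => if_neg (h i).not_gt, add_zero]
  congr 1
  exact Subtype.ext (Prod.ext (abs_of_nonneg (h 0)) (abs_of_nonneg (h 1)))

lemma extendSign_reflect (σ : SignDistribution d) (g : Klein) (p : latticeTriangle d) :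
    extendSign σ (reflect g p) = σ p + unitParity g.1 * p.1.1 + unitParity g.2 * p.1.2 := by
  rw [← octSign_reflect, octSign_octReflect _ _ (octLift_nonneg p), octSign_octLift,
    Fin.sum_univ_three, ← add_assoc, ← add_assoc]
  simp [spaceKlein, octLift, show unitParity 1 = 0 from rfl]

lemma exists_vertexPoint (v : Vertex d) : ∃ u : OctPoint d, v.1 = coverMap (vertexPoint u) := by
  obtain ⟨_, u, rfl⟩ := v
  have key : ∀ z : ℤ, ∃ e : ℤˣ, z = e * |z| := by
    intro z
    rcases abs_choice z with h | h
    · exact ⟨1, by simp [h]⟩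
    · exact ⟨-1, by simp [h]⟩
  obtain ⟨α, hα⟩ := key u.1.1
  obtain ⟨β, hβ⟩ := key u.1.2
  have hu : u = reflect (α, β) (foldPoint u) := Subtype.ext (Prod.ext hα hβ)
  exact ⟨_, (congrArg latticePoint hu).trans (latticePoint_reflect _ _)⟩

namespace OctTriangulation

/-! ### Flips and root isotopy -/

variable {K K' : OctTriangulation d} {s : OctPoint d → ZMod 2} {a b c e : OctPoint d}

lemma GoodCopy.swap {g : Fin 3 → ℤˣ} (h : GoodCopy s a b c e g) : GoodCopy s a e c b g := by
  rcases h with ⟨h1, h2⟩ | ⟨h1, h2, h3⟩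
  · exact Or.inl ⟨h1, h2.symm⟩
  · exact Or.inr ⟨h1, h2.symm, h3.trans h2.symm⟩

/-- A flip in a parallelogram which has, up to the antipode, just one copy with alternating signs
changes the number of components of the curve or moves its root region. -/
lemma IsFlip.false_of_ncard_eq (hd : 1 ≤ d) (σ : SignDistribution d) (h : IsFlip K K' a b c e)
    (hex : K.CocyclesExact) (hcon : K.EdgeConnected) {g : Fin 3 → ℤˣ}
    (hgood : ∀ g', g' ≠ g → g' ≠ -g → GoodCopy (octSign σ) a b c e g')
    (hac : octSign σ (octReflect g a) = octSign σ (octReflect g c))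
    (hbe : octSign σ (octReflect g b) = octSign σ (octReflect g e))
    (hA : octSign σ (octReflect g a) = 1) (hB : octSign σ (octReflect g b) = 0)
    (ho : 0 < orient (octReflect g a) (octReflect g c) (octReflect g e))
    (hcard : (componentsOf (patchworkedCurve (K.planeComplex hd) σ)).ncard
      = (componentsOf (patchworkedCurve (K'.planeComplex hd) σ)).ncard)
    {v : Vertex d} (hv : InRootRegion (K.planeComplex hd) σ v)
    (hv' : InRootRegion (K'.planeComplex hd) σ v) : False := by
  rcases h.components_or_monoPath hd (octSign_alternates σ) hgood hA (hac ▸ hA) hB (hbe ▸ hB) ho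
    with h1 | ⟨heven, h1, h2⟩
  · rw [patchworkedCurve_planeComplex, patchworkedCurve_planeComplex] at hcard
    exact h1 hcard
  · obtain ⟨u, hu⟩ := exists_vertexPoint v
    have e1 := sign_eq_of_inRootRegion hd heven σ hex hcon h1 hu hv
    have e2 := sign_eq_of_inRootRegion hd heven σ (h.cocyclesExact hd hex)
      (h.edgeConnected hd hcon) h2 hu hv'
    rw [e1, hA, hB] at e2
    exact absurd e2 (by decide)

lemma IsFlip.not_rootIsotopic (hd : 1 ≤ d) (σ : SignDistribution d) (h : IsFlip K K' a b c e)
    (hex : K.CocyclesExact) (hcon : K.EdgeConnected) {g : Fin 3 → ℤˣ}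
    (hgood : ∀ g', g' ≠ g → g' ≠ -g → GoodCopy (octSign σ) a b c e g')
    (hac : octSign σ (octReflect g a) = octSign σ (octReflect g c))
    (hbe : octSign σ (octReflect g b) = octSign σ (octReflect g e))
    (hab : octSign σ (octReflect g a) ≠ octSign σ (octReflect g b))
    (ho : 0 < orient (octReflect g a) (octReflect g c) (octReflect g e)) :
    ¬ RootIsotopic (K.planeComplex hd) σ (K'.planeComplex hd) σ := by
  rintro ⟨hiso, v, hv, hv'⟩
  have hcard := ncard_componentsOf_eq hiso
  rcases zmod_two_cases (octSign σ (octReflect g a)) with hA | hA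
  · have hB := (zmod_two_cases (octSign σ (octReflect g b))).resolve_left (hA ▸ hab.symm)
    refine (h.symm hd).false_of_ncard_eq hd σ (h.cocyclesExact hd hex) (h.edgeConnected hd hcon)
      (fun g' h1 h2 => (hgood g' h1 h2).rotate) hbe hac.symm hB (hac ▸ hA) ?_ hcard.symm hv' hv
    rw [orient_octReflect] at ho ⊢
    have hbea : orient b e a = orient a c e := by
      rw [orient_rotate, h.quad.orient_abe, h.quad.orient_e]
      unfold orient
      ring
    rwa [hbea]
  · have hB := (zmod_two_cases (octSign σ (octReflect g b))).resolve_right (hA ▸ hab.symm)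
    exact h.false_of_ncard_eq hd σ hex hcon hgood hac hbe hA hB ho hcard hv hv'

/-- If the signs alternate on just one copy of a parallelogram and its antipode, and have even sum on
the other copies, then flipping the parallelogram leads to a curve which is not root isotopic. -/
lemma IsQuad.exists_not_rootIsotopic (hd : 1 ≤ d) (σ : SignDistribution d) (h : K.IsQuad a b c e)
    (hex : K.CocyclesExact) (hcon : K.EdgeConnected) {g : Fin 3 → ℤˣ}
    (hgood : ∀ g', g' ≠ g → g' ≠ -g → GoodCopy (octSign σ) a b c e g')
    (hac : octSign σ (octReflect g a) = octSign σ (octReflect g c))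
    (hbe : octSign σ (octReflect g b) = octSign σ (octReflect g e))
    (hab : octSign σ (octReflect g a) ≠ octSign σ (octReflect g b)) :
    ∃ K' : OctTriangulation d, ¬ RootIsotopic (K.planeComplex hd) σ (K'.planeComplex hd) σ := by
  have hne := orient_ne_zero hd (tri_reflect g h.tri_ace)
  rcases hne.lt_or_gt with ho | ho
  · refine ⟨_, (isFlip_flip hd h.swap).not_rootIsotopic hd σ hex hcon
      (fun g' h1 h2 => (hgood g' h1 h2).swap) hac hbe.symm (hbe ▸ hab) ?_⟩
    rw [orient_octReflect] at ho ⊢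
    rw [h.orient_e] at ho
    linarith
  · exact ⟨_, (isFlip_flip hd h).not_rootIsotopic hd σ hex hcon hgood hac hbe hab ho⟩

end OctTriangulation

/-! ### Parallelograms in the honeycomb triangulation -/

lemma honeycomb_isQuad (hd : 1 ≤ d) {i j k : Fin 3} (hij : i ≠ j) (hik : i ≠ k) (hjk : j ≠ k)
    {m : Fin 3 → ℤ} (hm : ∀ t, 0 ≤ m t) (hk : 1 ≤ m k) {a b c e : OctPoint d}
    (ha : a.1 = m + Pi.single i 1) (hb : b.1 = m + Pi.single k 1) (hc : c.1 = m + Pi.single j 1)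
    (he : e.1 = m + Pi.single i 1 + Pi.single j 1 - Pi.single k 1) :
    (honeycomb d hd).IsQuad a b c e := by
  have ha' : ∀ t, a.1 t = m t + if t = i then 1 else 0 := fun t => by simp [ha, Pi.single_apply]
  have hb' : ∀ t, b.1 t = m t + if t = k then 1 else 0 := fun t => by simp [hb, Pi.single_apply]
  have hc' : ∀ t, c.1 t = m t + if t = j then 1 else 0 := fun t => by simp [hc, Pi.single_apply]
  have he' : ∀ t, e.1 t = m t + (if t = i then 1 else 0) + (if t = j then 1 else 0)
      - if t = k then 1 else 0 := fun t => by simp [he, Pi.single_apply]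
  have ne_of : ∀ {u v : OctPoint d} (t : Fin 3), u.1 t ≠ v.1 t → u ≠ v :=
    fun t h h' => h (h' ▸ rfl)
  refine ⟨mem_honeycombTris.2 ⟨⟨ne_of i ?_, ne_of i ?_, ne_of j ?_⟩, fun t => ?_⟩,
    mem_honeycombTris.2 ⟨⟨ne_of i ?_, ne_of j ?_, ne_of i ?_⟩, fun t => ?_⟩,
    fun t => ?_, fun t => ?_, fun t => ?_, fun t => ?_, fun t => ?_⟩
  · rw [ha', hb', if_pos rfl, if_neg hik]; omega
  · rw [ha', hc', if_pos rfl, if_neg hij]; omega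
  · rw [hb', hc', if_pos rfl, if_neg hjk]; omega
  · rw [ha', hb', hc']
    simp only [abs_le]
    split_ifs <;> omega
  · rw [ha', hc', if_pos rfl, if_neg hij]; omega
  · rw [ha', he', if_pos rfl, if_neg hjk, if_neg hij.symm]; omega
  · rw [hc', he', if_pos rfl, if_neg hij, if_neg hik]; omega
  · rw [ha', hc', he']
    simp only [abs_le]
    split_ifs <;> omega
  · rw [ha', hb', hc', he']; ring
  all_goals have h1 := hm t
  · rw [ha']; split_ifs <;> omega
  · rw [hb']; split_ifs <;> omega
  · rw [hc']; split_ifs <;> omega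
  · rw [he']
    by_cases htk : t = k
    · rw [htk, if_pos rfl]; split_ifs <;> omega
    · rw [if_neg htk]; split_ifs <;> omega

lemma sum_unitParity_single (g : Fin 3 → ℤˣ) (i : Fin 3) :
    ∑ t, unitParity (g t) * (((Pi.single i 1 : Fin 3 → ℤ) t : ℤ) : ZMod 2) = unitParity (g i) := by
  rw [Finset.sum_eq_single i (fun t _ ht => by simp [ht]) (fun h => absurd (Finset.mem_univ _) h)]
  simp

/-- If the patchworked curves of all triangulations are root isotopic, then each parallelogram of
the honeycomb triangulation has an odd number of vertices of sign one. Otherwise the signs alternate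
on two antipodal copies of it and on no other copy. -/
lemma sum_honeycomb_quad_eq_one (hd : 1 ≤ d) (σ : SignDistribution d)
    (hσ : ∀ T T' : Geometry.SimplicialComplex ℝ (ℝ × ℝ),
      IsUnimodularTriangulation d T → IsUnimodularTriangulation d T' → RootIsotopic T σ T' σ)
    {i j k : Fin 3} (hij : i ≠ j) (hik : i ≠ k) (hjk : j ≠ k)
    {m : Fin 3 → ℤ} (hm : ∀ t, 0 ≤ m t) (hk : 1 ≤ m k) {a b c e : OctPoint d}
    (ha : a.1 = m + Pi.single i 1) (hb : b.1 = m + Pi.single k 1) (hc : c.1 = m + Pi.single j 1)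
    (he : e.1 = m + Pi.single i 1 + Pi.single j 1 - Pi.single k 1) :
    octSign σ a + octSign σ b + octSign σ c + octSign σ e = 1 := by
  by_contra hsum
  replace hsum := (OctTriangulation.zmod_two_cases _).resolve_right hsum
  have hq := honeycomb_isQuad hd hij hik hjk hm hk ha hb hc he
  set s := octSign σ with hs
  set M : (Fin 3 → ℤˣ) → ZMod 2 := fun g => ∑ t, unitParity (g t) * (m t : ZMod 2) with hM
  have sa : ∀ g, s (octReflect g a) = s a + (M g + unitParity (g i)) := by
    intro g
    rw [hs, octSign_octReflect σ g hq.nonneg_a, ha, ← sum_unitParity_single g i, hM,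
      ← Finset.sum_add_distrib]
    simp only [Pi.add_apply, Int.cast_add, mul_add]
  have sb : ∀ g, s (octReflect g b) = s b + (M g + unitParity (g k)) := by
    intro g
    rw [hs, octSign_octReflect σ g hq.nonneg_b, hb, ← sum_unitParity_single g k, hM,
      ← Finset.sum_add_distrib]
    simp only [Pi.add_apply, Int.cast_add, mul_add]
  have sc : ∀ g, s (octReflect g c) = s c + (M g + unitParity (g j)) := by
    intro g
    rw [hs, octSign_octReflect σ g hq.nonneg_c, hc, ← sum_unitParity_single g j, hM,
      ← Finset.sum_add_distrib]
    simp only [Pi.add_apply, Int.cast_add, mul_add]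
  have se : ∀ g, s (octReflect g e)
      = s e + (M g + unitParity (g i) + unitParity (g j) - unitParity (g k)) := by
    intro g
    rw [hs, octSign_octReflect σ g hq.nonneg_e, he, ← sum_unitParity_single g i,
      ← sum_unitParity_single g j, ← sum_unitParity_single g k, hM, ← Finset.sum_add_distrib,
      ← Finset.sum_add_distrib, ← Finset.sum_sub_distrib]
    simp only [Pi.add_apply, Pi.sub_apply, Int.cast_add, Int.cast_sub, mul_add, mul_sub]
  -- up to a common sign, the reflection with alternating signs on the copy is determined by the signs
  obtain ⟨χi, hχi⟩ := exists_unitParity (s a + s b + 1)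
  obtain ⟨χj, hχj⟩ := exists_unitParity (s b + s c + 1)
  set g : Fin 3 → ℤˣ := fun t => if t = i then χi else if t = j then χj else 1 with hg
  have gi : unitParity (g i) = s a + s b + 1 := by rw [← hχi, hg]; simp
  have gj : unitParity (g j) = s b + s c + 1 := by rw [← hχj, hg]; simp [hij.symm]
  have gk : unitParity (g k) = 0 := by simp [hg, hik.symm, hjk.symm, unitParity]
  have huniv : ∀ t : Fin 3, t = i ∨ t = j ∨ t = k := by
    intro t
    have := i.2
    have := j.2
    have := k.2
    have := t.2
    rw [Ne, Fin.ext_iff] at hij hik hjk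
    simp only [Fin.ext_iff]
    omega
  have hgood : ∀ g', g' ≠ g → g' ≠ -g → OctTriangulation.GoodCopy s a b c e g' := by
    intro g' h1 h2
    by_contra hbad
    rw [OctTriangulation.GoodCopy] at hbad
    have key : unitParity (g' i) = unitParity (g i) + unitParity (g' k) ∧
        unitParity (g' j) = unitParity (g j) + unitParity (g' k) := by
      rw [sa, sb, sc, se] at hbad
      rw [gi, gj]
      revert hbad hsum
      generalize s a = A
      generalize s b = B
      generalize s c = C
      generalize s e = E
      generalize M g' = X
      generalize unitParity (g' i) = x
      generalize unitParity (g' j) = y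
      generalize unitParity (g' k) = z
      clear * -
      revert A B C E X x y z
      decide
    rcases OctTriangulation.zmod_two_cases (unitParity (g' k)) with hz | hz
    · refine h1 (funext fun t => unitParity_injective ?_)
      rcases huniv t with rfl | rfl | rfl
      · rw [key.1, hz, add_zero]
      · rw [key.2, hz, add_zero]
      · rw [hz, gk]
    · refine h2 (funext fun t => unitParity_injective ?_)
      rw [Pi.neg_apply, unitParity_neg]
      rcases huniv t with rfl | rfl | rfl
      · rw [key.1, hz]
      · rw [key.2, hz]
      · rw [hz, gk, zero_add]
  have hac : s (octReflect g a) = s (octReflect g c) := by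
    rw [sa, sc, gi, gj, ← sub_eq_zero]
    linear_combination zmod_add_self (s a) - zmod_add_self (s c)
  have hbe : s (octReflect g b) = s (octReflect g e) := by
    rw [sb, se, gi, gj, gk]
    linear_combination -hsum - zmod_add_self 1
  have hab : s (octReflect g a) ≠ s (octReflect g b) := by
    rw [sa, sb, gi, gk]
    intro h
    have : (1 : ZMod 2) = 0 := by linear_combination h - zmod_add_self (s a)
    exact absurd this (by decide)
  obtain ⟨K', hK'⟩ := hq.exists_not_rootIsotopic hd σ (honeycomb_cocyclesExact hd)
    (honeycomb_edgeConnected hd) hgood hac hbe hab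
  exact hK' (hσ _ _ (OctTriangulation.isUnimodularTriangulation_planeComplex hd)
    (OctTriangulation.isUnimodularTriangulation_planeComplex hd))

/-! ### Sign distributions with odd parallelograms -/

lemma eq_affine_of_step_two {f : ℕ → ZMod 2} {n : ℕ} (h : ∀ y, y + 2 ≤ n → f (y + 2) = f y) :
    ∀ y, y ≤ n → f y = f 0 + (f 0 + f 1) * y := by
  intro y
  induction y using Nat.twoStepInduction with
  | zero => intro _; simp
  | one =>
    intro _
    push_cast
    linear_combination -zmod_add_self (f 0)
  | more y ih _ =>
    intro hy
    have h2 : (2 : ZMod 2) = 0 := rfl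
    rw [h y hy, ih (by omega)]
    push_cast
    linear_combination -(f 0 + f 1) * h2

/-- A function on the lattice points of the triangle which has odd sum over each parallelogram of
two adjacent unimodular triangles of the honeycomb triangulation differs from `xy` by an affine
function. -/
lemma eq_quadratic_of_odd_quads {F : ℕ → ℕ → ZMod 2} {n : ℕ}
    (h : ∀ x y, x + y + 2 ≤ n → F x y + F (x + 1) y + F x (y + 1) + F (x + 1) (y + 1) = 1)
    (hy : ∀ y, y + 2 ≤ n → F 0 (y + 1) + F 1 (y + 1) + F 0 (y + 2) + F 1 y = 1)
    (hx : ∀ x, x + 2 ≤ n → F (x + 1) 0 + F (x + 1) 1 + F (x + 2) 0 + F x 1 = 1) :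
    ∀ x y, x + y ≤ n →
      F x y = F 0 0 + (F 0 0 + F 1 0) * x + (F 0 0 + F 0 1) * y + x * y := by
  have h0y := eq_affine_of_step_two (f := fun y => F 0 y) (n := n) fun y hn => by
    have h1 := h 0 y (by omega)
    linear_combination hy y hn - h1
  have hx0 := eq_affine_of_step_two (f := fun x => F x 0) (n := n) fun x hn => by
    have h1 := h x 0 (by omega)
    linear_combination hx x hn - h1
  intro x
  induction x with
  | zero =>
    intro y hn
    have := h0y y (by omega)
    push_cast
    linear_combination this
  | succ x ih =>
    intro y
    induction y with
    | zero =>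
      intro hn
      have := hx0 (x + 1) (by omega)
      push_cast at this ⊢
      linear_combination this
    | succ y ihy =>
      intro hn
      have h1 := h x y (by omega)
      have h2 := ih y (by omega)
      have h3 := ih (y + 1) (by omega)
      have h4 := ihy (by omega)
      push_cast at h2 h3 h4 ⊢
      have two : (2 : ZMod 2) = 0 := rfl
      linear_combination h1 - h2 - h3 - h4 - (2 * F 0 0 + (F 0 0 + F 1 0) * (2 * x + 1)
        + (F 0 0 + F 0 1) * (2 * y + 1) + 2 * x * y + x + y) * two

lemma signEquivalent_harnackSign (σ : SignDistribution d) {α β γ : ZMod 2}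
    (h : ∀ p : latticeTriangle d, σ p = γ + α * p.1.1 + β * p.1.2 + p.1.1 * p.1.2) :
    SignEquivalent σ (harnackSign d) := by
  obtain ⟨e₁, h₁⟩ := exists_unitParity (α + 1)
  obtain ⟨e₂, h₂⟩ := exists_unitParity (β + 1)
  refine ⟨(e₁, e₂), γ + 1, fun p => ?_⟩
  rw [extendSign_reflect, h, h₁, h₂, harnackSign]
  push_cast
  linear_combination -zmod_add_self γ - zmod_add_self α * p.1.1 - zmod_add_self β * p.1.2

/-- A sign distribution for which all patchworked curves are root isotopic is equivalent to the
Harnack sign distribution. -/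
lemma signEquivalent_of_rootIsotopic (hd : 1 ≤ d) (σ : SignDistribution d)
    (hσ : ∀ T T' : Geometry.SimplicialComplex ℝ (ℝ × ℝ),
      IsUnimodularTriangulation d T → IsUnimodularTriangulation d T' → RootIsotopic T σ T' σ) :
    SignEquivalent σ (harnackSign d) := by
  classical
  set F : ℕ → ℕ → ZMod 2 := fun x y =>
    if h : x + y ≤ d then
      σ ⟨(x, y), by simp, by simp, by simp only; exact_mod_cast h⟩ else 0 with hF
  have hFσ : ∀ (x y : ℕ), x + y ≤ d → ∃ u : OctPoint d, u.1 = ![(x : ℤ), (y : ℤ), d - x - y] ∧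
      octSign σ u = F x y := by
    intro x y h
    refine ⟨octLift ⟨(x, y), by simp, by simp, by simp only; exact_mod_cast h⟩,
      rfl, ?_⟩
    rw [octSign_octLift, hF]
    simp only [dif_pos h]
  have quad : ∀ {i j k : Fin 3}, i ≠ j → i ≠ k → j ≠ k → ∀ {m : Fin 3 → ℤ}, (∀ t, 0 ≤ m t) →
      1 ≤ m k → ∀ {x₁ y₁ x₂ y₂ x₃ y₃ x₄ y₄ : ℕ}, x₁ + y₁ ≤ d → x₂ + y₂ ≤ d → x₃ + y₃ ≤ d →
      x₄ + y₄ ≤ d → ![(x₁ : ℤ), y₁, d - x₁ - y₁] = m + Pi.single i 1 →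
      ![(x₂ : ℤ), y₂, d - x₂ - y₂] = m + Pi.single k 1 →
      ![(x₃ : ℤ), y₃, d - x₃ - y₃] = m + Pi.single j 1 →
      ![(x₄ : ℤ), y₄, d - x₄ - y₄] = m + Pi.single i 1 + Pi.single j 1 - Pi.single k 1 →
      F x₁ y₁ + F x₂ y₂ + F x₃ y₃ + F x₄ y₄ = 1 := by
    intro i j k hij hik hjk m hm hk x₁ y₁ x₂ y₂ x₃ y₃ x₄ y₄ h₁ h₂ h₃ h₄ e₁ e₂ e₃ e₄
    obtain ⟨a, ha, ha'⟩ := hFσ x₁ y₁ h₁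
    obtain ⟨b, hb, hb'⟩ := hFσ x₂ y₂ h₂
    obtain ⟨c, hc, hc'⟩ := hFσ x₃ y₃ h₃
    obtain ⟨e, he, he'⟩ := hFσ x₄ y₄ h₄
    rw [← ha', ← hb', ← hc', ← he']
    exact sum_honeycomb_quad_eq_one hd σ hσ hij hik hjk hm hk (ha.trans e₁) (hb.trans e₂)
      (hc.trans e₃) (he.trans e₄)
  have hquad := eq_quadratic_of_odd_quads (F := F) (n := d) (fun x y hn => ?_) (fun y hn => ?_)
    (fun x hn => ?_)
  · refine signEquivalent_harnackSign σ (α := F 0 0 + F 1 0) (β := F 0 0 + F 0 1) (γ := F 0 0) ?_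
    rintro ⟨⟨x, y⟩, hx, hy, hxy⟩
    simp only at hx hy hxy
    lift x to ℕ using hx
    lift y to ℕ using hy
    have h : x + y ≤ d := by exact_mod_cast hxy
    have h1 := hquad x y h
    rw [hF] at h1 ⊢
    simp only [dif_pos h] at h1
    rw [h1]
    simp
  · have := quad (i := 0) (j := 1) (k := 2) (by decide) (by decide) (by decide)
      (m := ![x, y, d - x - y - 1]) (fun t => by fin_cases t <;> simp <;> omega)
      (by simp; omega) (x₁ := x + 1) (y₁ := y) (x₂ := x) (y₂ := y) (x₃ := x) (y₃ := y + 1)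
      (x₄ := x + 1) (y₄ := y + 1) (by omega) (by omega) (by omega) (by omega)
      (by funext t; simp only [Pi.add_apply]; fin_cases t <;> simp <;> omega)
      (by funext t; simp only [Pi.add_apply]; fin_cases t <;> simp <;> omega)
      (by funext t; simp only [Pi.add_apply]; fin_cases t <;> simp <;> omega)
      (by funext t; simp only [Pi.add_apply, Pi.sub_apply]; fin_cases t <;> simp <;> omega)
    linear_combination this
  · have := quad (i := 0) (j := 2) (k := 1) (by decide) (by decide) (by decide)
      (m := ![0, (y + 1 : ℕ), d - y - 2]) (fun t => by fin_cases t <;> simp <;> omega)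
      (by simp) (x₁ := 1) (y₁ := y + 1) (x₂ := 0) (y₂ := y + 2) (x₃ := 0) (y₃ := y + 1)
      (x₄ := 1) (y₄ := y) (by omega) (by omega) (by omega) (by omega)
      (by funext t; simp only [Pi.add_apply]; fin_cases t <;> simp <;> omega)
      (by funext t; simp only [Pi.add_apply]; fin_cases t <;> simp <;> omega)
      (by funext t; simp only [Pi.add_apply]; fin_cases t <;> simp <;> omega)
      (by funext t; simp only [Pi.add_apply, Pi.sub_apply]; fin_cases t <;> simp <;> omega)
    linear_combination this
  · have := quad (i := 1) (j := 2) (k := 0) (by decide) (by decide) (by decide)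
      (m := ![(x + 1 : ℕ), 0, d - x - 2]) (fun t => by fin_cases t <;> simp <;> omega)
      (by simp) (x₁ := x + 1) (y₁ := 1) (x₂ := x + 2) (y₂ := 0) (x₃ := x + 1) (y₃ := 0)
      (x₄ := x) (y₄ := 1) (by omega) (by omega) (by omega) (by omega)
      (by funext t; simp only [Pi.add_apply]; fin_cases t <;> simp <;> omega)
      (by funext t; simp only [Pi.add_apply]; fin_cases t <;> simp <;> omega)
      (by funext t; simp only [Pi.add_apply]; fin_cases t <;> simp <;> omega)
      (by funext t; simp only [Pi.add_apply, Pi.sub_apply]; fin_cases t <;> simp <;> omega)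
    linear_combination this

end

end TCurve

theorem theorem3p7 (d : ℕ) (hd : 1 ≤ d) (σ : TCurve.SignDistribution d)
    (hσ : ∀ T T' : Geometry.SimplicialComplex ℝ (ℝ × ℝ),
      TCurve.IsUnimodularTriangulation d T → TCurve.IsUnimodularTriangulation d T' →
      TCurve.RootIsotopic T σ T' σ) :
    TCurve.SignEquivalent σ (TCurve.harnackSign d) := by
  exact TCurve.signEquivalent_of_rootIsotopic hd σ hσ
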